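/- Let $p\in[1,\infty)$. Let $\mu$ and $\mu_\varepsilon$ be probability measures on $\mathbb R$ ($\mu$ unknown, $\mu_\varepsilon$ known). One observes $Y_i=X_i+\varepsilon_i$, $i=1,\dots,n$, where $X_1,\dots,X_n$ are i.i.d. with law $\mu$, $\varepsilon_1,\dots,\varepsilon_n$ are i.i.d. with law $\mu_\varepsilon$, and $(X_1,\dots,X_n)$ is independent of $(\varepsilon_1,\dots,\varepsilon_n)$; $Y$ denotes a variable with the common law $\mu\star\mu_\varepsilon$ of the $Y_i$. Write $\mu_\varepsilon^*(t)=\int e^{itu}\mu_\varepsilon(du)$ and $f^*(t)=\int e^{itu}f(u)\,du$. For probability measures $\nu,\nu'$ on $\mathbb R$ let $W_p(\nu,\nu')=\inf_\pi\big(\int|x-y|^p\,\pi(dx,dy)\big)^{1/p}$, the infimum being over all couplings $\pi$ of $\nu$ and $\nu'$. Let $m_0$ be the least integer strictly greater than $p+\frac12$ and $m_1$ the least integer strictly greater than $p-\frac12$. *The estimator.* Let $k\ge 0$ be a symmetric function with $\int k=1$ whose Fourier transform $k^*$ is supported on $[-1,1]$ and is $\lceil p\rceil$ times differentiable with Lipschitz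 $\lceil p\rceil$-th derivative. Assume that $\mu_\varepsilon^*$ does not vanish. For a bandwidth $h>0$ put $$\tilde k_h(x)=\frac1{2\pi}\int\frac{e^{iux}k^*(u)}{\mu_\varepsilon^*(-u/h)}\,du,\qquad \hat F_n(t)=\frac1{nh}\int_{-\infty}^t\sum_{i=1}^n\tilde k_h\Big(\frac{u-Y_i}h\Big)du .$$ Given $\rho\ge 0$, let $\tilde\mu_n$ be a (random) probability measure whose distribution function $\tilde F_n$ satisfies, for every distribution function $G$, $$\int|x|^{p-1}|\hat F_n-\tilde F_n|(x)\,dx\le\int|x|^{p-1}|\hat F_n-G|(x)\,dx+\rho .$$ *Assumptions.* Let $r_\varepsilon=1/\mu_\varepsilon^*$ be twice continuously differentiable and $m_1$ times differentiable on $\mathbb R$, and $m_0$ times differentiable at every point of $[-2,2]$, and assume that $$\int_0^\infty x^{p-1}\sqrt{P(|Y|\ge x)}\,dx<\infty\quad\text{and}\quad\sup_{t\in[-2,2]}|r_\varepsilon^{(m_0)}(t)|<\infty .$$ (1) (Supersmooth case.) Assume that there are $\beta>0$, $\tilde\beta\ge0$, $\gamma>0$, $c>0$ with $|r_\varepsilon^{(\ell)}(t)|\le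 c(1+|t|)^{\tilde\beta}\exp(|t|^\beta/\gamma)$ for all $\ell\in\{0,\dots,m_1\}$ and $t\in\mathbb R$. Then there is a constant $C>0$ such that for every $n\ge2$ and every $0\le\rho\le n^{-1/2}$, the estimator with bandwidth $h=(4/(\gamma\log n))^{1/\beta}$ satisfies $$\mathbb E\,W_p^p(\tilde\mu_n,\mu)\le C(\log n)^{-p/\beta}.$$ (2) (Ordinary smooth case.) Assume that there are $\beta>0$, $c>0$ with $|r_\varepsilon^{(\ell)}(t)|\le c(1+|t|)^{\beta}$ for all $\ell\in\{0,\dots,m_1\}$ and $t\in\mathbb R$. Then there is a constant $C>0$ such that for every $n\ge2$ and every $0\le\rho\le n^{-1/2}$, the estimator with bandwidth $h=n^{-1/(2p+(2\beta-1)_+)}$ satisfies $\mathbb E\,W_p^p(\tilde\mu_n,\mu)\le C\psi_n$, where $$\psi_n=\begin{cases}n^{-p/(2p+2\beta-1)}&\text{if }\beta>\frac12,\\ \sqrt{\log n/n}&\text{if }\beta=\frac12,\\ n^{-1/2}&\text{if }\beta<\frac12.\end{cases}$$ In both cases $C$ does not depend on $n$, on $\rho$, on the probability space, or on the choice of the approximate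 minimizer $\tilde\mu_n$. -/

import Mathlib

open MeasureTheory ProbabilityTheory Set
open scoped ENNReal NNReal

noncomputable section

namespace WassersteinDeconvolution

/-- The Wasserstein distance of order `p` between two probability measures on the line: the infimum
of `(∫ |x - y| ^ p dπ(x, y)) ^ (1 / p)` over all couplings `π`, with values in `[0, ∞]`. -/
def wasserstein (p : ℝ) (μ ν : Measure ℝ) : ℝ≥0∞ :=
  ⨅ π : {π : Measure (ℝ × ℝ) // π.fst = μ ∧ π.snd = ν},
    (∫⁻ z, ENNReal.ofReal (|z.1 - z.2| ^ p) ∂π.1) ^ (1 / p)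

/-- The Fourier transform `x ↦ ∫ e^{iux} f(u) du` of a function. -/
def fourierStar (f : ℝ → ℝ) (x : ℝ) : ℂ :=
  ∫ u : ℝ, Complex.exp (Complex.I * u * x) * (f u : ℂ)

/-- The function `r = 1 / μ_ε^*`, where `μ_ε^*` is the characteristic function of the noise. -/
def invCharFun (με : Measure ℝ) (t : ℝ) : ℂ := 1 / charFun με t

/-- The least integer strictly greater than `p + 1/2`. -/
def mZero (p : ℝ) : ℕ := ⌊p + 1 / 2⌋₊ + 1

/-- The least integer strictly greater than `p - 1/2`. -/
def mOne (p : ℝ) : ℕ := ⌊p - 1 / 2⌋₊ + 1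

/-- Admissible kernels: symmetric probability densities whose Fourier transform is supported on
`[-1, 1]` and is `⌈p⌉` times differentiable with a Lipschitz `⌈p⌉`-th derivative. (As the last
derivative is Lipschitz, hence continuous, this is `ContDiff` of order `⌈p⌉`.) -/
structure IsKernel (p : ℝ) (k : ℝ → ℝ) : Prop where
  symm : ∀ x, k (-x) = k x
  nonneg : ∀ x, 0 ≤ k x
  integrable : Integrable k
  integral_eq_one : ∫ x, k x = 1
  contDiff : ContDiff ℝ (⌈p⌉₊ : ℕ) (fourierStar k)
  lipschitz : ∃ L : ℝ≥0, LipschitzWith L (iteratedDeriv ⌈p⌉₊ (fourierStar k))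
  support : ∀ u, u ∉ Icc (-1 : ℝ) 1 → fourierStar k u = 0

/-- The deconvolution kernel `x ↦ (2π)⁻¹ ∫ e^{iux} k^*(u) / μ_ε^*(-u/h) du`; the integral is a real
number by symmetry, and we take its real part to obtain an element of `ℝ`. -/
def deconvKernel (k : ℝ → ℝ) (με : Measure ℝ) (h x : ℝ) : ℝ :=
  ((1 / (2 * Real.pi) : ℂ) *
    ∫ u : ℝ, Complex.exp (Complex.I * u * x) * fourierStar k u / charFun με (-u / h)).re

/-- The preliminary estimator `F̂ₙ` of the distribution function of `μ`, from the observations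
`y 0, …, y (n - 1)` and with bandwidth `h`. -/
def prelimCDF (k : ℝ → ℝ) (με : Measure ℝ) (h : ℝ) {n : ℕ} (y : Fin n → ℝ) (t : ℝ) : ℝ :=
  1 / (n * h) * ∫ u in Iic t, ∑ i, deconvKernel k με h ((u - y i) / h)

/-- The loss `∫ |x| ^ (p - 1) |F(x) - G(x)| dx`, with values in `[0, ∞]`. -/
def cdfLoss (p : ℝ) (F G : ℝ → ℝ) : ℝ≥0∞ :=
  ∫⁻ x, ENNReal.ofReal (|x| ^ (p - 1) * |F x - G x|)

/-- `ν` is a probability measure whose distribution function minimizes, up to `ρ`, the loss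
`∫ |x| ^ (p - 1) |F(x) - G(x)| dx` over all distribution functions `G`. -/
def IsIsotoneApprox (p ρ : ℝ) (F : ℝ → ℝ) (ν : Measure ℝ) : Prop :=
  IsProbabilityMeasure ν ∧
    ∀ G : Measure ℝ, IsProbabilityMeasure G →
      cdfLoss p F (cdf ν) ≤ cdfLoss p F (cdf G) + ENNReal.ofReal ρ

/-- The convolution model: `X 0, …, X (n - 1)` are i.i.d. of law `μ`, `ε 0, …, ε (n - 1)` are i.i.d.
of law `με`, and the two families are independent of each other. -/
structure IsConvolutionSample {Ω : Type*} [MeasurableSpace Ω] (P : Measure Ω) (μ με : Measure ℝ)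
    {n : ℕ} (X ε : Fin n → Ω → ℝ) : Prop where
  measurable_signal : ∀ i, Measurable (X i)
  measurable_noise : ∀ i, Measurable (ε i)
  law_signal : ∀ i, P.map (X i) = μ
  law_noise : ∀ i, P.map (ε i) = με
  indep_signal : iIndepFun X P
  indep_noise : iIndepFun ε P
  indep : IndepFun (fun ω i => X i ω) (fun ω i => ε i ω) P

/-- `μt` is (a version of) the isotone deconvolution estimator of order `p`, kernel `k`,
bandwidth `h` and tolerance `ρ`, computed from the observations `Y i = X i + ε i`. -/
def IsIsotoneEstimator {Ω : Type*} (p ρ : ℝ) (k : ℝ → ℝ) (με : Measure ℝ) (h : ℝ) {n : ℕ}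
    (X ε : Fin n → Ω → ℝ) (μt : Ω → Measure ℝ) : Prop :=
  ∀ ω, IsIsotoneApprox p ρ (prelimCDF k με h (fun i => X i ω + ε i ω)) (μt ω)

/-- The rate in the ordinary smooth case. -/
def ordinaryRate (p β : ℝ) (n : ℕ) : ℝ :=
  if 1 / 2 < β then (n : ℝ) ^ (-(p / (2 * p + 2 * β - 1)))
  else if β = 1 / 2 then √(Real.log n / n)
  else 1 / √n

end WassersteinDeconvolution

end

open MeasureTheory ProbabilityTheory Set
open scoped ENNReal NNReal

noncomputable section

namespace WassersteinDeconvolution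

open Filter Topology FourierTransform SchwartzMap ComplexConjugate

/-! ### The inverse Fourier transform -/

/-! The Wasserstein loss is reduced to a weighted L¹ distance between distribution functions: on the
line, the quantile coupling gives W_p^p(ν, ν') ≤ 4^p ∫ |x|^(p-1) |F - G|
(`lintegral_quantileCoupling_le`). Let K_h be the law with density k(x/h)/h. Gluing the quantile
coupling of the estimator and μ ∗ K_h to the coupling (X + hξ, X) of μ ∗ K_h and μ costs a bias of
order h^p, since smoothness of k^* gives k a finite moment of order p. The preliminary estimator is
unbiased for the distribution function of μ ∗ K_h, and near-minimality of the isotone estimator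
costs only a factor 2 and the tolerance ρ ≤ n^(-1/2).

It remains to bound the expected weighted L¹ error of the preliminary estimator. At each x it is at
most n^(-1/2) times the standard deviation of one summand, and the variance may be replaced by the
second moment about 1_{x ≥ 0}, a centring for which the bound is integrable at both ends of the
line. A summand is the primitive, evaluated at x - Y, of the deconvolution density, whose Fourier
transform is k^*(hw) r(w) with r = 1/μ_ε^*. A smooth cutoff φ separates the frequencies.

Low frequencies: the part with transform φ(w) k^*(hw) r(w) has integral one and a weighted L¹ norm
of order p bounded uniformly in h. Indeed m_0 bounded derivatives of r on [-2, 2] give a weighted L²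
bound by Plancherel, and m_0 > p + 1/2 turns it into a weighted L¹ bound by Cauchy-Schwarz. The tail
condition on Y then makes the contribution bounded (`lintegral_rpow_half_integral_Iic_le`).

High frequencies: the primitive is itself an inverse Fourier transform, that of i (1 - φ(w))/w ·
k^*(hw) r(w). The division by w gains a factor 1/(1 + |w|), so m_1 derivatives and Plancherel bound
its weighted L² norm by the root of S(h) = ∫_{|w| ≤ 1/h} (b(w)/(1 + |w|))² dw, where b dominates the
derivatives of r. As m_1 > p - 1/2, the tail condition allows the convolution with the law of Y
(`exists_lintegral_rpow_half_conv_le`).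

Altogether the risk is at most K (n^(-1/2) (1 + S(h)^(1/2)) + h^p) (`IsKernel.exists_risk_le`), and
the rates follow by estimating S(h) at the prescribed bandwidths. -/

/-- Plancherel's identity for functions that are both integrable and square integrable. -/
theorem eLpNorm_fourier_eq {f : ℝ → ℂ} (h1 : Integrable f) (h2 : MemLp f 2) :
    eLpNorm (𝓕 f) 2 volume = eLpNorm f 2 volume := by
  set F : Lp ℂ 2 (volume : Measure ℝ) := h2.toLp f with hF
  -- Plancherel is known for the Fourier transform on L². It agrees almost everywhere with the
  -- Fourier integral because both give the same pairings with test functions: one through tempered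
  -- distributions, the other by moving the transform onto the test function.
  have key : ∀ᵐ x, (𝓕 F : Lp ℂ 2 (volume : Measure ℝ)) x = 𝓕 f x := by
    apply ae_eq_of_integral_contDiff_smul_eq
    · exact (Lp.memLp (𝓕 F)).locallyIntegrable (by norm_num)
    · exact (VectorFourier.fourierIntegral_continuous Real.continuous_fourierChar
        (by fun_prop) h1).locallyIntegrable
    intro g hg hgc
    let η : 𝓢(ℝ, ℂ) := HasCompactSupport.toSchwartzMap (f := fun x => (g x : ℂ))
      (hgc.comp_left (g := ((↑) : ℝ → ℂ)) rfl) (Complex.ofRealCLM.contDiff.comp hg)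
    have e1 := congrArg (fun T => T η) (Lp.fourier_toTemperedDistribution_eq F)
    simp only [TemperedDistribution.fourier_apply, Lp.toTemperedDistribution_apply] at e1
    have e2 : ∫ x, g x • (𝓕 F : Lp ℂ 2 (volume : Measure ℝ)) x =
        ∫ x, η x • (𝓕 F : Lp ℂ 2 (volume : Measure ℝ)) x := rfl
    have e3 : ∫ x, (𝓕 η) x • F x = ∫ x, (𝓕 (η : ℝ → ℂ)) x • f x := by
      apply integral_congr_ae
      filter_upwards [h2.coeFn_toLp] with x hx
      rw [hx]; rfl
    rw [e2, ← e1, e3]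
    have e4 := VectorFourier.integral_fourierIntegral_smul_eq_flip (L := innerₗ ℝ)
      Real.continuous_fourierChar (by fun_prop) (η.integrable (μ := volume)) h1
    rw [flip_innerₗ] at e4
    exact e4
  rw [← eLpNorm_congr_ae key, ← eLpNorm_congr_ae h2.coeFn_toLp]
  have := Lp.norm_fourier_eq F
  rw [Lp.norm_def, Lp.norm_def] at this
  exact (ENNReal.toReal_eq_toReal_iff' (Lp.eLpNorm_ne_top _) (Lp.eLpNorm_ne_top _)).1 this

/-- The inverse Fourier transform `v ↦ (2π)⁻¹ ∫ e^{-iwv} f(w) dw`. -/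
def invFourier (f : ℝ → ℂ) (v : ℝ) : ℂ := (1 / (2 * Real.pi) : ℂ) * 𝓕 f (v / (2 * Real.pi))

theorem invFourier_eq_integral (f : ℝ → ℂ) (v : ℝ) :
    invFourier f v =
      (1 / (2 * Real.pi) : ℂ) * ∫ w : ℝ, Complex.exp (-(Complex.I * w * v)) * f w := by
  rw [invFourier, Real.fourier_real_eq_integral_exp_smul]
  congr 1
  refine integral_congr_ae (.of_forall fun w => ?_)
  simp only [smul_eq_mul]
  congr 2
  push_cast
  have : (Real.pi : ℂ) ≠ 0 := by exact_mod_cast Real.pi_ne_zero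
  field_simp

theorem continuous_invFourier {f : ℝ → ℂ} (hf : Integrable f) : Continuous (invFourier f) := by
  have : Continuous (𝓕 f) := VectorFourier.fourierIntegral_continuous
    Real.continuous_fourierChar (by fun_prop) hf
  unfold invFourier
  fun_prop

theorem tendsto_invFourier_atBot (f : ℝ → ℂ) : Tendsto (invFourier f) atBot (𝓝 0) := by
  have h1 : Tendsto (𝓕 f) atBot (𝓝 0) :=
    (Real.zero_at_infty_fourier f).mono_left (by rw [cocompact_eq_atBot_atTop]; exact le_sup_left)
  have h2 : Tendsto (fun v : ℝ => v / (2 * Real.pi)) atBot atBot :=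
    tendsto_id.atBot_div_const (by positivity)
  unfold invFourier
  simpa using (h1.comp h2).const_mul (1 / (2 * Real.pi) : ℂ)

theorem lintegral_comp_div {g : ℝ → ℝ≥0∞} {c : ℝ} (hc : 0 < c) :
    ∫⁻ v, g (v / c) = ENNReal.ofReal c * ∫⁻ v, g v := by
  have hm := Real.map_volume_mul_left (a := c⁻¹) (inv_ne_zero hc.ne')
  have he : MeasurableEmbedding (fun v : ℝ => c⁻¹ * v) :=
    (Homeomorph.mulLeft₀ c⁻¹ (inv_ne_zero hc.ne')).measurableEmbedding
  have := he.lintegral_map (μ := volume) g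
  change ∫⁻ v, g v ∂(Measure.map (c⁻¹ * ·) volume) = _ at this
  rw [hm, lintegral_smul_measure, inv_inv, abs_of_pos hc] at this
  simp only [div_eq_inv_mul]
  exact this.symm

/-- Plancherel and the change of variables give the exact constant 1/(2π); only the bound by 1 is
kept. -/
theorem lintegral_sq_invFourier_le {f : ℝ → ℂ} (h1 : Integrable f) (h2 : MemLp f 2) :
    ∫⁻ v, ‖invFourier f v‖ₑ ^ 2 ≤ ∫⁻ w, ‖f w‖ₑ ^ 2 := by
  have hP : ∫⁻ v, ‖𝓕 f v‖ₑ ^ 2 = ∫⁻ w, ‖f w‖ₑ ^ 2 := by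
    have := eLpNorm_fourier_eq h1 h2
    rw [eLpNorm_eq_lintegral_rpow_enorm_toReal (by norm_num) (by norm_num),
      eLpNorm_eq_lintegral_rpow_enorm_toReal (by norm_num) (by norm_num)] at this
    simpa using (ENNReal.rpow_left_injective (by norm_num : (1 / (2 : ℝ)) ≠ 0))
      (by simpa using this)
  have hpi : (1 : ℝ) ≤ 2 * Real.pi := by linarith [Real.pi_gt_three]
  have hc : ‖(1 / (2 * Real.pi) : ℂ)‖ₑ = ENNReal.ofReal (1 / (2 * Real.pi)) := by
    rw [← ofReal_norm]
    congr 1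
    simp [abs_of_pos Real.pi_pos]
  simp only [invFourier, enorm_mul, mul_pow]
  rw [lintegral_const_mul' _ _ (by rw [hc]; exact ENNReal.pow_ne_top ENNReal.ofReal_ne_top),
    lintegral_comp_div (g := fun v => ‖𝓕 f v‖ₑ ^ 2)
    (by positivity), hP, ← mul_assoc, hc]
  refine (mul_le_mul_left ?_ _).trans (one_mul _).le
  rw [← ENNReal.ofReal_pow (by positivity), ← ENNReal.ofReal_mul (by positivity),
    ENNReal.ofReal_le_one]
  have : (1 / (2 * Real.pi)) ^ 2 * (2 * Real.pi) = 1 / (2 * Real.pi) := by field_simp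
  rw [this]
  exact (div_le_one (by positivity)).2 hpi

theorem invFourier_deriv {f : ℝ → ℂ} (hf : Integrable f) (hd : Differentiable ℝ f)
    (hf' : Integrable (deriv f)) (v : ℝ) :
    invFourier (deriv f) v = Complex.I * v * invFourier f v := by
  have : (Real.pi : ℂ) ≠ 0 := by exact_mod_cast Real.pi_ne_zero
  rw [invFourier, Real.fourier_deriv hf hd hf', invFourier]
  simp only [smul_eq_mul]
  push_cast
  field_simp

theorem hasDerivAt_invFourier {f : ℝ → ℂ} (hf : Integrable f)
    (hf' : Integrable (fun x : ℝ => (x : ℂ) * f x)) (v : ℝ) :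
    HasDerivAt (invFourier f) (invFourier (fun w => -Complex.I * w * f w) v) v := by
  have hpi : (Real.pi : ℂ) ≠ 0 := by exact_mod_cast Real.pi_ne_zero
  have h := Real.hasDerivAt_fourier hf (by simpa using hf') (v / (2 * Real.pi))
  have h2 := (h.scomp v ((hasDerivAt_id v).div_const (2 * Real.pi))).const_mul
    (1 / (2 * Real.pi) : ℂ)
  have h3 : HasDerivAt (invFourier f) _ v := h2
  convert h3 using 1
  rw [invFourier, Real.fourier_real_eq_integral_exp_smul, Real.fourier_real_eq_integral_exp_smul,
    Complex.real_smul]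
  congr 1
  rw [← integral_const_mul]
  refine integral_congr_ae (.of_forall fun w => ?_)
  simp only [smul_eq_mul]
  push_cast
  field_simp

theorem integral_exp_mul_invFourier {f : ℝ → ℂ} (hc : Continuous f) (hf : Integrable f)
    (hi : Integrable (invFourier f)) (t : ℝ) :
    ∫ v : ℝ, Complex.exp (Complex.I * t * v) * invFourier f v = f t := by
  have hpi : (Real.pi : ℂ) ≠ 0 := by exact_mod_cast Real.pi_ne_zero
  have hpi2 : (2 * Real.pi : ℝ) ≠ 0 := by positivity
  have hiF : Integrable (𝓕 f) := by
    have := (hi.comp_mul_left' hpi2).const_mul (2 * Real.pi : ℂ)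
    refine this.congr (.of_forall fun x => ?_)
    simp only [invFourier]
    rw [mul_div_cancel_left₀ _ hpi2]
    field_simp
  have hinv := congrFun (hc.fourierInv_fourier_eq hf hiF) t
  rw [← hinv, Real.fourierInv_eq_fourier_neg, Real.fourier_real_eq_integral_exp_smul]
  have hs := Measure.integral_comp_div
    (fun s : ℝ => Complex.exp (((-2 * Real.pi * s * -t : ℝ) : ℂ) * Complex.I) • 𝓕 f s) (2 * Real.pi)
  rw [abs_of_pos (by positivity), ] at hs
  have : ∫ v : ℝ, Complex.exp (Complex.I * t * v) * invFourier f v = ∫ v : ℝ,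
      (1 / (2 * Real.pi) : ℂ) * (Complex.exp (((-2 * Real.pi * (v / (2 * Real.pi)) * -t : ℝ) : ℂ)
        * Complex.I) • 𝓕 f (v / (2 * Real.pi))) := by
    refine integral_congr_ae (.of_forall fun v => ?_)
    simp only [invFourier, smul_eq_mul]
    rw [mul_left_comm]
    congr 3
    push_cast
    field_simp
  rw [this, integral_const_mul, hs, Complex.real_smul, ← mul_assoc]
  push_cast
  rw [one_div, inv_mul_cancel₀ (by simp), one_mul]

/-! ### Pointwise bounds on the derivatives of a function -/

/-- On `S`, the function `f` is `m` times differentiable, and its derivatives of order `0, …, m` are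
bounded by `b`. The last derivative need not be continuous. -/
def DerivBound (S : Set ℝ) : ℕ → (ℝ → ℝ) → (ℝ → ℂ) → Prop
  | 0, b, f => ∀ t ∈ S, ‖f t‖ ≤ b t
  | m + 1, b, f => (∀ t ∈ S, ‖f t‖ ≤ b t) ∧ (∀ t ∈ S, DifferentiableAt ℝ f t) ∧
      DerivBound S m b (deriv f)

namespace DerivBound

variable {S T : Set ℝ} {m : ℕ} {b b' : ℝ → ℝ} {f g : ℝ → ℂ}

theorem norm_le (h : DerivBound S m b f) : ∀ t ∈ S, ‖f t‖ ≤ b t := by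
  cases m with
  | zero => exact h
  | succ m => exact h.1

theorem mono (h : DerivBound S m b f) (hb : ∀ t ∈ S, b t ≤ b' t) : DerivBound S m b' f := by
  induction m generalizing f with
  | zero => exact fun t ht => (h t ht).trans (hb t ht)
  | succ m ih => exact ⟨fun t ht => (h.1 t ht).trans (hb t ht), h.2.1, ih h.2.2⟩

theorem congr (hS : IsOpen S) (h : DerivBound S m b f) (hfg : EqOn f g S) : DerivBound S m b g := by
  induction m generalizing f g with
  | zero => exact fun t ht => by rw [← hfg ht]; exact h t ht
  | succ m ih =>
    have hev : ∀ t ∈ S, g =ᶠ[𝓝 t] f := fun t ht => by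
      filter_upwards [hS.mem_nhds ht] with s hs using (hfg hs).symm
    refine ⟨fun t ht => by rw [← hfg ht]; exact h.1 t ht,
      fun t ht => (h.2.1 t ht).congr_of_eventuallyEq (hev t ht), ih h.2.2 fun t ht => ?_⟩
    exact ((hev t ht).deriv_eq).symm

theorem of_succ (h : DerivBound S (m + 1) b f) : DerivBound S m b f := by
  induction m generalizing f with
  | zero => exact h.1
  | succ m ih => exact ⟨h.1, h.2.1, ih h.2.2⟩

theorem union (h : DerivBound S m b f) (h' : DerivBound T m b f) : DerivBound (S ∪ T) m b f := by
  induction m generalizing f with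
  | zero => exact fun t ht => ht.elim (h t) (h' t)
  | succ m ih =>
    exact ⟨fun t ht => ht.elim (h.1 t) (h'.1 t), fun t ht => ht.elim (h.2.1 t) (h'.2.1 t),
      ih h.2.2 h'.2.2⟩

theorem zero (hb : ∀ t ∈ S, 0 ≤ b t) : DerivBound S m b 0 := by
  induction m with
  | zero => exact fun t ht => by simpa using hb t ht
  | succ m ih =>
    refine ⟨fun t ht => by simpa using hb t ht, fun t _ => differentiableAt_const _, ?_⟩
    have : deriv (0 : ℝ → ℂ) = 0 := by ext; simp
    rwa [this]

theorem add (hS : IsOpen S) (h : DerivBound S m b f) (h' : DerivBound S m b' g) :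
    DerivBound S m (fun t => b t + b' t) (fun t => f t + g t) := by
  induction m generalizing f g with
  | zero => exact fun t ht => (norm_add_le _ _).trans (add_le_add (h t ht) (h' t ht))
  | succ m ih =>
    refine ⟨fun t ht => (norm_add_le _ _).trans (add_le_add (h.1 t ht) (h'.1 t ht)),
      fun t ht => (h.2.1 t ht).add (h'.2.1 t ht), (ih h.2.2 h'.2.2).congr hS fun t ht => ?_⟩
    exact (deriv_fun_add (h.2.1 t ht) (h'.2.1 t ht)).symm

/-- By the Leibniz rule each differentiation doubles the number of products, whence the factor 2^m.
-/
theorem mul (hS : IsOpen S) (h : DerivBound S m b f) (h' : DerivBound S m b' g) :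
    DerivBound S m (fun t => 2 ^ m * (b t * b' t)) (fun t => f t * g t) := by
  have hn : ∀ {m : ℕ} {f g : ℝ → ℂ}, DerivBound S m b f → DerivBound S m b' g → ∀ t ∈ S,
      ‖f t * g t‖ ≤ 2 ^ m * (b t * b' t) := fun {m f g} h h' t ht => by
    have h1 := h.norm_le t ht
    have h2 := h'.norm_le t ht
    have h3 : ‖f t * g t‖ ≤ b t * b' t := by
      rw [norm_mul]
      exact mul_le_mul h1 h2 (norm_nonneg _) ((norm_nonneg _).trans h1)
    exact h3.trans (le_mul_of_one_le_left ((norm_nonneg _).trans h3) (one_le_pow₀ one_le_two))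
  induction m generalizing f g with
  | zero => exact hn h h'
  | succ m ih =>
    refine ⟨hn h h', fun t ht => (h.2.1 t ht).mul (h'.2.1 t ht), ?_⟩
    refine (((ih h.2.2 h'.of_succ).add hS (ih h.of_succ h'.2.2)).mono fun t _ => ?_).congr hS
      fun t ht => ?_
    · exact (by ring : (2 : ℝ) ^ m * (b t * b' t) + 2 ^ m * (b t * b' t) =
        2 ^ (m + 1) * (b t * b' t)).le
    · exact (deriv_fun_mul (h.2.1 t ht) (h'.2.1 t ht)).symm

theorem const_mul (hS : IsOpen S) (a : ℂ) (h : DerivBound S m b f) :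
    DerivBound S m (fun t => ‖a‖ * b t) (fun t => a * f t) := by
  have hn : ∀ {f : ℝ → ℂ}, (∀ t ∈ S, ‖f t‖ ≤ b t) → ∀ t ∈ S, ‖a * f t‖ ≤ ‖a‖ * b t :=
    fun {f} hf t ht => by rw [norm_mul]; gcongr; exact hf t ht
  induction m generalizing f with
  | zero => exact hn h
  | succ m ih =>
    refine ⟨hn h.1, fun t ht => (h.2.1 t ht).const_mul _, (ih h.2.2).congr hS fun t ht => ?_⟩
    exact (deriv_const_mul _ (h.2.1 t ht)).symm

theorem of_iteratedDeriv (hd : ∀ ℓ < m, ∀ t ∈ S, DifferentiableAt ℝ (iteratedDeriv ℓ f) t)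
    (hb : ∀ ℓ ≤ m, ∀ t ∈ S, ‖iteratedDeriv ℓ f t‖ ≤ b t) : DerivBound S m b f := by
  induction m generalizing f with
  | zero => exact fun t ht => by simpa using hb 0 le_rfl t ht
  | succ m ih =>
    refine ⟨fun t ht => by simpa using hb 0 (Nat.zero_le _) t ht,
      fun t ht => by simpa using hd 0 (Nat.succ_pos _) t ht, ih (fun ℓ hℓ t ht => ?_)
      fun ℓ hℓ t ht => ?_⟩
    · simpa only [iteratedDeriv_succ'] using hd (ℓ + 1) (by omega) t ht
    · simpa only [iteratedDeriv_succ'] using hb (ℓ + 1) (by omega) t ht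

/-- On a compact set, one constant bounds all derivatives of order less than `m`, as these are
continuous, and the last one if it is bounded. -/
theorem exists_of_bddAbove {K : Set ℝ} (hK : IsCompact K)
    (hd : ∀ ℓ < m, ∀ t ∈ K, DifferentiableAt ℝ (iteratedDeriv ℓ f) t)
    (hM : ∃ M, ∀ t ∈ K, ‖iteratedDeriv m f t‖ ≤ M) :
    ∃ c, 0 ≤ c ∧ DerivBound K m (fun _ => c) f := by
  have hb : ∀ ℓ ≤ m, ∃ M, ∀ t ∈ K, ‖iteratedDeriv ℓ f t‖ ≤ M := fun ℓ hℓ => by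
    rcases hℓ.eq_or_lt with rfl | hlt
    · exact hM
    · exact hK.exists_bound_of_continuousOn fun t ht =>
        (hd ℓ hlt t ht).continuousAt.continuousWithinAt
  choose! M hM' using hb
  refine ⟨∑ ℓ ∈ Finset.range (m + 1), |M ℓ|, Finset.sum_nonneg fun _ _ => abs_nonneg _,
    of_iteratedDeriv hd fun ℓ hℓ t ht => (hM' ℓ hℓ t ht).trans ((le_abs_self _).trans ?_)⟩
  exact Finset.single_le_sum (f := fun ℓ => |M ℓ|) (fun _ _ => abs_nonneg _)
    (Finset.mem_range.2 (by omega))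

theorem subset (h : DerivBound T m b f) (hST : S ⊆ T) : DerivBound S m b f := by
  induction m generalizing f with
  | zero => exact fun t ht => h t (hST ht)
  | succ m ih => exact ⟨fun t ht => h.1 t (hST ht), fun t ht => h.2.1 t (hST ht), ih h.2.2⟩

theorem of_support_subset {R : ℝ} (hb : ∀ t, 0 ≤ b t) (hf : ∀ t, R < |t| → f t = 0) :
    DerivBound {t | R < |t|} m b f :=
  (zero fun t _ => hb t).congr (isOpen_lt continuous_const continuous_abs)
    fun t ht => (hf t ht).symm

/-- A compactly supported function of class `C^m` has uniformly bounded derivatives. -/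
theorem exists_of_contDiff {R : ℝ} (hf : ContDiff ℝ m f) (hR : ∀ t, R < |t| → f t = 0) :
    ∃ c, 0 ≤ c ∧ DerivBound univ m (fun _ => c) f := by
  obtain ⟨c, hc, h⟩ := exists_of_bddAbove (f := f) (m := m)
    (isCompact_Icc (a := -(R + 1)) (b := R + 1))
    (fun ℓ hℓ t _ => (hf.differentiable_iteratedDeriv ℓ (by exact_mod_cast hℓ)) t)
    (isCompact_Icc.exists_bound_of_continuousOn (hf.continuous_iteratedDeriv m le_rfl).continuousOn)
  refine ⟨c, hc, (h.union (of_support_subset (fun _ => hc) hR)).subset fun t _ => ?_⟩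
  by_cases ht : R < |t|
  · exact .inr ht
  · exact .inl (abs_le.1 (by linarith [not_lt.1 ht]))

/-- The ℓ-th derivative acquires the factor h^ℓ; the single constant (1 + h)^m dominates all of
these for ℓ ≤ m and is monotone in h. -/
theorem comp_mul_left {c h : ℝ} (hh : 0 ≤ h) (hf : DerivBound univ m (fun _ => c) f) :
    DerivBound univ m (fun _ => (1 + h) ^ m * c) (fun t => f (h * t)) := by
  have hpow : ∀ m : ℕ, (1 : ℝ) ≤ (1 + h) ^ m := fun m => one_le_pow₀ (by linarith)
  induction m generalizing f c with
  | zero => exact fun t _ => by simpa using hf (h * t) trivial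
  | succ m ih =>
    have hc : 0 ≤ c := (norm_nonneg _).trans (hf.1 0 trivial)
    refine ⟨fun t _ => (hf.1 (h * t) trivial).trans (le_mul_of_one_le_left hc (hpow _)),
      fun t _ => ?_, ?_⟩
    · exact (hf.2.1 (h * t) trivial).comp t ((differentiableAt_id).const_mul h)
    · have h1 := ih (f := fun t => h * deriv f t) (c := (1 + h) * c)
        ((hf.2.2.const_mul isOpen_univ h).mono fun t _ => ?_)
      · refine (h1.mono fun t _ => ?_).congr isOpen_univ fun t _ => ?_
        · exact (by ring : (1 + h) ^ m * ((1 + h) * c) = (1 + h) ^ (m + 1) * c).le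
        · rw [deriv_comp_mul_left, Complex.real_smul]
      · rw [Complex.norm_real, Real.norm_of_nonneg hh]
        gcongr
        linarith

end DerivBound

theorem deriv_eq_zero_of_support {R : ℝ} {f : ℝ → ℂ} (hf : ∀ t, R < |t| → f t = 0) :
    ∀ t, R < |t| → deriv f t = 0 := fun t ht => by
  have : f =ᶠ[𝓝 t] fun _ => 0 := by
    filter_upwards [(isOpen_lt continuous_const continuous_abs).mem_nhds ht] with s hs using hf s hs
  rw [this.deriv_eq, deriv_const]

/-! ### Weighted L² bounds for inverse Fourier transforms -/

section moments

variable {R : ℝ} {b : ℝ → ℝ} {f : ℝ → ℂ}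

theorem memLp_of_support (q : ℝ≥0∞) (hm : Measurable f) (hb : Continuous b)
    (hf : ∀ t, ‖f t‖ ≤ b t) (hR : ∀ t, R < |t| → f t = 0) : MemLp f q := by
  obtain ⟨M, hM⟩ := (isCompact_Icc (a := -R) (b := R)).exists_bound_of_continuousOn hb.continuousOn
  have h : f = (Icc (-R) R).indicator f := by
    ext t
    by_cases ht : t ∈ Icc (-R) R
    · simp [ht]
    · rw [indicator_of_notMem ht]
      exact hR t (by rw [mem_Icc, ← abs_le] at ht; exact not_le.1 ht)
  rw [h, memLp_indicator_iff_restrict measurableSet_Icc]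
  refine MemLp.of_bound hm.aestronglyMeasurable M ?_
  filter_upwards [ae_restrict_mem measurableSet_Icc] with t ht
  exact (hf t).trans ((le_abs_self _).trans (hM t ht))

theorem integrable_of_support (hm : Measurable f) (hb : Continuous b)
    (hf : ∀ t, ‖f t‖ ≤ b t) (hR : ∀ t, R < |t| → f t = 0) : Integrable f :=
  memLp_one_iff_integrable.1 (memLp_of_support 1 hm hb hf hR)

/-- Each derivative of f multiplies its inverse transform by iv, so the estimate is Plancherel for
the m-th derivative. That derivative need only be measurable and bounded by b, with support in [-R,
R]. -/
theorem lintegral_pow_mul_sq_invFourier_le {m : ℕ} (hm : Measurable f) (hb : Continuous b)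
    (h : DerivBound univ m b f) (hR : ∀ t, R < |t| → f t = 0) :
    ∫⁻ v, ENNReal.ofReal (|v| ^ (2 * m) * ‖invFourier f v‖ ^ 2) ≤
      ∫⁻ w in Icc (-R) R, ENNReal.ofReal (b w ^ 2) := by
  induction m generalizing f with
  | zero =>
    have hle : ∀ t, ‖f t‖ ≤ b t := fun t => h t trivial
    refine le_trans (le_of_eq (lintegral_congr fun v => ?_)) ((lintegral_sq_invFourier_le
      (integrable_of_support hm hb hle hR) (memLp_of_support 2 hm hb hle hR)).trans ?_)
    · rw [mul_zero, pow_zero, one_mul, ENNReal.ofReal_pow (norm_nonneg _), ofReal_norm]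
    · rw [← lintegral_indicator measurableSet_Icc]
      refine lintegral_mono fun t => ?_
      by_cases ht : t ∈ Icc (-R) R
      · rw [indicator_of_mem ht, ← ofReal_norm, ← ENNReal.ofReal_pow (norm_nonneg _)]
        exact ENNReal.ofReal_le_ofReal (by gcongr; exact hle t)
      · rw [hR t (by rw [mem_Icc, ← abs_le] at ht; exact not_le.1 ht)]
        simp
  | succ m ih =>
    have hR' := deriv_eq_zero_of_support hR
    refine le_trans (le_of_eq (lintegral_congr fun v => ?_)) (ih (measurable_deriv f) h.2.2 hR')
    rw [invFourier_deriv (integrable_of_support hm hb (fun t => h.1 t trivial) hR)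
      (fun t => h.2.1 t trivial) (integrable_of_support (measurable_deriv f) hb
      (fun t => h.2.2.norm_le t trivial) hR')]
    simp only [norm_mul, Complex.norm_I, Complex.norm_real, Real.norm_eq_abs]
    congr 1
    ring

theorem DerivBound.zero_order {S : Set ℝ} {m : ℕ} (h : DerivBound S m b f) : DerivBound S 0 b f :=
  h.norm_le

theorem lintegral_one_add_pow_mul_sq_invFourier_le {m : ℕ} (hm : Measurable f) (hb : Continuous b)
    (h : DerivBound univ m b f) (hR : ∀ t, R < |t| → f t = 0) :
    ∫⁻ v, ENNReal.ofReal ((1 + |v|) ^ (2 * m) * ‖invFourier f v‖ ^ 2) ≤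
      ENNReal.ofReal (2 * 4 ^ m) * ∫⁻ w in Icc (-R) R, ENNReal.ofReal (b w ^ 2) := by
  have h0 := lintegral_pow_mul_sq_invFourier_le hm hb h.zero_order hR
  have h1 := lintegral_pow_mul_sq_invFourier_le hm hb h hR
  have hcont := continuous_invFourier
    (integrable_of_support hm hb (fun t => h.norm_le t trivial) hR)
  calc ∫⁻ v, ENNReal.ofReal ((1 + |v|) ^ (2 * m) * ‖invFourier f v‖ ^ 2)
      ≤ ∫⁻ v, ENNReal.ofReal (4 ^ m) * (ENNReal.ofReal (|v| ^ (2 * 0) * ‖invFourier f v‖ ^ 2) +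
          ENNReal.ofReal (|v| ^ (2 * m) * ‖invFourier f v‖ ^ 2)) := by
        refine lintegral_mono fun v => ?_
        rw [← ENNReal.ofReal_add (by positivity) (by positivity),
          ← ENNReal.ofReal_mul (by positivity)]
        refine ENNReal.ofReal_le_ofReal ?_
        -- This allows the estimates of orders 0 and m to be added, which is the source of the
        -- factor 2 · 4^m.
        have : (1 + |v|) ^ (2 * m) ≤ 4 ^ m * (1 + |v| ^ (2 * m)) := by
          rw [pow_mul, pow_mul]
          have e1 : (1 + |v|) ^ 2 ≤ 4 * max 1 (|v| ^ 2) := by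
            rcases le_total |v| 1 with hv | hv
            · nlinarith [le_max_left 1 (|v| ^ 2), abs_nonneg v]
            · nlinarith [le_max_right 1 (|v| ^ 2), abs_nonneg v]
          calc ((1 + |v|) ^ 2) ^ m ≤ (4 * max 1 (|v| ^ 2)) ^ m := by gcongr
            _ = 4 ^ m * (max 1 (|v| ^ 2)) ^ m := mul_pow _ _ _
            _ ≤ 4 ^ m * (1 + (|v| ^ 2) ^ m) := by
              gcongr
              rcases max_choice 1 (|v| ^ 2) with e | e <;> rw [e]
              · rw [one_pow]; linarith [pow_nonneg (sq_nonneg |v|) m]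
              · linarith
        calc _ ≤ 4 ^ m * (1 + |v| ^ (2 * m)) * ‖invFourier f v‖ ^ 2 := by gcongr
          _ = _ := by ring
    _ ≤ _ := by
        rw [lintegral_const_mul' _ _ ENNReal.ofReal_ne_top, lintegral_add_left (by fun_prop),
          ENNReal.ofReal_mul (by positivity), mul_comm (ENNReal.ofReal 2), mul_assoc]
        gcongr
        rw [ENNReal.ofReal_ofNat, two_mul (∫⁻ w in Icc (-R) R, ENNReal.ofReal (b w ^ 2))]
        exact add_le_add h0 h1

end moments

/-! ### The frequency cutoff -/

/-- A smooth bump function, equal to `1` on `[-1, 1]` and to `0` outside `[-3/2, 3/2]`. -/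
def bump : ContDiffBump (0 : ℝ) := ⟨1, 3 / 2, by norm_num, by norm_num⟩

/-- The smooth cutoff to low frequencies. -/
def cutoff (w : ℝ) : ℂ := (bump w : ℝ)

/-- The smooth function `w ↦ (1 - φ(w)) / w`, where `φ` is the cutoff. -/
def cutoffQuot (w : ℝ) : ℂ := (1 - cutoff w) / w

theorem contDiff_cutoff {n : ℕ∞} : ContDiff ℝ n cutoff :=
  Complex.ofRealCLM.contDiff.comp bump.contDiff

theorem cutoff_eq_one {w : ℝ} (hw : |w| ≤ 1) : cutoff w = 1 := by
  have : bump w = 1 := bump.one_of_mem_closedBall (by simpa [bump] using hw)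
  simp [cutoff, this]

theorem cutoff_eq_zero {w : ℝ} (hw : 3 / 2 ≤ |w|) : cutoff w = 0 := by
  have : bump w = 0 := bump.zero_of_le_dist (by simpa [bump] using hw)
  simp [cutoff, this]

theorem integrable_cutoff_mul {f : ℝ → ℂ} (hf : Continuous f) :
    Integrable fun w => cutoff w * f w :=
  ((contDiff_cutoff (n := 0)).continuous.mul hf).integrable_of_hasCompactSupport
    (HasCompactSupport.of_support_subset_isCompact (isCompact_Icc (a := -2) (b := 2))
      fun w hw => by
        by_contra hw'
        rw [mem_Icc, ← abs_le, not_le] at hw'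
        exact hw (by rw [Pi.mul_apply, cutoff_eq_zero (by linarith), zero_mul]))

theorem cutoffQuot_eq_zero {w : ℝ} (hw : |w| ≤ 1) : cutoffQuot w = 0 := by
  simp [cutoffQuot, cutoff_eq_one hw]

theorem mul_cutoffQuot (w : ℝ) : (w : ℂ) * cutoffQuot w = 1 - cutoff w := by
  rcases eq_or_ne w 0 with rfl | hw
  · simp [cutoff_eq_one]
  · rw [cutoffQuot, mul_div_cancel₀]
    exact_mod_cast hw

/-- The only possible singularity is at the origin, and the quotient vanishes in a neighbourhood of
it. -/
theorem contDiff_cutoffQuot : ContDiff ℝ (⊤ : ℕ∞) cutoffQuot := by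
  rw [contDiff_iff_contDiffAt]
  intro w
  by_cases hw : |w| < 1
  · refine (contDiffAt_const (c := (0 : ℂ))).congr_of_eventuallyEq ?_
    filter_upwards [(isOpen_lt continuous_abs continuous_const).mem_nhds hw] with s hs
    exact cutoffQuot_eq_zero (le_of_lt hs)
  · have hw0 : (w : ℂ) ≠ 0 := by
      rintro h
      simp [Complex.ofReal_eq_zero.1 h] at hw
    have hs : ContDiffAt ℝ (⊤ : ℕ∞) (fun w : ℝ => (w : ℂ)) w :=
      Complex.ofRealCLM.contDiff.contDiffAt
    have hq : ContDiffAt ℝ (⊤ : ℕ∞) (fun w : ℝ => (1 - cutoff w) * (w : ℂ)⁻¹) w :=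
      (contDiffAt_const.sub contDiff_cutoff.contDiffAt).mul (hs.inv hw0)
    exact hq

theorem DerivBound.const {S : Set ℝ} {m : ℕ} (a : ℂ) :
    DerivBound S m (fun _ => ‖a‖) (fun _ => a) := by
  cases m with
  | zero => exact fun _ _ => le_rfl
  | succ m =>
    refine ⟨fun _ _ => le_rfl, fun _ _ => differentiableAt_const _, ?_⟩
    have : deriv (fun _ : ℝ => a) = 0 := by ext; simp
    rw [this]
    exact DerivBound.zero fun _ _ => norm_nonneg _

theorem norm_le_div_one_add_abs {g : ℝ → ℂ} {c : ℝ} (hg0 : ∀ w, |w| < 1 → g w = 0)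
    (hb : ∀ w : ℝ, ‖w * g w‖ ≤ c) (w : ℝ) : ‖g w‖ ≤ 2 * c / (1 + |w|) := by
  have h1 := hb w
  rw [norm_mul, Complex.norm_real, Real.norm_eq_abs] at h1
  rw [le_div_iff₀ (by positivity)]
  rcases lt_or_ge |w| 1 with hw | hw
  · rw [hg0 w hw] at h1 ⊢
    simp only [norm_zero, mul_zero, zero_mul] at h1 ⊢
    linarith
  · nlinarith [norm_nonneg (g w)]

/-- The case m = 0 is division by w away from the origin. For the induction, w g' = (w g)' - g, so
g' satisfies the hypothesis with one derivative less. No sharper decay of the higher derivatives is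
needed. -/
theorem DerivBound.exists_div_of_mul {m : ℕ} {g : ℝ → ℂ} {c : ℝ} (hg : ContDiff ℝ (⊤ : ℕ∞) g)
    (hg0 : ∀ w, |w| < 1 → g w = 0) (hb : DerivBound univ m (fun _ => c) (fun w => w * g w)) :
    ∃ c', 0 ≤ c' ∧ DerivBound univ m (fun w => c' / (1 + |w|)) g := by
  have hn := norm_le_div_one_add_abs hg0 fun w => hb.norm_le w trivial
  have hc : 0 ≤ c := (norm_nonneg _).trans (hb.norm_le 0 trivial)
  induction m generalizing g c with
  | zero => exact ⟨2 * c, by linarith, fun w _ => hn w⟩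
  | succ m ih =>
    obtain ⟨c₁, hc₁, h₁⟩ := ih hg hg0 hb.of_succ hn hc
    have hg' : ContDiff ℝ (⊤ : ℕ∞) (deriv g) := (contDiff_infty_iff_deriv.1 hg).2
    have hdg : Differentiable ℝ g := (contDiff_infty_iff_deriv.1 hg).1
    have hg0' : ∀ w, |w| < 1 → deriv g w = 0 := fun w hw => by
      have : g =ᶠ[𝓝 w] fun _ => 0 := by
        filter_upwards [(isOpen_lt continuous_abs continuous_const).mem_nhds hw] with s hs
          using hg0 s hs
      rw [this.deriv_eq, deriv_const]
    have hb' : DerivBound univ m (fun _ => c + c₁) (fun w => w * deriv g w) := by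
      refine ((hb.2.2.add isOpen_univ (h₁.const_mul isOpen_univ (-1))).mono fun w _ => ?_).congr
        isOpen_univ fun w _ => ?_
      · have : c₁ / (1 + |w|) ≤ c₁ := div_le_self hc₁ (by linarith [abs_nonneg w])
        simpa using this
      · have : HasDerivAt (fun w : ℝ => (w : ℂ) * g w) (1 * g w + w * deriv g w) w :=
          (Complex.ofRealCLM.hasDerivAt (x := w)).mul (hdg w).hasDerivAt
        simp only [this.deriv]
        ring
    have hc' : 0 ≤ c + c₁ := by linarith
    obtain ⟨c₂, hc₂, h₂⟩ := ih hg' hg0' hb'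
      (norm_le_div_one_add_abs hg0' fun w => hb'.norm_le w trivial) hc'
    refine ⟨2 * c + c₂, by linarith, fun w _ => (hn w).trans ?_, fun w _ => hdg w,
      h₂.mono fun w _ => ?_⟩
    · exact div_le_div_of_nonneg_right (by linarith) (by positivity)
    · exact div_le_div_of_nonneg_right (by linarith) (by positivity)

theorem exists_derivBound_cutoffQuot (m : ℕ) :
    ∃ c, 0 ≤ c ∧ DerivBound univ m (fun w => c / (1 + |w|)) cutoffQuot := by
  obtain ⟨c, hc, h⟩ := DerivBound.exists_of_contDiff (m := m) (R := 2) (f := cutoff)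
    (contDiff_cutoff (n := m)) fun t ht => cutoff_eq_zero (by linarith)
  refine DerivBound.exists_div_of_mul (c := 1 + c) contDiff_cutoffQuot
    (fun w hw => cutoffQuot_eq_zero hw.le) ?_
  refine (((DerivBound.const 1).add isOpen_univ (h.const_mul isOpen_univ (-1))).mono
    fun w _ => by simp).congr isOpen_univ fun w _ => ?_
  rw [mul_cutoffQuot]
  ring

/-! ### Moments of the kernel -/

theorem deriv_fwdDiff_iter (δ : ℝ) (n : ℕ) {f : ℝ → ℂ} (hf : Differentiable ℝ f) :
    Differentiable ℝ ((fwdDiff δ)^[n] f) ∧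
      deriv ((fwdDiff δ)^[n] f) = (fwdDiff δ)^[n] (deriv f) := by
  induction n with
  | zero => exact ⟨hf, rfl⟩
  | succ n ih =>
    rw [Function.iterate_succ_apply', Function.iterate_succ_apply', ← ih.2]
    have hs : Differentiable ℝ fun t => ((fwdDiff δ)^[n] f) (t + δ) := ih.1.comp (by fun_prop)
    refine ⟨hs.sub ih.1, ?_⟩
    ext t
    have : fwdDiff δ ((fwdDiff δ)^[n] f) =
        fun t => ((fwdDiff δ)^[n] f) (t + δ) - ((fwdDiff δ)^[n] f) t := rfl
    rw [this, deriv_fun_sub (hs t) (ih.1 t), deriv_comp_add_const]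
    rfl

/-- Differences commute with differentiation. By induction, the difference of order n + 1 of f has a
derivative bounded by L δ^(n+1), hence is Lipschitz, and one further difference gains another factor
δ. -/
theorem norm_fwdDiff_iter_le {n : ℕ} {f : ℝ → ℂ} {L : ℝ≥0} (hf : ContDiff ℝ n f)
    (hL : LipschitzWith L (iteratedDeriv n f)) {δ : ℝ} (hδ : 0 ≤ δ) (t : ℝ) :
    ‖(fwdDiff δ)^[n + 1] f t‖ ≤ L * δ ^ (n + 1) := by
  have habs : ∀ t, dist (t + δ) t = δ := fun t => by simp [abs_of_nonneg hδ]
  induction n generalizing f t with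
  | zero =>
    have := hL.dist_le_mul (t + δ) t
    rw [habs, iteratedDeriv_zero, dist_eq_norm] at this
    simpa [fwdDiff] using this
  | succ n ih =>
    have hd : Differentiable ℝ f := hf.differentiable (by simp)
    have hf' : ContDiff ℝ n (deriv f) := (contDiff_succ_iff_deriv.1 (by exact_mod_cast hf)).2.2
    have hb := ih hf' (by rwa [← iteratedDeriv_succ'])
    obtain ⟨h1, h2⟩ := deriv_fwdDiff_iter δ (n + 1) hd
    have hlip : LipschitzWith (L * δ.toNNReal ^ (n + 1)) ((fwdDiff δ)^[n + 1] f) := by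
      refine lipschitzWith_of_nnnorm_deriv_le h1 fun t => ?_
      rw [h2, ← NNReal.coe_le_coe, NNReal.coe_mul, NNReal.coe_pow, Real.coe_toNNReal _ hδ]
      exact hb t
    have := hlip.dist_le_mul (t + δ) t
    rw [habs, dist_eq_norm] at this
    rw [Function.iterate_succ_apply']
    calc _ ≤ _ := this
      _ = _ := by rw [NNReal.coe_mul, NNReal.coe_pow, Real.coe_toNNReal _ hδ]; ring

/-- On the character t ↦ e^{iut} the difference operator acts as multiplication by e^{iuδ} - 1. -/
theorem fwdDiff_iter_fourierStar {k : ℝ → ℝ} (hk : Integrable k) (δ : ℝ) (n : ℕ) (t : ℝ) :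
    (fwdDiff δ)^[n] (fourierStar k) t = ∫ u : ℝ, Complex.exp (Complex.I * u * t) *
      (Complex.exp (Complex.I * u * δ) - 1) ^ n * (k u : ℂ) := by
  have hint : ∀ (n : ℕ) (t : ℝ), Integrable fun u : ℝ => Complex.exp (Complex.I * u * t) *
      (Complex.exp (Complex.I * u * δ) - 1) ^ n * (k u : ℂ) := fun n t => by
    refine hk.ofReal.bdd_mul (c := 2 ^ n) (Continuous.aestronglyMeasurable (by fun_prop))
      (.of_forall fun u => ?_)
    have e : ∀ s : ℝ, ‖Complex.exp (Complex.I * u * s)‖ = 1 := fun s => by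
      rw [mul_assoc, mul_comm, ← Complex.ofReal_mul, Complex.norm_exp_ofReal_mul_I]
    rw [norm_mul, e, one_mul, norm_pow]
    gcongr
    refine (norm_sub_le _ _).trans ?_
    rw [e, norm_one]
    norm_num
  induction n generalizing t with
  | zero => simp [fourierStar]
  | succ n ih =>
    rw [Function.iterate_succ_apply', fwdDiff, ih, ih, ← integral_sub (hint n _) (hint n _)]
    refine integral_congr_ae (.of_forall fun u => ?_)
    simp only
    rw [Complex.ofReal_add, mul_add, Complex.exp_add]
    ring

/-- The central difference of k^* of order 2j at the origin is, up to sign, ∫ (2 sin(δu/2))^(2j)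
k(u) du, and it is at most L δ^(2j). The integrand is nonnegative since the order is even and k ≥ 0,
so after division by δ^(2j) Fatou's lemma applies as δ → 0. -/
theorem lintegral_even_pow_mul_le {k : ℝ → ℝ} (hk : Integrable k) (hk0 : ∀ x, 0 ≤ k x) {j : ℕ}
    (hj : 0 < j) {L : ℝ≥0} (hf : ContDiff ℝ (2 * j - 1 : ℕ) (fourierStar k))
    (hL : LipschitzWith L (iteratedDeriv (2 * j - 1) (fourierStar k))) :
    ∫⁻ x, ENNReal.ofReal (x ^ (2 * j) * k x) ≤ L := by
  have hbound : ∀ δ : ℝ, 0 < δ →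
      ∫⁻ x, ENNReal.ofReal ((2 * Real.sin (δ * x / 2) / δ) ^ (2 * j) * k x) ≤ L := fun δ hδ => by
    -- The base point -jδ centres the forward difference at the origin.
    have h1 := norm_fwdDiff_iter_le hf hL hδ.le (-(j * δ))
    rw [show 2 * j - 1 + 1 = 2 * j by omega, fwdDiff_iter_fourierStar hk] at h1
    have h2 : ∀ u : ℝ, Complex.exp (Complex.I * u * (-(j * δ) : ℝ)) *
        (Complex.exp (Complex.I * u * δ) - 1) ^ (2 * j) * (k u : ℂ) =
        (-1) ^ j * (((2 * Real.sin (δ * u / 2)) ^ (2 * j) * k u : ℝ) : ℂ) := fun u => by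
      have e1 : Complex.exp (Complex.I * u * (-(j * δ) : ℝ)) =
          Complex.exp (-(Complex.I * (δ * u / 2))) ^ (2 * j) := by
        rw [← Complex.exp_nat_mul]
        congr 1
        push_cast
        ring
      have e2 : Complex.exp (-(Complex.I * (δ * u / 2))) * (Complex.exp (Complex.I * u * δ) - 1) =
          Complex.I * (2 * Real.sin (δ * u / 2) : ℝ) := by
        rw [mul_sub, ← Complex.exp_add]
        push_cast
        rw [Complex.sin, mul_one, show -(Complex.I * (δ * u / 2)) + Complex.I * u * δ =
          δ * u / 2 * Complex.I by ring, show -(Complex.I * (δ * u / 2)) =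
          -(δ * u / 2) * Complex.I by ring]
        have hI := Complex.I_mul_I
        linear_combination (Complex.exp (δ * u / 2 * Complex.I) -
          Complex.exp (-(δ * u / 2) * Complex.I)) * hI
      rw [e1, ← mul_pow, e2, mul_pow, pow_mul Complex.I, Complex.I_sq]
      push_cast
      ring
    simp_rw [h2] at h1
    rw [integral_const_mul, norm_mul, norm_pow, norm_neg, norm_one, one_pow, one_mul,
      integral_complex_ofReal, Complex.norm_real] at h1
    have hint : Integrable fun u => (2 * Real.sin (δ * u / 2)) ^ (2 * j) * k u := by
      refine hk.bdd_mul (c := 2 ^ (2 * j)) (Continuous.aestronglyMeasurable (by fun_prop))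
        (.of_forall fun u => ?_)
      rw [norm_pow, norm_mul, Real.norm_eq_abs, Real.norm_eq_abs, abs_two]
      gcongr
      linarith [Real.abs_sin_le_one (δ * u / 2)]
    have hnn : ∀ u, 0 ≤ (2 * Real.sin (δ * u / 2)) ^ (2 * j) * k u := fun u =>
      mul_nonneg ((even_two_mul j).pow_nonneg _) (hk0 u)
    have h3 : ∀ x, (2 * Real.sin (δ * x / 2) / δ) ^ (2 * j) * k x =
        (δ ^ (2 * j))⁻¹ * ((2 * Real.sin (δ * x / 2)) ^ (2 * j) * k x) := fun x => by
      rw [div_pow]; field_simp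
    simp_rw [h3]
    rw [← ofReal_integral_eq_lintegral_ofReal (hint.const_mul _)
      (.of_forall fun u => mul_nonneg (by positivity) (hnn u)), integral_const_mul]
    rw [Real.norm_of_nonneg (integral_nonneg hnn)] at h1
    calc ENNReal.ofReal _ ≤ ENNReal.ofReal L := ENNReal.ofReal_le_ofReal (by
          rw [inv_mul_le_iff₀ (by positivity), mul_comm (δ ^ (2 * j))]
          exact h1)
      _ = L := ENNReal.ofReal_coe_nnreal
  have hlim : ∀ x : ℝ, Tendsto (fun N : ℕ => ENNReal.ofReal
      ((2 * Real.sin (1 / ((N : ℝ) + 1) * x / 2) / (1 / ((N : ℝ) + 1))) ^ (2 * j) * k x)) atTop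
      (𝓝 (ENNReal.ofReal (x ^ (2 * j) * k x))) := fun x => by
    refine ENNReal.tendsto_ofReal (Tendsto.mul_const _ (Tendsto.pow ?_ _))
    have hd : HasDerivAt (fun δ : ℝ => 2 * Real.sin (δ * x / 2)) x 0 := by
      refine ((((hasDerivAt_id (0 : ℝ)).mul_const x).div_const 2).sin.const_mul 2).congr_deriv ?_
      simp only [id, zero_mul, zero_div, Real.cos_zero]
      ring
    have := hd.tendsto_slope_zero
    have hN : Tendsto (fun N : ℕ => 1 / ((N : ℝ) + 1)) atTop (𝓝[≠] 0) :=
      tendsto_nhdsWithin_iff.2 ⟨tendsto_one_div_add_atTop_nhds_zero_nat,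
        .of_forall fun N => (Nat.one_div_pos_of_nat (α := ℝ)).ne'⟩
    refine (this.comp hN).congr fun N => ?_
    simp [div_eq_inv_mul, mul_comm]
  calc ∫⁻ x, ENNReal.ofReal (x ^ (2 * j) * k x)
      = ∫⁻ x, liminf (fun N : ℕ => ENNReal.ofReal ((2 * Real.sin (1 / ((N : ℝ) + 1) * x / 2) /
          (1 / ((N : ℝ) + 1))) ^ (2 * j) * k x)) atTop :=
        lintegral_congr fun x => (hlim x).liminf_eq.symm
    _ ≤ liminf (fun N : ℕ => ∫⁻ x, ENNReal.ofReal ((2 * Real.sin (1 / ((N : ℝ) + 1) * x / 2) /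
          (1 / ((N : ℝ) + 1))) ^ (2 * j) * k x)) atTop :=
        lintegral_liminf_le' fun N => ((Continuous.aemeasurable (by fun_prop)).mul
          hk.aemeasurable).ennreal_ofReal
    _ ≤ liminf (fun _ : ℕ => (L : ℝ≥0∞)) atTop :=
        liminf_le_liminf (.of_forall fun N => hbound _ (by positivity))
    _ = L := liminf_const _

theorem iteratedDeriv_eq_zero_of_support {R : ℝ} {f : ℝ → ℂ} (hf : ∀ t, R < |t| → f t = 0) (n : ℕ) :
    ∀ t, R < |t| → iteratedDeriv n f t = 0 := by
  induction n generalizing f with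
  | zero => simpa using hf
  | succ n ih =>
    rw [iteratedDeriv_succ']
    exact ih (deriv_eq_zero_of_support hf)

/-- An even moment of order at least p suffices. With N = ⌈p⌉, the order 2j is N or N + 1, whichever
is even. For odd N the Lipschitz hypothesis is used directly; for even N the derivative of order N -
1 is Lipschitz because it is C¹ with compact support. -/
theorem IsKernel.lintegral_rpow_mul_lt_top {p : ℝ} {k : ℝ → ℝ} (hp : 1 ≤ p) (hk : IsKernel p k) :
    ∫⁻ x, ENNReal.ofReal (|x| ^ p * k x) < ∞ := by
  set N := ⌈p⌉₊ with hN
  have hN1 : 1 ≤ N := Nat.one_le_ceil_iff.2 (by linarith)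
  set j := (N + 1) / 2 with hj
  have hLip : ∃ L : ℝ≥0, LipschitzWith L (iteratedDeriv (2 * j - 1) (fourierStar k)) := by
    rcases Nat.even_or_odd N with he | ho
    · have h1 : 2 * j = N := by obtain ⟨r, hr⟩ := he; omega
      have hc : ContDiff ℝ (1 : ℕ) (iteratedDeriv (2 * j - 1) (fourierStar k)) := by
        rw [iteratedDeriv_eq_iterate]
        refine ContDiff.iterate_deriv' 1 (2 * j - 1) ?_
        rw [show 1 + (2 * j - 1) = N by omega]
        exact hk.contDiff
      refine hc.lipschitzWith_of_hasCompactSupport ?_ one_ne_zero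
      refine HasCompactSupport.of_support_subset_isCompact (isCompact_Icc (a := -1) (b := 1))
        fun u hu => ?_
      by_contra h
      exact hu (iteratedDeriv_eq_zero_of_support (R := 1) (fun t ht => hk.support t fun h' =>
        absurd (abs_le.2 h') (not_le.2 ht)) _ u (by rw [mem_Icc, ← abs_le] at h; exact not_le.1 h))
    · have h1 : 2 * j - 1 = N := by obtain ⟨r, hr⟩ := ho; omega
      rw [h1]
      exact hk.lipschitz
  obtain ⟨L, hL⟩ := hLip
  have h2 := lintegral_even_pow_mul_le hk.integrable hk.nonneg (j := j) (by omega)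
    (hk.contDiff.of_le (by exact_mod_cast (by omega : 2 * j - 1 ≤ N))) hL
  have hpj : p ≤ (2 * j : ℕ) := (Nat.le_ceil p).trans (by exact_mod_cast (by omega : N ≤ 2 * j))
  calc ∫⁻ x, ENNReal.ofReal (|x| ^ p * k x)
      ≤ ∫⁻ x, (ENNReal.ofReal (k x) + ENNReal.ofReal (x ^ (2 * j) * k x)) := by
        refine lintegral_mono fun x => ?_
        rw [← ENNReal.ofReal_add (hk.nonneg x)
          (mul_nonneg ((even_two_mul j).pow_nonneg _) (hk.nonneg x))]
        refine ENNReal.ofReal_le_ofReal ?_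
        have : |x| ^ p ≤ 1 + x ^ (2 * j) := by
          rw [← (even_two_mul j).pow_abs x]
          rcases le_total |x| 1 with hx | hx
          · have := Real.rpow_le_one (abs_nonneg x) hx (by linarith : 0 ≤ p)
            have := pow_nonneg (abs_nonneg x) (2 * j)
            linarith
          · have := Real.rpow_le_rpow_of_exponent_le hx hpj
            rw [Real.rpow_natCast] at this
            linarith
        nlinarith [hk.nonneg x]
    _ = (∫⁻ x, ENNReal.ofReal (k x)) + ∫⁻ x, ENNReal.ofReal (x ^ (2 * j) * k x) :=
        lintegral_add_left' hk.integrable.aemeasurable.ennreal_ofReal _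
    _ < ∞ := ENNReal.add_lt_top.2 ⟨hk.integrable.lintegral_lt_top, h2.trans_lt ENNReal.coe_lt_top⟩

/-! ### Couplings on the line -/

theorem wasserstein_rpow_le {p : ℝ} (hp : 0 < p) {μ ν : Measure ℝ} {π : Measure (ℝ × ℝ)}
    (h₁ : π.fst = μ) (h₂ : π.snd = ν) :
    wasserstein p μ ν ^ p ≤ ∫⁻ z, ENNReal.ofReal (|z.1 - z.2| ^ p) ∂π := by
  have h := iInf_le (fun π : {π : Measure (ℝ × ℝ) // π.fst = μ ∧ π.snd = ν} =>
    (∫⁻ z, ENNReal.ofReal (|z.1 - z.2| ^ p) ∂π.1) ^ (1 / p)) ⟨π, h₁, h₂⟩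
  calc wasserstein p μ ν ^ p ≤ ((∫⁻ z, ENNReal.ofReal (|z.1 - z.2| ^ p) ∂π) ^ (1 / p)) ^ p :=
        ENNReal.rpow_le_rpow h hp.le
    _ = _ := by rw [← ENNReal.rpow_mul, one_div_mul_cancel hp.ne', ENNReal.rpow_one]

/-- Gluing two couplings along their common marginal. -/
theorem wasserstein_rpow_le_of_couplings {p : ℝ} (hp : 1 ≤ p) {μ₁ μ₂ μ₃ : Measure ℝ}
    {π₁ π₂ : Measure (ℝ × ℝ)} [IsFiniteMeasure π₁] [IsFiniteMeasure π₂]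
    (h₁ : π₁.fst = μ₁) (h₁' : π₁.snd = μ₂) (h₂ : π₂.fst = μ₂) (h₂' : π₂.snd = μ₃) :
    wasserstein p μ₁ μ₃ ^ p ≤ 2 ^ (p - 1) * (∫⁻ z, ENNReal.ofReal (|z.1 - z.2| ^ p) ∂π₁ +
      ∫⁻ z, ENNReal.ofReal (|z.1 - z.2| ^ p) ∂π₂) := by
  set κ := π₂.condKernel
  -- The third coordinate is drawn from the conditional law of the second coordinate of π₂, given
  -- that its first coordinate equals the second coordinate of π₁. The pairs (1, 2) and (2, 3) then
  -- have the laws π₁ and π₂.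
  set γ : Measure ((ℝ × ℝ) × ℝ) := π₁.compProd (κ.comap Prod.snd measurable_snd) with hγ
  have hmeas : Measurable fun z : ℝ × ℝ => ENNReal.ofReal (|z.1 - z.2| ^ p) :=
    (((measurable_fst.sub measurable_snd).abs).pow_const p).ennreal_ofReal
  have hg : ∀ g : ℝ × ℝ → ℝ≥0∞, Measurable g → ∫⁻ z, g (z.1.2, z.2) ∂γ = ∫⁻ z, g z ∂π₂ := by
    intro g hg
    rw [hγ, Measure.lintegral_compProd (by fun_prop)]
    have e : π₂ = π₂.fst.compProd κ := (π₂.disintegrate κ).symm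
    conv_rhs => rw [e, Measure.lintegral_compProd hg, h₂, ← h₁', Measure.snd]
    rw [lintegral_map (Measurable.lintegral_kernel_prod_right' hg) measurable_snd]
    rfl
  have hg₁ : ∀ g : ℝ × ℝ → ℝ≥0∞, Measurable g → ∫⁻ z, g z.1 ∂γ = ∫⁻ z, g z ∂π₁ := by
    intro g hg
    conv_rhs => rw [← Measure.fst_compProd π₁ (κ.comap Prod.snd measurable_snd), Measure.fst,
      lintegral_map hg measurable_fst]
  have hm : Measurable fun z : (ℝ × ℝ) × ℝ => (z.1.1, z.2) := by fun_prop
  have hle := wasserstein_rpow_le (p := p) (by linarith) (π := γ.map fun z => (z.1.1, z.2))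
    (μ := μ₁) (ν := μ₃) (by
      ext s hs
      rw [Measure.fst_apply hs, Measure.map_apply hm (measurable_fst hs), ← h₁,
        Measure.fst_apply hs, ← lintegral_indicator_one (hm (measurable_fst hs)),
        ← lintegral_indicator_one (measurable_fst hs),
        ← hg₁ _ (measurable_one.indicator (measurable_fst hs))]
      rfl) (by
      ext s hs
      rw [Measure.snd_apply hs, Measure.map_apply hm (measurable_snd hs), ← h₂',
        Measure.snd_apply hs, ← lintegral_indicator_one (hm (measurable_snd hs)),
        ← lintegral_indicator_one (measurable_snd hs),
        ← hg _ (measurable_one.indicator (measurable_snd hs))]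
      rfl)
  refine hle.trans ?_
  rw [lintegral_map hmeas hm, ← hg _ hmeas, ← hg₁ _ hmeas, ← lintegral_add_left (by fun_prop),
    ← lintegral_const_mul' _ _ (by simp)]
  refine lintegral_mono fun z => ?_
  simp only [← ENNReal.ofReal_rpow_of_nonneg (abs_nonneg _) (zero_le_one.trans hp)]
  -- Convexity of the p-th power produces the factor 2^(p-1).
  refine le_trans ?_ (ENNReal.rpow_add_le_mul_rpow_add_rpow _ _ hp)
  rw [← ENNReal.ofReal_add (abs_nonneg _) (abs_nonneg _)]
  gcongr
  exact abs_sub_le _ _ _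

/-- The quantile function of a probability measure on the line. -/
def quantile (μ : Measure ℝ) (u : ℝ) : ℝ := sInf {x | u ≤ cdf μ x}

/-- The upward closed set defining the quantile is nonempty and bounded below for u in (0, 1), and
right continuity of the distribution function makes it contain its infimum. -/
theorem quantile_le_iff (μ : Measure ℝ) {u x : ℝ} (hu : u ∈ Ioo (0 : ℝ) 1) :
    quantile μ u ≤ x ↔ u ≤ cdf μ x := by
  obtain ⟨y, hy⟩ := ((tendsto_cdf_atTop μ).eventually (eventually_ge_nhds hu.2)).exists
  obtain ⟨z, hz⟩ := ((tendsto_cdf_atBot μ).eventually (eventually_lt_nhds hu.1)).exists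
  have hbdd : BddBelow {x | u ≤ cdf μ x} := ⟨z, fun w hw => by
    by_contra h
    exact absurd (hw.trans (monotone_cdf μ (not_le.1 h).le)) (not_le.2 hz)⟩
  refine ⟨fun h => ?_, fun h => csInf_le hbdd h⟩
  have hev : ∀ᶠ w in 𝓝[>] x, u ≤ cdf μ w := by
    filter_upwards [self_mem_nhdsWithin] with w hw
    obtain ⟨v, hv, hvw⟩ := exists_lt_of_csInf_lt ⟨y, hy⟩ (h.trans_lt hw)
    exact le_trans hv (monotone_cdf μ hvw.le)
  have hlim : Tendsto (cdf μ) (𝓝[>] x) (𝓝 (cdf μ x)) :=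
    ((cdf μ).right_continuous x).mono_left (nhdsWithin_mono _ Ioi_subset_Ici_self)
  exact ge_of_tendsto hlim hev

theorem aemeasurable_quantile (μ : Measure ℝ) :
    AEMeasurable (quantile μ) (volume.restrict (Ioo (0 : ℝ) 1)) := by
  refine aemeasurable_restrict_of_monotoneOn measurableSet_Ioo fun u hu v hv huv => ?_
  rw [quantile_le_iff μ hu]
  exact huv.trans ((quantile_le_iff μ hv).1 le_rfl)

theorem map_quantile (μ : Measure ℝ) [IsProbabilityMeasure μ] :
    (volume.restrict (Ioo (0 : ℝ) 1)).map (quantile μ) = μ := by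
  have : IsProbabilityMeasure (volume.restrict (Ioo (0 : ℝ) 1)) := ⟨by simp⟩
  have := Measure.isProbabilityMeasure_map (aemeasurable_quantile μ)
  refine Measure.ext_of_Iic _ _ fun x => ?_
  rw [Measure.map_apply_of_aemeasurable (aemeasurable_quantile μ) measurableSet_Iic,
    ← ofReal_cdf μ x, Measure.restrict_apply' measurableSet_Ioo]
  have h1 : quantile μ ⁻¹' Iic x ∩ Ioo 0 1 = Iic (cdf μ x) ∩ Ioo 0 1 := by
    ext u
    constructor
    · exact fun h => ⟨(quantile_le_iff μ h.2).1 h.1, h.2⟩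
    · exact fun h => ⟨(quantile_le_iff μ h.2).2 h.1, h.2⟩
  rw [h1]
  apply le_antisymm
  · calc volume (Iic (cdf μ x) ∩ Ioo 0 1) ≤ volume (Ioc 0 (cdf μ x)) :=
        measure_mono (fun u hu => ⟨hu.2.1, hu.1⟩ : Iic (cdf μ x) ∩ Ioo 0 1 ⊆ Ioc 0 (cdf μ x))
      _ = _ := by simp
  · calc ENNReal.ofReal (cdf μ x) = volume (Ioo 0 (cdf μ x)) := by simp
      _ ≤ _ := measure_mono (fun u hu => ⟨hu.2.le, hu.1, hu.2.trans_le (cdf_le_one μ x)⟩ :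
        Ioo 0 (cdf μ x) ⊆ Iic (cdf μ x) ∩ Ioo 0 1)

/-- The weight is small only near the origin, and a quarter of the interval stays at distance at
least (b - a)/4 from it. -/
theorem rpow_sub_le_lintegral {p : ℝ} (hp : 1 ≤ p) {a b : ℝ} (hab : a ≤ b) :
    ENNReal.ofReal ((b - a) ^ p) ≤
      ENNReal.ofReal (4 ^ p) * ∫⁻ x in Ico a b, ENNReal.ofReal (|x| ^ (p - 1)) := by
  rcases hab.eq_or_lt with rfl | hlt
  · simp [Real.zero_rpow (by linarith : p ≠ 0)]
  set L := (b - a) / 4 with hL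
  have hL0 : 0 < L := by rw [hL]; linarith
  -- The quarter is taken at the endpoint farther from the origin, which the sign of a + b
  -- determines.
  have key : ∃ c, Ico c (c + L) ⊆ Ico a b ∧ ∀ x ∈ Ico c (c + L), L ≤ |x| := by
    rcases le_total 0 (a + b) with h | h
    · refine ⟨b - L, Ico_subset_Ico (by linarith) (by linarith), fun x hx => ?_⟩
      exact le_trans (by linarith [hx.1]) (le_abs_self x)
    · refine ⟨a, Ico_subset_Ico le_rfl (by linarith), fun x hx => ?_⟩
      exact le_trans (by linarith [hx.2]) (neg_le_abs x)
  obtain ⟨c, hc, hcL⟩ := key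
  calc ENNReal.ofReal ((b - a) ^ p) = ENNReal.ofReal (4 ^ p) * ENNReal.ofReal (L ^ p) := by
        rw [← ENNReal.ofReal_mul (by positivity), ← Real.mul_rpow (by norm_num) hL0.le]
        congr 2
        rw [hL]; ring
    _ = ENNReal.ofReal (4 ^ p) * ∫⁻ x in Ico c (c + L), ENNReal.ofReal (L ^ (p - 1)) := by
        rw [setLIntegral_const, Real.volume_Ico,
          ← ENNReal.ofReal_mul (Real.rpow_nonneg hL0.le (p - 1))]
        congr 2
        rw [add_sub_cancel_left, ← Real.rpow_add_one hL0.ne', sub_add_cancel]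
    _ ≤ ENNReal.ofReal (4 ^ p) * ∫⁻ x in Ico c (c + L), ENNReal.ofReal (|x| ^ (p - 1)) := by
        gcongr 1
        refine setLIntegral_mono' measurableSet_Ico fun x hx => ENNReal.ofReal_le_ofReal ?_
        exact Real.rpow_le_rpow hL0.le (hcL x hx) (by linarith)
    _ ≤ _ := by
        gcongr

/-- The quantile coupling of two probability measures. -/
def quantileCoupling (μ ν : Measure ℝ) : Measure (ℝ × ℝ) :=
  (volume.restrict (Ioo (0 : ℝ) 1)).map fun u => (quantile μ u, quantile ν u)

instance (μ ν : Measure ℝ) : IsFiniteMeasure (quantileCoupling μ ν) := by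
  unfold quantileCoupling; infer_instance

theorem fst_quantileCoupling (μ ν : Measure ℝ) [IsProbabilityMeasure μ] :
    (quantileCoupling μ ν).fst = μ := by
  rw [quantileCoupling, Measure.fst_map_prodMk₀ (aemeasurable_quantile ν), map_quantile]

theorem snd_quantileCoupling (μ ν : Measure ℝ) [IsProbabilityMeasure ν] :
    (quantileCoupling μ ν).snd = ν := by
  rw [quantileCoupling, Measure.snd_map_prodMk₀ (aemeasurable_quantile μ), map_quantile]

/-- For fixed u, a point x lying between the two quantiles of u has u between the two distribution
functions at x. The preceding bound turns the cost at u into an integral over such x; after Tonelli,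
the set of admissible u at given x has length |F(x) - G(x)|. -/
theorem lintegral_quantileCoupling_le {p : ℝ} (hp : 1 ≤ p) (μ ν : Measure ℝ) :
    ∫⁻ z, ENNReal.ofReal (|z.1 - z.2| ^ p) ∂(quantileCoupling μ ν) ≤
      ENNReal.ofReal (4 ^ p) * cdfLoss p (cdf μ) (cdf ν) := by
  have hmeas : Measurable fun z : ℝ × ℝ => ENNReal.ofReal (|z.1 - z.2| ^ p) :=
    (((measurable_fst.sub measurable_snd).abs).pow_const p).ennreal_ofReal
  have hF : ∀ μ : Measure ℝ, Measurable (cdf μ) := fun μ => (monotone_cdf μ).measurable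
  set A : Set (ℝ × ℝ) := {z | z.1 ∈ uIoc (cdf μ z.2) (cdf ν z.2)} with hA
  have hAm : MeasurableSet A := by
    have h1 : Measurable fun z : ℝ × ℝ => cdf μ z.2 := (hF μ).comp measurable_snd
    have h2 : Measurable fun z : ℝ × ℝ => cdf ν z.2 := (hF ν).comp measurable_snd
    exact (measurableSet_lt (h1.min h2) measurable_fst).inter
      (measurableSet_le measurable_fst (h1.max h2))
  set g : ℝ × ℝ → ℝ≥0∞ := A.indicator fun z => ENNReal.ofReal (|z.2| ^ (p - 1)) with hg
  have hgm : Measurable g := Measurable.indicator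
    ((measurable_snd.abs.pow_const _).ennreal_ofReal) hAm
  have hpt : ∀ u ∈ Ioo (0 : ℝ) 1, ENNReal.ofReal (|quantile μ u - quantile ν u| ^ p) ≤
      ENNReal.ofReal (4 ^ p) * ∫⁻ x, g (u, x) := fun u hu => by
    have hsub : ∀ x ∈ Ico (min (quantile μ u) (quantile ν u)) (max (quantile μ u) (quantile ν u)),
        (u, x) ∈ A := fun x hx => by
      have h1 := quantile_le_iff μ (x := x) hu
      have h2 := quantile_le_iff ν (x := x) hu
      rw [mem_Ico, min_le_iff, lt_max_iff, h1, h2, ← not_le, ← not_le, h1, h2, not_le, not_le] at hx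
      simp only [hA, mem_ofPred_eq, uIoc, mem_Ioc, min_lt_iff, le_max_iff]
      tauto
    have := rpow_sub_le_lintegral hp (min_le_max (a := quantile μ u) (b := quantile ν u))
    rw [max_sub_min_eq_abs'] at this
    refine this.trans ?_
    gcongr 1
    rw [← lintegral_indicator measurableSet_Ico]
    refine lintegral_mono fun x => ?_
    by_cases hx : x ∈ Ico (min (quantile μ u) (quantile ν u)) (max (quantile μ u) (quantile ν u))
    · rw [indicator_of_mem hx, hg, indicator_of_mem (hsub x hx)]
    · rw [indicator_of_notMem hx]; exact zero_le
  rw [quantileCoupling, lintegral_map' hmeas.aemeasurable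
    ((aemeasurable_quantile μ).prodMk (aemeasurable_quantile ν))]
  refine (setLIntegral_mono' measurableSet_Ioo hpt).trans ?_
  rw [lintegral_const_mul' _ _ ENNReal.ofReal_ne_top,
    lintegral_lintegral_swap (by exact hgm.aemeasurable)]
  gcongr 1
  refine lintegral_mono fun x => ?_
  have h1 : ∀ u, g (u, x) = (uIoc (cdf μ x) (cdf ν x)).indicator
      (fun _ => ENNReal.ofReal (|x| ^ (p - 1))) u := fun u => by
    by_cases hu : u ∈ uIoc (cdf μ x) (cdf ν x)
    · rw [indicator_of_mem hu, hg, indicator_of_mem (by exact hu)]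
    · rw [indicator_of_notMem hu, hg, indicator_of_notMem (by exact hu)]
  simp_rw [h1]
  refine (setLIntegral_le_lintegral _ _).trans ?_
  rw [lintegral_indicator measurableSet_uIoc, setLIntegral_const, Real.volume_uIoc,
    ENNReal.ofReal_mul (by positivity), abs_sub_comm]

/-! ### The bias -/

/-- The law with density `x ↦ h⁻¹ k(x / h)`. -/
def kernelLaw (k : ℝ → ℝ) (h : ℝ) : Measure ℝ :=
  (volume.withDensity fun x => ENNReal.ofReal (k x)).map (h * ·)

theorem IsKernel.isProbabilityMeasure {p : ℝ} {k : ℝ → ℝ} (hk : IsKernel p k) (h : ℝ) :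
    IsProbabilityMeasure (kernelLaw k h) := by
  have : IsProbabilityMeasure (volume.withDensity fun x => ENNReal.ofReal (k x)) := ⟨by
    rw [withDensity_apply _ .univ, Measure.restrict_univ,
      ← ofReal_integral_eq_lintegral_ofReal hk.integrable (.of_forall hk.nonneg),
      hk.integral_eq_one, ENNReal.ofReal_one]⟩
  exact Measure.isProbabilityMeasure_map (by fun_prop)

theorem IsKernel.lintegral_kernelLaw {p : ℝ} {k : ℝ → ℝ} (hk : IsKernel p k) (h : ℝ)
    {g : ℝ → ℝ≥0∞} (hg : Measurable g) :
    ∫⁻ x, g x ∂(kernelLaw k h) = ∫⁻ x, ENNReal.ofReal (k x) * g (h * x) := by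
  rw [kernelLaw, lintegral_map hg (by fun_prop), lintegral_withDensity_eq_lintegral_mul₀
    hk.integrable.aemeasurable.ennreal_ofReal (by fun_prop)]
  rfl

/-- The intermediate law is μ ∗ K_h. It is joined to ν by the quantile coupling and to μ by (X + hξ,
X), where ξ has density k; the second coupling costs exactly h^p times the moment of k. -/
theorem wasserstein_rpow_le_cdfLoss_add {p : ℝ} (hp : 1 ≤ p) {k : ℝ → ℝ} (hk : IsKernel p k) {h : ℝ}
    (hh : 0 ≤ h) (μ ν : Measure ℝ) [IsProbabilityMeasure μ] [IsProbabilityMeasure ν] :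
    wasserstein p ν μ ^ p ≤ 2 ^ (p - 1) * (ENNReal.ofReal (4 ^ p) *
      cdfLoss p (cdf ν) (cdf (μ.conv (kernelLaw k h))) +
      ENNReal.ofReal (h ^ p) * ∫⁻ x, ENNReal.ofReal (|x| ^ p * k x)) := by
  have := hk.isProbabilityMeasure h
  have hm : Measurable fun z : ℝ × ℝ => (z.1 + z.2, z.1) := by fun_prop
  set π₂ : Measure (ℝ × ℝ) := (μ.prod (kernelLaw k h)).map fun z => (z.1 + z.2, z.1) with hπ
  have h₂ : π₂.fst = μ.conv (kernelLaw k h) := by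
    rw [hπ, Measure.fst, Measure.map_map measurable_fst hm]; rfl
  have h₂' : π₂.snd = μ := by
    rw [hπ, Measure.snd, Measure.map_map measurable_snd hm]
    exact Measure.fst_prod
  refine (wasserstein_rpow_le_of_couplings hp (fst_quantileCoupling ν _)
    (snd_quantileCoupling ν (μ.conv (kernelLaw k h))) h₂ h₂').trans ?_
  gcongr
  · exact lintegral_quantileCoupling_le hp _ _
  · have hmeas : Measurable fun z : ℝ × ℝ => ENNReal.ofReal (|z.1 - z.2| ^ p) :=
      (((measurable_fst.sub measurable_snd).abs).pow_const p).ennreal_ofReal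
    have hg : Measurable fun x : ℝ => ENNReal.ofReal (|x| ^ p) :=
      (measurable_id.abs.pow_const p).ennreal_ofReal
    rw [hπ, lintegral_map hmeas hm]
    simp only [add_sub_cancel_left]
    rw [lintegral_prod _ (by exact (hg.comp measurable_snd).aemeasurable)]
    simp only [lintegral_const, measure_univ, mul_one]
    rw [hk.lintegral_kernelLaw h hg, ← lintegral_const_mul' _ _ ENNReal.ofReal_ne_top]
    refine lintegral_mono fun x => ?_
    rw [abs_mul, abs_of_nonneg hh, Real.mul_rpow hh (abs_nonneg x),
      ENNReal.ofReal_mul (by positivity),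
      ENNReal.ofReal_mul (by positivity), mul_comm (ENNReal.ofReal (k x)), mul_assoc]

/-! ### Weighted integrals of root mean squares -/

theorem rpow_half_sq (a : ℝ≥0∞) : (a ^ (1 / 2 : ℝ)) ^ 2 = a := by
  rw [← ENNReal.rpow_natCast, ← ENNReal.rpow_mul]; norm_num

theorem sq_rpow_half (a : ℝ≥0∞) : (a ^ 2) ^ (1 / 2 : ℝ) = a := by
  rw [← ENNReal.rpow_natCast, ← ENNReal.rpow_mul]; norm_num

theorem lintegral_mul_rpow_half_le {α : Type*} [MeasurableSpace α] {μ : Measure α}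
    {f g : α → ℝ≥0∞} (hf : AEMeasurable f μ) (hg : AEMeasurable g μ) :
    ∫⁻ x, f x * g x ^ (1 / 2 : ℝ) ∂μ ≤
      (∫⁻ x, f x ^ 2 ∂μ) ^ (1 / 2 : ℝ) * (∫⁻ x, g x ∂μ) ^ (1 / 2 : ℝ) := by
  have h := ENNReal.lintegral_mul_le_Lp_mul_Lq μ Real.HolderConjugate.two_two hf
    (hg.pow_const (1 / 2 : ℝ))
  simpa only [Pi.mul_apply, ENNReal.rpow_two, rpow_half_sq] using h

theorem rpow_half_add_le (a b : ℝ≥0∞) :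
    (a + b) ^ (1 / 2 : ℝ) ≤ a ^ (1 / 2 : ℝ) + b ^ (1 / 2 : ℝ) :=
  ENNReal.rpow_add_le_add_rpow _ _ (by norm_num) (by norm_num)

/-- The root of the probability that `|Y| ≥ |x| / c`, if `Y` has law `ν`. -/
def rootTail (ν : Measure ℝ) (c x : ℝ) : ℝ≥0∞ := ν {y | |x| / c ≤ |y|} ^ (1 / 2 : ℝ)

theorem lintegral_rootTail_ne_top {p : ℝ} {ν : Measure ℝ} [IsProbabilityMeasure ν]
    (htail : ∫⁻ x in Ioi (0 : ℝ), ENNReal.ofReal (|x| ^ (p - 1) * √(ν.real {y | x ≤ |y|})) < ∞)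
    {c : ℝ} (hc : 0 < c) : ∫⁻ x, ENNReal.ofReal (|x| ^ (p - 1)) * rootTail ν c x ≠ ∞ := by
  set g : ℝ → ℝ≥0∞ := fun x => ENNReal.ofReal (|x| ^ (p - 1)) * rootTail ν 1 x with hg
  have h1 : ∫⁻ x in Ioi (0 : ℝ), g x < ∞ := by
    refine lt_of_le_of_lt (le_of_eq ?_) htail
    refine setLIntegral_congr_fun measurableSet_Ioi fun x hx => ?_
    simp only [hg, rootTail]
    rw [ENNReal.ofReal_mul (by positivity), Real.sqrt_eq_rpow,
      ← ENNReal.ofReal_rpow_of_nonneg measureReal_nonneg (by norm_num), ofReal_measureReal, div_one,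
      abs_of_pos hx]
  have h2 : ∫⁻ x in Iic (0 : ℝ), g x < ∞ := by
    have := (Measure.measurePreserving_neg (volume : Measure ℝ)).setLIntegral_comp_preimage_emb
      (MeasurableEquiv.neg ℝ).measurableEmbedding g (Iic 0)
    rw [← this]
    have e : Neg.neg ⁻¹' Iic (0 : ℝ) = Ici 0 := by ext; simp
    rw [e, setLIntegral_congr Ioi_ae_eq_Ici.symm]
    simpa [hg, rootTail] using h1
  have h3 : ∫⁻ x, g x < ∞ := by
    rw [← lintegral_add_compl g (measurableSet_Ioi (a := (0 : ℝ))), compl_Ioi]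
    exact ENNReal.add_lt_top.2 ⟨h1, h2⟩
  have h4 : ∀ x, ENNReal.ofReal (|x| ^ (p - 1)) * rootTail ν c x =
      ENNReal.ofReal (c ^ (p - 1)) * g (x / c) := fun x => by
    simp only [hg, rootTail, abs_div, abs_of_pos hc, div_one]
    rw [← mul_assoc, ← ENNReal.ofReal_mul (by positivity), Real.div_rpow (abs_nonneg x) hc.le,
      mul_div_cancel₀ _ (Real.rpow_pos_of_pos hc _).ne']
  simp_rw [h4]
  rw [lintegral_const_mul' _ _ ENNReal.ofReal_ne_top, lintegral_comp_div hc]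
  exact ENNReal.mul_ne_top ENNReal.ofReal_ne_top (ENNReal.mul_ne_top ENNReal.ofReal_ne_top h3.ne)

theorem lintegral_lintegral_mul_comp_sub {g u : ℝ → ℝ≥0∞} (hg : Measurable g) (hu : Measurable u)
    (ν : Measure ℝ) [SFinite ν] :
    ∫⁻ x, ∫⁻ y, u y * g (x - y) ∂ν = (∫⁻ y, u y ∂ν) * ∫⁻ x, g x := by
  rw [lintegral_lintegral_swap (by fun_prop)]
  have h : ∀ y, ∫⁻ x, u y * g (x - y) = u y * ∫⁻ x, g x := fun y => by
    rw [lintegral_const_mul _ (by fun_prop), lintegral_sub_right_eq_self g]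
  simp_rw [h]
  rw [lintegral_mul_const _ hu]

/-- A given x belongs to [t, t + 1] for a set of t of length one. This permits Cauchy-Schwarz on
unit windows, where the weight is nearly constant. -/
theorem lintegral_eq_lintegral_Icc {F : ℝ → ℝ≥0∞} (hF : Measurable F) :
    ∫⁻ x, F x = ∫⁻ t, ∫⁻ x in Icc t (t + 1), F x := by
  have h1 : ∀ t, ∫⁻ x in Icc t (t + 1), F x =
      ∫⁻ x, (Icc (x - 1) x).indicator (fun _ => F x) t := fun t => by
    rw [← lintegral_indicator measurableSet_Icc]
    refine lintegral_congr fun x => ?_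
    have : x ∈ Icc t (t + 1) ↔ t ∈ Icc (x - 1) x := by
      simp only [mem_Icc]; constructor <;> rintro ⟨h, h'⟩ <;> constructor <;> linarith
    simp only [indicator, this]
  simp_rw [h1]
  rw [lintegral_lintegral_swap]
  · simp [lintegral_indicator measurableSet_Icc]
  · have hA : MeasurableSet {z : ℝ × ℝ | z.1 ∈ Icc (z.2 - 1) z.2} :=
      (measurableSet_le (measurable_snd.sub_const 1) measurable_fst).inter
        (measurableSet_le measurable_fst measurable_snd)
    exact ((hF.comp measurable_snd).indicator hA).aemeasurable

/-- The weighted integral of the root of `g ∗ ν` is controlled by a weighted `L¹` norm of `g`. -/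
theorem exists_lintegral_rpow_half_conv_le {p : ℝ} (hp : 1 ≤ p) {m : ℕ} (hm : p - 1 / 2 < m)
    {ν : Measure ℝ} [IsProbabilityMeasure ν]
    (htail : ∫⁻ x, ENNReal.ofReal (|x| ^ (p - 1)) * rootTail ν 3 x ≠ ∞) :
    ∃ C : ℝ≥0∞, C ≠ ∞ ∧ ∀ g : ℝ → ℝ≥0∞, Measurable g →
      ∫⁻ x, ENNReal.ofReal (|x| ^ (p - 1)) * (∫⁻ y, g (x - y) ∂ν) ^ (1 / 2 : ℝ) ≤
        C * (∫⁻ z, ENNReal.ofReal ((1 + |z|) ^ (2 * m)) * g z) ^ (1 / 2 : ℝ) := by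
  -- The Cauchy-Schwarz constant for the region |y| ≤ |x|/2. Its integrand is at most (1 +
  -- |x|)^(2(p-1-m)), integrable exactly when m > p - 1/2.
  set C₁ : ℝ≥0∞ := (∫⁻ x : ℝ, ENNReal.ofReal (|x| ^ (p - 1) * ((1 + |x|) ^ m)⁻¹) ^ 2) ^ (1 / 2 : ℝ)
    with hC₁
  set C₂ : ℝ≥0∞ := ∫⁻ t : ℝ, ENNReal.ofReal ((|t| + 1) ^ (p - 1)) *
    ν {y | (|t| - 1) / 2 ≤ |y|} ^ (1 / 2 : ℝ) with hC₂
  have hC₁top : C₁ ≠ ∞ := by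
    refine ENNReal.rpow_ne_top_of_nonneg (by norm_num) (ne_of_lt (lt_of_le_of_lt
      (lintegral_mono fun x => ?_) (finite_integral_one_add_norm (E := ℝ) (μ := volume)
      (r := 2 * m - 2 * p + 2) (by simp; linarith))))
    rw [← ENNReal.ofReal_pow (by positivity)]
    refine ENNReal.ofReal_le_ofReal ?_
    have hx : (0 : ℝ) < 1 + |x| := by positivity
    have h1 : |x| ^ (p - 1) * ((1 + |x|) ^ m)⁻¹ ≤ (1 + |x|) ^ (p - 1 - m) := by
      rw [Real.rpow_sub hx, Real.rpow_natCast, div_eq_mul_inv]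
      gcongr
      linarith
    calc (|x| ^ (p - 1) * ((1 + |x|) ^ m)⁻¹) ^ 2 ≤ ((1 + |x|) ^ (p - 1 - m)) ^ 2 := by gcongr
      _ = _ := by
        rw [← Real.rpow_natCast, ← Real.rpow_mul hx.le, Real.norm_eq_abs]
        congr 1
        push_cast
        ring
  have hC₂top : C₂ ≠ ∞ := by
    -- For |t| > 3 one has |t| + 1 ≤ 2|t| and (|t| - 1)/2 ≥ |t|/3, which explains the scale 3 in the
    -- tail hypothesis.
    have hle : ∀ t : ℝ, ENNReal.ofReal ((|t| + 1) ^ (p - 1)) *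
        ν {y | (|t| - 1) / 2 ≤ |y|} ^ (1 / 2 : ℝ) ≤
        (Icc (-3 : ℝ) 3).indicator (fun _ => ENNReal.ofReal (4 ^ (p - 1))) t +
        ENNReal.ofReal (2 ^ (p - 1)) *
          (ENNReal.ofReal (|t| ^ (p - 1)) * rootTail ν 3 t) := fun t => by
      by_cases ht : t ∈ Icc (-3 : ℝ) 3
      · refine le_add_right ?_
        rw [indicator_of_mem ht]
        have h3 : |t| ≤ 3 := abs_le.2 ht
        calc _ ≤ ENNReal.ofReal (4 ^ (p - 1)) * 1 ^ (1 / 2 : ℝ) :=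
              mul_le_mul' (ENNReal.ofReal_le_ofReal (Real.rpow_le_rpow (by positivity)
                (by linarith) (by linarith))) (ENNReal.rpow_le_rpow prob_le_one (by norm_num))
          _ = _ := by simp
      · refine le_add_left ?_
        have h3 : 3 < |t| := by rw [mem_Icc, ← abs_le] at ht; exact not_le.1 ht
        rw [← mul_assoc, ← ENNReal.ofReal_mul (by positivity),
          ← Real.mul_rpow zero_le_two (abs_nonneg t), rootTail]
        refine mul_le_mul' (ENNReal.ofReal_le_ofReal (Real.rpow_le_rpow (by positivity)
          (by linarith) (by linarith))) (ENNReal.rpow_le_rpow (measure_mono fun y hy => ?_)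
          (by norm_num))
        have hy' : (|t| - 1) / 2 ≤ |y| := hy
        change |t| / 3 ≤ |y|
        linarith
    refine ne_of_lt (lt_of_le_of_lt (lintegral_mono hle) ?_)
    rw [lintegral_add_left (by fun_prop (disch := exact measurableSet_Icc)),
      lintegral_const_mul' _ _ ENNReal.ofReal_ne_top, lintegral_indicator measurableSet_Icc,
      setLIntegral_const]
    exact ENNReal.add_lt_top.2 ⟨ENNReal.mul_lt_top ENNReal.ofReal_lt_top (by simp),
      ENNReal.mul_lt_top ENNReal.ofReal_lt_top htail.lt_top⟩
  -- The summand 1 makes the constant nonzero, so that the bound is infinite when I is.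
  refine ⟨C₁ * 2 ^ m + C₂ + 1, by finiteness, fun g hg => ?_⟩
  set I := ∫⁻ z, ENNReal.ofReal ((1 + |z|) ^ (2 * m)) * g z with hI
  by_cases hItop : I = ∞
  · rw [hItop, ENNReal.top_rpow_of_pos (by norm_num), ENNReal.mul_top (by simp)]
    exact le_top
  -- If |y| ≤ |x|/2, then x - y is comparable with x and the weight passes to g. Otherwise |y| is
  -- large and the tail of ν supplies the decay.
  set A : Set (ℝ × ℝ) := {z | |z.2| ≤ |z.1| / 2} with hA
  have hAm : MeasurableSet A := measurableSet_le (by fun_prop) (by fun_prop)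
  have hF : Measurable fun z : ℝ × ℝ => g (z.1 - z.2) := by fun_prop
  set H₁ : ℝ → ℝ≥0∞ := fun x => ∫⁻ y, A.indicator (fun z => g (z.1 - z.2)) (x, y) ∂ν with hH₁
  set H₂ : ℝ → ℝ≥0∞ := fun x => ∫⁻ y, Aᶜ.indicator (fun z => g (z.1 - z.2)) (x, y) ∂ν with hH₂
  have hm₁ : Measurable H₁ := (hF.indicator hAm).lintegral_prod_right'
  have hm₂ : Measurable H₂ := (hF.indicator hAm.compl).lintegral_prod_right'
  have hw : Measurable fun x : ℝ => ENNReal.ofReal (|x| ^ (p - 1)) :=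
    (measurable_id.abs.pow_const _).ennreal_ofReal
  have hwm : ∀ {H : ℝ → ℝ≥0∞}, Measurable H →
      Measurable fun x : ℝ => ENNReal.ofReal (|x| ^ (p - 1)) * H x ^ (1 / 2 : ℝ) :=
    fun hH => hw.mul (hH.pow_const _)
  have hsplit : ∀ x, ∫⁻ y, g (x - y) ∂ν = H₁ x + H₂ x := fun x => by
    rw [hH₁, hH₂, ← lintegral_add_left
      (by exact (hF.indicator hAm).comp (measurable_const.prodMk measurable_id))]
    exact lintegral_congr fun y => (indicator_self_add_compl_apply A
      (fun z : ℝ × ℝ => g (z.1 - z.2)) (x, y)).symm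
  have hpart₁ : ∫⁻ x, ENNReal.ofReal (|x| ^ (p - 1)) * H₁ x ^ (1 / 2 : ℝ) ≤
      C₁ * 2 ^ m * I ^ (1 / 2 : ℝ) := by
    calc ∫⁻ x, ENNReal.ofReal (|x| ^ (p - 1)) * H₁ x ^ (1 / 2 : ℝ)
        = ∫⁻ x, ENNReal.ofReal (|x| ^ (p - 1) * ((1 + |x|) ^ m)⁻¹) *
            (ENNReal.ofReal ((1 + |x|) ^ m) ^ 2 * H₁ x) ^ (1 / 2 : ℝ) := by
          refine lintegral_congr fun x => ?_
          rw [ENNReal.mul_rpow_of_nonneg _ _ (by norm_num), sq_rpow_half, ← mul_assoc,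
            ← ENNReal.ofReal_mul (by positivity), inv_mul_cancel_right₀ (by positivity)]
      _ ≤ C₁ * (∫⁻ x, ENNReal.ofReal ((1 + |x|) ^ m) ^ 2 * H₁ x) ^ (1 / 2 : ℝ) :=
          lintegral_mul_rpow_half_le (by fun_prop) (by fun_prop)
      _ ≤ C₁ * ((2 ^ m) ^ 2 * I) ^ (1 / 2 : ℝ) := by
          gcongr
          have hmeas : Measurable fun z => ENNReal.ofReal ((1 + |z|) ^ (2 * m)) * g z := by fun_prop
          have := lintegral_lintegral_mul_comp_sub hmeas (measurable_const (a := (1 : ℝ≥0∞))) ν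
          simp only [one_mul, lintegral_const, measure_univ] at this
          rw [hI, ← this, ← lintegral_const_mul _ (by fun_prop)]
          refine lintegral_mono fun x => ?_
          rw [hH₁, ← lintegral_const_mul _
            (by exact (hF.indicator hAm).comp (measurable_const.prodMk measurable_id)),
            ← lintegral_const_mul _ (by fun_prop)]
          refine lintegral_mono fun y => ?_
          by_cases hxy : (x, y) ∈ A
          · rw [indicator_of_mem hxy, ← mul_assoc]
            gcongr ?_ * _
            rw [← ENNReal.ofReal_pow (by positivity), show ((2 : ℝ≥0∞) ^ m) ^ 2 =
              ENNReal.ofReal ((2 ^ m) ^ 2) by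
                rw [ENNReal.ofReal_pow (by positivity), ENNReal.ofReal_pow (by positivity),
                  ENNReal.ofReal_ofNat], ← ENNReal.ofReal_mul (by positivity)]
            refine ENNReal.ofReal_le_ofReal ?_
            have hy : |y| ≤ |x| / 2 := hxy
            have h1 : 1 + |x| ≤ 2 * (1 + |x - y|) := by linarith [abs_sub_abs_le_abs_sub x y]
            calc ((1 + |x|) ^ m) ^ 2 ≤ ((2 * (1 + |x - y|)) ^ m) ^ 2 := by gcongr
              _ = _ := by rw [mul_pow, mul_pow]; ring
          · rw [indicator_of_notMem hxy, mul_zero]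
            exact zero_le
      _ = _ := by
          rw [ENNReal.mul_rpow_of_nonneg _ _ (by norm_num), sq_rpow_half, mul_assoc]
  have hpart₂ : ∫⁻ x, ENNReal.ofReal (|x| ^ (p - 1)) * H₂ x ^ (1 / 2 : ℝ) ≤
      C₂ * I ^ (1 / 2 : ℝ) := by
    -- For x in [t, t + 1], the condition |y| > |x|/2 forces |y| ≥ (|t| - 1)/2. Cauchy-Schwarz on
    -- the window then separates the root of the tail probability from the root of the integral of
    -- g.
    rw [lintegral_eq_lintegral_Icc (hwm hm₂), hC₂, ← lintegral_mul_const'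
      _ _ (ENNReal.rpow_ne_top_of_nonneg (by norm_num) hItop)]
    refine lintegral_mono fun t => ?_
    set E : Set ℝ := {y | (|t| - 1) / 2 ≤ |y|} with hE
    have hEm : MeasurableSet E := measurableSet_le (by fun_prop) (by fun_prop)
    set u : ℝ → ℝ≥0∞ := E.indicator 1 with hu
    have hum : Measurable u := measurable_one.indicator hEm
    have habs : ∀ x ∈ Icc t (t + 1), |x - t| ≤ 1 := fun x hx => by
      rw [abs_le]; constructor <;> linarith [hx.1, hx.2]
    calc ∫⁻ x in Icc t (t + 1), ENNReal.ofReal (|x| ^ (p - 1)) * H₂ x ^ (1 / 2 : ℝ)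
        ≤ ∫⁻ x in Icc t (t + 1), ENNReal.ofReal ((|t| + 1) ^ (p - 1)) *
            (∫⁻ y, u y * g (x - y) ∂ν) ^ (1 / 2 : ℝ) := by
          refine setLIntegral_mono' measurableSet_Icc fun x hx => ?_
          have h1 := habs x hx
          refine mul_le_mul' (ENNReal.ofReal_le_ofReal (Real.rpow_le_rpow (abs_nonneg x)
            (by linarith [abs_sub_abs_le_abs_sub x t]) (by linarith)))
            (ENNReal.rpow_le_rpow (lintegral_mono fun y => ?_) (by norm_num))
          by_cases hxy : (x, y) ∈ Aᶜ
          · rw [indicator_of_mem hxy, hu, indicator_of_mem, Pi.one_apply, one_mul]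
            have : |x| / 2 < |y| := not_le.1 hxy
            have h2 := abs_sub_abs_le_abs_sub t x
            rw [abs_sub_comm] at h2
            change (|t| - 1) / 2 ≤ |y|
            linarith
          · rw [indicator_of_notMem hxy]; exact zero_le
      _ ≤ (∫⁻ x in Icc t (t + 1), ENNReal.ofReal ((|t| + 1) ^ (p - 1)) ^ 2) ^ (1 / 2 : ℝ) *
            (∫⁻ x in Icc t (t + 1), ∫⁻ y, u y * g (x - y) ∂ν) ^ (1 / 2 : ℝ) :=
          lintegral_mul_rpow_half_le (by fun_prop) (Measurable.aemeasurable (by fun_prop))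
      _ ≤ ENNReal.ofReal ((|t| + 1) ^ (p - 1)) * (ν E * I) ^ (1 / 2 : ℝ) := by
          rw [setLIntegral_const, Real.volume_Icc, add_sub_cancel_left, ENNReal.ofReal_one, mul_one,
            sq_rpow_half]
          gcongr
          refine (setLIntegral_le_lintegral _ _).trans ?_
          rw [lintegral_lintegral_mul_comp_sub hg hum, hu, lintegral_indicator_one hEm]
          gcongr
          refine lintegral_mono fun z => le_mul_of_one_le_left zero_le ?_
          rw [ENNReal.one_le_ofReal]
          exact one_le_pow₀ (by linarith [abs_nonneg z])
      _ = _ := by rw [ENNReal.mul_rpow_of_nonneg _ _ (by norm_num), mul_assoc]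
  calc ∫⁻ x, ENNReal.ofReal (|x| ^ (p - 1)) * (∫⁻ y, g (x - y) ∂ν) ^ (1 / 2 : ℝ)
      ≤ ∫⁻ x, (ENNReal.ofReal (|x| ^ (p - 1)) * H₁ x ^ (1 / 2 : ℝ) +
          ENNReal.ofReal (|x| ^ (p - 1)) * H₂ x ^ (1 / 2 : ℝ)) := by
        refine lintegral_mono fun x => ?_
        rw [hsplit, ← mul_add]
        gcongr
        exact rpow_half_add_le _ _
    _ ≤ C₁ * 2 ^ m * I ^ (1 / 2 : ℝ) + C₂ * I ^ (1 / 2 : ℝ) := by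
        rw [lintegral_add_left (hwm hm₁)]
        exact add_le_add hpart₁ hpart₂
    _ = (C₁ * 2 ^ m + C₂) * I ^ (1 / 2 : ℝ) := by rw [add_mul]
    _ ≤ _ := mul_le_mul' le_self_add le_rfl

theorem rpow_half_lintegral_add_sq_le {α : Type*} [MeasurableSpace α] {μ : Measure α}
    {f g : α → ℝ≥0∞} (hf : AEMeasurable f μ) (hg : AEMeasurable g μ) :
    (∫⁻ x, (f x + g x) ^ 2 ∂μ) ^ (1 / 2 : ℝ) ≤
      (∫⁻ x, f x ^ 2 ∂μ) ^ (1 / 2 : ℝ) + (∫⁻ x, g x ^ 2 ∂μ) ^ (1 / 2 : ℝ) := by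
  simpa using ENNReal.lintegral_Lp_add_le hf hg one_le_two

/-- A weighted `L²` bound implies a weighted `L¹` bound. -/
theorem lintegral_one_add_rpow_mul_lt_top {p : ℝ} {m : ℕ} (hm : p + 1 / 2 < m) {f : ℝ → ℂ}
    (hf : Measurable f) (h : ∫⁻ v, ENNReal.ofReal ((1 + |v|) ^ (2 * m) * ‖f v‖ ^ 2) < ∞) :
    ∫⁻ v, ENNReal.ofReal ((1 + |v|) ^ p) * ‖f v‖ₑ < ∞ := by
  calc ∫⁻ v, ENNReal.ofReal ((1 + |v|) ^ p) * ‖f v‖ₑ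
      = ∫⁻ v, ENNReal.ofReal ((1 + |v|) ^ (p - m)) *
          ENNReal.ofReal ((1 + |v|) ^ (2 * m) * ‖f v‖ ^ 2) ^ (1 / 2 : ℝ) := by
        refine lintegral_congr fun v => ?_
        have hv : (0 : ℝ) < 1 + |v| := by positivity
        have e : (1 + |v|) ^ (2 * m) * ‖f v‖ ^ 2 = ((1 + |v|) ^ m * ‖f v‖) ^ 2 := by ring
        rw [e, ENNReal.ofReal_pow (by positivity), sq_rpow_half, ENNReal.ofReal_mul (by positivity),
          ← mul_assoc, ← ENNReal.ofReal_mul (by positivity), ← Real.rpow_natCast,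
          ← Real.rpow_add hv, sub_add_cancel, ofReal_norm]
    _ ≤ (∫⁻ v, ENNReal.ofReal ((1 + |v|) ^ (p - m)) ^ 2) ^ (1 / 2 : ℝ) *
          (∫⁻ v, ENNReal.ofReal ((1 + |v|) ^ (2 * m) * ‖f v‖ ^ 2)) ^ (1 / 2 : ℝ) :=
        lintegral_mul_rpow_half_le
          (((measurable_const.add measurable_id.abs).pow_const _).ennreal_ofReal.aemeasurable)
          (by fun_prop)
    _ < ∞ := by
        -- The remaining weight has exponent -2(m - p), which is below -1 because m > p + 1/2.
        refine ENNReal.mul_lt_top (ENNReal.rpow_lt_top_of_nonneg (by norm_num) (ne_of_lt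
          (lt_of_le_of_lt (lintegral_mono fun v => ?_) (finite_integral_one_add_norm (E := ℝ)
          (μ := volume) (r := 2 * (m - p)) (by simp; linarith)))))
          (ENNReal.rpow_lt_top_of_nonneg (by norm_num) h.ne)
        have hv : (0 : ℝ) < 1 + |v| := by positivity
        rw [← ENNReal.ofReal_pow (by positivity), ← Real.rpow_natCast, ← Real.rpow_mul hv.le,
          Real.norm_eq_abs]
        refine ENNReal.ofReal_le_ofReal (le_of_eq ?_)
        congr 1
        push_cast
        ring

theorem lintegral_enorm_le {p : ℝ} (hp : 0 ≤ p) (f : ℝ → ℂ) :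
    ∫⁻ v, ‖f v‖ₑ ≤ ∫⁻ v, ENNReal.ofReal ((1 + |v|) ^ p) * ‖f v‖ₑ :=
  lintegral_mono fun v => le_mul_of_one_le_left zero_le
    (ENNReal.one_le_ofReal.2 (Real.one_le_rpow (by linarith [abs_nonneg v]) hp))

/-! ### Primitives of densities with integral one -/

section lowFrequency

variable {q : ℝ → ℂ}

/-- As q has integral one, the difference is, up to sign, the integral of q over the half-line
beyond x - y that points away from the origin. If |y| < |x|/2, this half-line lies in |v| ≥ |x|/2;
otherwise the full L¹ norm is used. -/
theorem enorm_integral_Iic_sub_le (hq : Integrable q) (h1 : ∫ v, q v = 1) (x y : ℝ) :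
    ‖(∫ v in Iic (x - y), q v) - (if 0 ≤ x then 1 else 0)‖ₑ ≤
      (∫⁻ v in {v | |x| / 2 ≤ |v|}, ‖q v‖ₑ) +
        (∫⁻ v, ‖q v‖ₑ) * {y : ℝ | |x| / 2 ≤ |y|}.indicator 1 y := by
  obtain ⟨S, hS, hsub⟩ : ∃ S : Set ℝ, ‖(∫ v in Iic (x - y), q v) - (if 0 ≤ x then 1 else 0)‖ₑ ≤
      ∫⁻ v in S, ‖q v‖ₑ ∧ (|y| < |x| / 2 → S ⊆ {v | |x| / 2 ≤ |v|}) := by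
    by_cases hx : 0 ≤ x
    · refine ⟨Ioi (x - y), ?_, fun hy v hv => ?_⟩
      · have := integral_add_compl (measurableSet_Iic (a := x - y)) hq
        rw [h1, compl_Iic] at this
        rw [if_pos hx, ← this, sub_add_cancel_left, enorm_neg]
        exact enorm_integral_le_lintegral_enorm _
      · have hv' : x - y < v := hv
        rw [abs_of_nonneg hx] at hy
        change |x| / 2 ≤ |v|
        rw [abs_of_nonneg hx]
        linarith [le_abs_self v, le_abs_self y]
    · refine ⟨Iic (x - y), ?_, fun hy v hv => ?_⟩
      · rw [if_neg hx, sub_zero]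
        exact enorm_integral_le_lintegral_enorm _
      · have hv' : v ≤ x - y := hv
        rw [abs_of_neg (not_le.1 hx)] at hy
        change |x| / 2 ≤ |v|
        rw [abs_of_neg (not_le.1 hx)]
        linarith [neg_abs_le v, neg_abs_le y]
  refine hS.trans ?_
  by_cases hy : |x| / 2 ≤ |y|
  · rw [indicator_of_mem (by exact hy), Pi.one_apply, mul_one]
    exact le_add_left (setLIntegral_le_lintegral _ _)
  · exact le_add_right (lintegral_mono_set (hsub (not_le.1 hy)))

/-- By Tonelli: at fixed v, the variable x ranges over |x| ≤ 2|v|, where the weight integrates to a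
multiple of |v|^p at most. -/
theorem lintegral_rpow_mul_setLIntegral_le {p : ℝ} (hp : 1 ≤ p) (hq : Measurable q) :
    ∫⁻ x : ℝ, ENNReal.ofReal (|x| ^ (p - 1)) * ∫⁻ v in {v | |x| / 2 ≤ |v|}, ‖q v‖ₑ ≤
      ENNReal.ofReal (2 * 2 ^ p) * ∫⁻ v, ENNReal.ofReal ((1 + |v|) ^ p) * ‖q v‖ₑ := by
  set A : Set (ℝ × ℝ) := {z | |z.1| / 2 ≤ |z.2|} with hA
  have hAm : MeasurableSet A := measurableSet_le (by fun_prop) (by fun_prop)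
  set F : ℝ × ℝ → ℝ≥0∞ := A.indicator fun z => ENNReal.ofReal (|z.1| ^ (p - 1)) * ‖q z.2‖ₑ with hF
  have hFm : Measurable F := Measurable.indicator
    ((measurable_fst.abs.pow_const _).ennreal_ofReal.mul (hq.comp measurable_snd).enorm) hAm
  have h1 : ∀ x : ℝ, ENNReal.ofReal (|x| ^ (p - 1)) * ∫⁻ v in {v | |x| / 2 ≤ |v|}, ‖q v‖ₑ =
      ∫⁻ v, F (x, v) := fun x => by
    rw [← lintegral_indicator (measurableSet_le (by fun_prop) (by fun_prop)),
      ← lintegral_const_mul' _ _ ENNReal.ofReal_ne_top]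
    refine lintegral_congr fun v => ?_
    simp only [hF, hA, indicator, mem_ofPred_eq, mul_ite, mul_zero]
  simp_rw [h1]
  rw [lintegral_lintegral_swap (by exact hFm.aemeasurable),
    ← lintegral_const_mul' _ _ ENNReal.ofReal_ne_top]
  refine lintegral_mono fun v => ?_
  calc ∫⁻ x, F (x, v) ≤ ∫⁻ x in Icc (-(2 * |v|)) (2 * |v|),
        ENNReal.ofReal ((2 * |v|) ^ (p - 1)) * ‖q v‖ₑ := by
        rw [← lintegral_indicator measurableSet_Icc]
        refine lintegral_mono fun x => ?_
        by_cases hx : (x, v) ∈ A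
        · have hx' : |x| ≤ 2 * |v| := by
            have : |x| / 2 ≤ |v| := hx
            linarith
          rw [hF, indicator_of_mem hx, indicator_of_mem (by exact abs_le.1 hx')]
          exact mul_le_mul' (ENNReal.ofReal_le_ofReal (Real.rpow_le_rpow (abs_nonneg x) hx'
            (by linarith))) le_rfl
        · rw [hF, indicator_of_notMem hx]; exact zero_le
    _ ≤ _ := by
        rw [setLIntegral_const, Real.volume_Icc, mul_right_comm, ← mul_assoc,
          ← ENNReal.ofReal_mul (by positivity), ← ENNReal.ofReal_mul (by positivity)]
        gcongr ENNReal.ofReal ?_ * _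
        have hv := abs_nonneg v
        calc (2 * |v|) ^ (p - 1) * (2 * |v| - -(2 * |v|))
            ≤ (2 * (1 + |v|)) ^ (p - 1) * (2 * (2 * (1 + |v|))) := by
              refine mul_le_mul (Real.rpow_le_rpow (by positivity) (by linarith) (by linarith))
                (by linarith) (by linarith) (by positivity)
          _ = 2 * (2 * (1 + |v|)) ^ p := by
              have := Real.rpow_sub_one (by positivity : 2 * (1 + |v|) ≠ 0) p
              rw [this]
              field_simp
          _ = 2 * 2 ^ p * (1 + |v|) ^ p := by
              rw [Real.mul_rpow zero_le_two (by positivity), mul_assoc]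

theorem measurable_rootTail (ν : Measure ℝ) [SFinite ν] (c : ℝ) : Measurable (rootTail ν c) := by
  have hA : MeasurableSet {z : ℝ × ℝ | |z.1| / c ≤ |z.2|} :=
    measurableSet_le (by fun_prop) (by fun_prop)
  exact (measurable_measure_prodMk_left hA).pow_const _

/-- The contribution of an integrable function with integral one. -/
theorem lintegral_rpow_half_integral_Iic_le {p : ℝ} (hp : 1 ≤ p) (hqm : Measurable q)
    (hq : Integrable q) (h1 : ∫ v, q v = 1) (ν : Measure ℝ) [IsProbabilityMeasure ν] :
    ∫⁻ x : ℝ, ENNReal.ofReal (|x| ^ (p - 1)) * (∫⁻ y, ‖(∫ v in Iic (x - y), q v) -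
        (if 0 ≤ x then 1 else 0)‖ₑ ^ 2 ∂ν) ^ (1 / 2 : ℝ) ≤
      (ENNReal.ofReal (2 * 2 ^ p) + ∫⁻ x, ENNReal.ofReal (|x| ^ (p - 1)) * rootTail ν 2 x) *
        ∫⁻ v, ENNReal.ofReal ((1 + |v|) ^ p) * ‖q v‖ₑ := by
  set N := ∫⁻ v, ‖q v‖ₑ with hN
  have hw : Measurable fun x : ℝ => ENNReal.ofReal (|x| ^ (p - 1)) :=
    (measurable_id.abs.pow_const _).ennreal_ofReal
  have hwt : Measurable fun x => ENNReal.ofReal (|x| ^ (p - 1)) * rootTail ν 2 x :=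
    hw.mul (measurable_rootTail ν 2)
  have hpt : ∀ x : ℝ, (∫⁻ y, ‖(∫ v in Iic (x - y), q v) -
        (if 0 ≤ x then 1 else 0)‖ₑ ^ 2 ∂ν) ^ (1 / 2 : ℝ) ≤
      (∫⁻ v in {v | |x| / 2 ≤ |v|}, ‖q v‖ₑ) + N * rootTail ν 2 x := fun x => by
    have hE : MeasurableSet {y : ℝ | |x| / 2 ≤ |y|} := measurableSet_le (by fun_prop) (by fun_prop)
    have hm : Measurable fun y => N * {y : ℝ | |x| / 2 ≤ |y|}.indicator 1 y :=
      (measurable_one.indicator hE).const_mul _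
    -- Minkowski in L²(ν): the first term does not depend on y, and the indicator has root mean
    -- square equal to the root of the tail probability.
    calc _ ≤ (∫⁻ y, ((∫⁻ v in {v | |x| / 2 ≤ |v|}, ‖q v‖ₑ) +
          N * {y : ℝ | |x| / 2 ≤ |y|}.indicator 1 y) ^ 2 ∂ν) ^ (1 / 2 : ℝ) := by
          gcongr with y
          exact enorm_integral_Iic_sub_le hq h1 x y
      _ ≤ _ := rpow_half_lintegral_add_sq_le aemeasurable_const hm.aemeasurable
      _ = _ := by
          rw [lintegral_const, measure_univ, mul_one, sq_rpow_half]
          congr 1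
          simp_rw [mul_pow]
          have e : ∀ y, ({y : ℝ | |x| / 2 ≤ |y|}.indicator (1 : ℝ → ℝ≥0∞) y) ^ 2 =
              {y : ℝ | |x| / 2 ≤ |y|}.indicator 1 y := fun y => by
            by_cases hy : y ∈ {y : ℝ | |x| / 2 ≤ |y|}
            · rw [indicator_of_mem hy]; simp
            · rw [indicator_of_notMem hy]; simp
          simp_rw [e]
          rw [lintegral_const_mul _ (measurable_one.indicator hE), lintegral_indicator_one hE,
            ENNReal.mul_rpow_of_nonneg _ _ (by norm_num), sq_rpow_half]
          rfl
  calc _ ≤ ∫⁻ x : ℝ, (ENNReal.ofReal (|x| ^ (p - 1)) * (∫⁻ v in {v | |x| / 2 ≤ |v|}, ‖q v‖ₑ) +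
        N * (ENNReal.ofReal (|x| ^ (p - 1)) * rootTail ν 2 x)) := by
        refine lintegral_mono fun x => ?_
        rw [mul_left_comm N, ← mul_add]
        gcongr
        exact hpt x
    _ ≤ _ := by
        rw [lintegral_add_right _ (hwt.const_mul N), add_mul,
          lintegral_const_mul _ hwt, mul_comm N]
        refine add_le_add (lintegral_rpow_mul_setLIntegral_le hp hqm) ?_
        gcongr
        exact lintegral_enorm_le (by linarith) q

end lowFrequency

/-! ### Averages of pairwise independent variables -/

/-- The first absolute moment is bounded by the standard deviation; pairwise independence divides
the variance by n, and a variance is at most the second moment about any constant. The constant c is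
left free so that it can depend on x later. -/
theorem lintegral_abs_average_sub_le {Ω : Type*} [MeasurableSpace Ω] {P : Measure Ω}
    [IsProbabilityMeasure P] {n : ℕ} (hn : 0 < n) {Y : Fin n → Ω → ℝ} {ν : Measure ℝ}
    [IsProbabilityMeasure ν] (hY : ∀ i, Measurable (Y i)) (hlaw : ∀ i, P.map (Y i) = ν)
    (hind : Pairwise fun i j => IndepFun (Y i) (Y j) P) {g : ℝ → ℝ} (hg : Measurable g) {M : ℝ}
    (hM : ∀ y, |g y| ≤ M) (c : ℝ) :
    ∫⁻ ω, ENNReal.ofReal |1 / n * ∑ i, g (Y i ω) - ∫ y, g y ∂ν| ∂P ≤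
      ENNReal.ofReal ((n : ℝ) ^ (-(1 / 2) : ℝ)) * (∫⁻ y, ‖g y - c‖ₑ ^ 2 ∂ν) ^ (1 / 2 : ℝ) := by
  have hn' : (0 : ℝ) < n := by exact_mod_cast hn
  have hgν : MemLp g 2 ν := MemLp.of_bound hg.aestronglyMeasurable M (.of_forall hM)
  have hgY : ∀ i, MemLp (fun ω => g (Y i ω)) 2 P := fun i =>
    MemLp.of_bound (hg.comp (hY i)).aestronglyMeasurable M (.of_forall fun ω => hM _)
  have hmean : ∀ i, ∫ ω, g (Y i ω) ∂P = ∫ y, g y ∂ν := fun i => by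
    rw [← hlaw i, integral_map (hY i).aemeasurable hg.aestronglyMeasurable]
  have hvar : ∀ i, variance (fun ω => g (Y i ω)) P = variance g ν := fun i => by
    rw [← hlaw i, variance_map hg.aemeasurable (hY i).aemeasurable]; rfl
  set Z : Ω → ℝ := fun ω => 1 / n * ∑ i, g (Y i ω) with hZ
  have hZL : MemLp Z 2 P := (memLp_finsetSum Finset.univ fun i _ => hgY i).const_mul _
  have hZm : Measurable Z := by fun_prop
  have hEZ : ∫ ω, Z ω ∂P = ∫ y, g y ∂ν := by
    rw [hZ, integral_const_mul, integral_finsetSum _ fun i _ => (hgY i).integrable one_le_two]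
    simp only [hmean, Finset.sum_const, Finset.card_univ, Fintype.card_fin, nsmul_eq_mul]
    field_simp
  have hVZ : variance Z P = variance g ν / n := by
    have h1 : variance (∑ i, fun ω => g (Y i ω)) P = ∑ i, variance (fun ω => g (Y i ω)) P :=
      IndepFun.variance_sum (fun i _ => hgY i) fun i _ j _ hij => (hind hij).comp hg hg
    have h2 : Z = fun ω => 1 / n * (∑ i, fun ω => g (Y i ω)) ω := by
      ext ω; simp [hZ]
    rw [h2, variance_const_mul, h1]
    simp only [hvar, Finset.sum_const, Finset.card_univ, Fintype.card_fin, nsmul_eq_mul]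
    field_simp
  have hle : variance g ν ≤ ∫ y, (g y - c) ^ 2 ∂ν := by
    rw [← variance_sub_const hg.aestronglyMeasurable c]
    exact variance_le_expectation_sq (hg.sub_const c).aestronglyMeasurable
  have hsq : ∫⁻ ω, ENNReal.ofReal |Z ω - ∫ y, g y ∂ν| ^ 2 ∂P = ENNReal.ofReal (variance Z P) := by
    rw [hZL.ofReal_variance_eq, evariance, hEZ]
    refine lintegral_congr fun ω => ?_
    rw [← Real.norm_eq_abs, ofReal_norm]
  have hint : ENNReal.ofReal (∫ y, (g y - c) ^ 2 ∂ν) = ∫⁻ y, ‖g y - c‖ₑ ^ 2 ∂ν := by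
    have hi : Integrable (fun y => (g y - c) ^ 2) ν := (hgν.sub (memLp_const c)).integrable_sq
    rw [ofReal_integral_eq_lintegral_ofReal hi (.of_forall fun y => sq_nonneg _)]
    refine lintegral_congr fun y => ?_
    rw [← ofReal_norm, ← ENNReal.ofReal_pow (norm_nonneg _), Real.norm_eq_abs, sq_abs]
  calc ∫⁻ ω, ENNReal.ofReal |Z ω - ∫ y, g y ∂ν| ∂P
      = ∫⁻ ω, 1 * (ENNReal.ofReal |Z ω - ∫ y, g y ∂ν| ^ 2) ^ (1 / 2 : ℝ) ∂P := by
        simp_rw [sq_rpow_half, one_mul]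
    _ ≤ (∫⁻ _, 1 ^ 2 ∂P) ^ (1 / 2 : ℝ) *
          (∫⁻ ω, ENNReal.ofReal |Z ω - ∫ y, g y ∂ν| ^ 2 ∂P) ^ (1 / 2 : ℝ) :=
        lintegral_mul_rpow_half_le aemeasurable_const (by fun_prop)
    _ ≤ ENNReal.ofReal ((n : ℝ)⁻¹ * ∫ y, (g y - c) ^ 2 ∂ν) ^ (1 / 2 : ℝ) := by
        rw [hsq, hVZ, one_pow, lintegral_const, measure_univ, mul_one, ENNReal.one_rpow, one_mul,
          div_eq_inv_mul]
        gcongr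
    _ = _ := by
        rw [ENNReal.ofReal_mul (by positivity), ENNReal.mul_rpow_of_nonneg _ _ (by norm_num), hint,
          ENNReal.ofReal_rpow_of_nonneg (by positivity) (by norm_num), Real.rpow_neg hn'.le,
          Real.inv_rpow hn'.le]

/-! ### The observations -/

section sample

variable {Ω : Type*} [MeasurableSpace Ω] {P : Measure Ω} [IsProbabilityMeasure P]
  {μ με : Measure ℝ} {n : ℕ}
  {X ε : Fin n → Ω → ℝ}

theorem IsConvolutionSample.map_add (h : IsConvolutionSample P μ με X ε) (i : Fin n) :
    P.map (fun ω => X i ω + ε i ω) = μ.conv με := by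
  have hi : IndepFun (X i) (ε i) P :=
    h.indep.comp (φ := fun x : Fin n → ℝ => x i) (ψ := fun x : Fin n → ℝ => x i) (by fun_prop)
      (by fun_prop)
  have := hi.map_add_eq_map_conv_map (h.measurable_signal i) (h.measurable_noise i)
  rwa [h.law_signal i, h.law_noise i] at this

/-- The four variables X i, X j, ε i, ε j have a product law, and the probability of a rectangle for
the two sums factors by Tonelli. -/
theorem IsConvolutionSample.pairwise_indepFun [IsProbabilityMeasure μ] [IsProbabilityMeasure με]
    (h : IsConvolutionSample P μ με X ε) :
    Pairwise fun i j => IndepFun (fun ω => X i ω + ε i ω) (fun ω => X j ω + ε j ω) P := by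
  intro i j hij
  have hX := h.measurable_signal
  have hε := h.measurable_noise
  have h4 : IndepFun (fun ω => (X i ω, X j ω)) (fun ω => (ε i ω, ε j ω)) P :=
    h.indep.comp (φ := fun x => (x i, x j)) (ψ := fun x => (x i, x j)) (by fun_prop) (by fun_prop)
  rw [indepFun_iff_map_prod_eq_prod_map_map (by fun_prop) (by fun_prop),
    (indepFun_iff_map_prod_eq_prod_map_map (by fun_prop) (by fun_prop)).1
      (h.indep_signal.indepFun hij),
    (indepFun_iff_map_prod_eq_prod_map_map (by fun_prop) (by fun_prop)).1
      (h.indep_noise.indepFun hij),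
    h.law_signal, h.law_signal, h.law_noise, h.law_noise] at h4
  rw [indepFun_iff_map_prod_eq_prod_map_map (by fun_prop) (by fun_prop), h.map_add, h.map_add]
  refine (Measure.prod_eq fun s t hs ht => ?_).symm
  have hm : Measurable fun z : (ℝ × ℝ) × ℝ × ℝ => (z.1.1 + z.2.1, z.1.2 + z.2.2) := by fun_prop
  have hmap : P.map (fun ω => (X i ω + ε i ω, X j ω + ε j ω)) =
      ((μ.prod μ).prod (με.prod με)).map fun z => (z.1.1 + z.2.1, z.1.2 + z.2.2) := by
    rw [← h4, Measure.map_map hm (by fun_prop)]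
    rfl
  have hs1 : Measurable (s.indicator (1 : ℝ → ℝ≥0∞)) := measurable_one.indicator hs
  have ht1 : Measurable (t.indicator (1 : ℝ → ℝ≥0∞)) := measurable_one.indicator ht
  have hind : (s ×ˢ t).indicator (1 : ℝ × ℝ → ℝ≥0∞) =
      fun z => s.indicator 1 z.1 * t.indicator 1 z.2 := by
    ext z
    by_cases h1 : z.1 ∈ s <;> by_cases h2 : z.2 ∈ t <;> simp [indicator, h1, h2]
  have hconv : ∀ {s : Set ℝ}, MeasurableSet s → (μ.conv με) s =
      ∫⁻ x, ∫⁻ e, s.indicator 1 (x + e) ∂με ∂μ := fun {s} hs => by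
    rw [← lintegral_indicator_one hs, Measure.lintegral_conv (measurable_one.indicator hs)]
  rw [hmap, ← lintegral_indicator_one (hs.prod ht), hind, lintegral_map (by fun_prop) hm,
    lintegral_prod _ (by fun_prop), hconv hs, hconv ht,
    ← lintegral_prod_mul (Measurable.aemeasurable (by fun_prop))
      (Measurable.aemeasurable (by fun_prop))]
  refine lintegral_congr fun x => ?_
  exact lintegral_prod_mul (f := fun e => s.indicator 1 (x.1 + e))
    (g := fun e => t.indicator 1 (x.2 + e)) (by fun_prop) (by fun_prop)

end sample

/-! ### Distribution functions of convolutions with signed densities -/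

/-- Characteristic functions determine finite positive measures, whereas q may change sign. The
negative part is therefore moved to the other side: ν ∗ q⁺ = ν ∗ q⁻ + ρ. Evaluation on half-lines
gives the claim. -/
theorem integral_integral_Iic_sub_eq {q : ℝ → ℝ} (hq : Integrable q) {ν ρ : Measure ℝ}
    [IsProbabilityMeasure ν] [IsProbabilityMeasure ρ]
    (hchar : ∀ t : ℝ, (∫ v : ℝ, Complex.exp (Complex.I * t * v) * (q v : ℂ)) * charFun ν t =
      charFun ρ t) (x : ℝ) :
    ∫ y, (∫ v in Iic (x - y), q v) ∂ν = cdf ρ x := by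
  set D : (ℝ → ℝ) → Measure ℝ := fun q => volume.withDensity fun v => ENNReal.ofReal (q v) with hD
  have hfin : ∀ {q : ℝ → ℝ}, Integrable q → IsFiniteMeasure (D q) := fun hq =>
    isFiniteMeasure_withDensity_ofReal hq.2
  have := hfin hq
  have := hfin hq.neg
  have hcf : ∀ {q : ℝ → ℝ}, Integrable q → ∀ t, charFun (D q) t =
      ∫ v : ℝ, ((max (q v) 0 : ℝ) : ℂ) * Complex.exp (Complex.I * t * v) := fun {q} hq t => by
    rw [charFun_apply_real, hD, integral_withDensity_eq_integral_toReal_smul₀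
      hq.aemeasurable.ennreal_ofReal (.of_forall fun _ => ENNReal.ofReal_lt_top)]
    refine integral_congr_ae (.of_forall fun v => ?_)
    simp only [ENNReal.toReal_ofReal', Complex.real_smul]
    congr 2
    ring
  have hint : ∀ {q : ℝ → ℝ}, Integrable q → ∀ t : ℝ, Integrable fun v : ℝ =>
      ((max (q v) 0 : ℝ) : ℂ) * Complex.exp (Complex.I * t * v) := fun {q} hq t => by
    refine (hq.pos_part.ofReal).mul_bdd (c := 1) (Continuous.aestronglyMeasurable (by fun_prop))
      (.of_forall fun v => ?_)
    rw [mul_assoc, mul_comm, ← Complex.ofReal_mul, Complex.norm_exp_ofReal_mul_I]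
  have heq : ν.conv (D q) = ν.conv (D (-q)) + ρ := by
    refine Measure.ext_of_charFun ?_
    ext t
    have hadd : charFun (ν.conv (D (-q)) + ρ) t = charFun (ν.conv (D (-q))) t + charFun ρ t := by
      simp only [charFun_apply_real]
      refine integral_add_measure ?_ ?_ <;>
      · refine Integrable.of_bound (Continuous.aestronglyMeasurable (by fun_prop)) 1
          (.of_forall fun v => ?_)
        rw [← Complex.ofReal_mul, Complex.norm_exp_ofReal_mul_I]
    rw [hadd, charFun_conv, charFun_conv, ← hchar t, ← sub_eq_iff_eq_add', ← mul_sub, mul_comm,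
      hcf hq, hcf hq.neg, ← integral_sub (hint hq t) (hint hq.neg t)]
    congr 1
    refine integral_congr_ae (.of_forall fun v => ?_)
    simp only [Pi.neg_apply]
    rw [← sub_mul, ← Complex.ofReal_sub, max_zero_sub_max_neg_zero_eq_self, mul_comm]
  have hI : ∀ {q : ℝ → ℝ}, Integrable q → (ν.conv (D q)).real (Iic x) =
      ∫ y, (D q).real (Iic (x - y)) ∂ν ∧ Integrable (fun y => (D q).real (Iic (x - y))) ν :=
    fun {q} hq => by
      have := hfin hq
      have hm : Measurable fun y => (D q) (Iic (x - y)) := by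
        have : Antitone fun y => (D q) (Iic (x - y)) := fun a b hab =>
          measure_mono (Iic_subset_Iic.2 (by linarith))
        exact this.measurable
      have hlt : ∀ y, (D q) (Iic (x - y)) < ∞ := fun y => measure_lt_top _ _
      constructor
      · simp only [Measure.real]
        rw [integral_toReal hm.aemeasurable (.of_forall hlt),
          ← lintegral_indicator_one measurableSet_Iic,
          Measure.lintegral_conv (measurable_one.indicator measurableSet_Iic)]
        congr 1
        refine lintegral_congr fun y => ?_
        rw [← lintegral_indicator_one measurableSet_Iic]
        refine lintegral_congr fun v => ?_
        have : y + v ∈ Iic x ↔ v ∈ Iic (x - y) := by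
          simp only [mem_Iic]; constructor <;> intro h <;> linarith
        simp only [indicator, this, Pi.one_apply]
      · refine Integrable.of_bound hm.ennreal_toReal.aestronglyMeasurable ((D q).real univ)
          (.of_forall fun y => ?_)
        rw [Real.norm_of_nonneg measureReal_nonneg]
        exact measureReal_mono (subset_univ _)
  have hz : ∀ z, ∫ v in Iic z, q v = (D q).real (Iic z) - (D (-q)).real (Iic z) := fun z => by
    rw [integral_eq_lintegral_pos_part_sub_lintegral_neg_part hq.integrableOn, Measure.real,
      Measure.real, hD]
    simp only [Pi.neg_apply]
    rw [withDensity_apply _ measurableSet_Iic, withDensity_apply _ measurableSet_Iic]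
  simp_rw [hz]
  rw [integral_sub (hI hq).2 (hI hq.neg).2, ← (hI hq).1, ← (hI hq.neg).1, heq, cdf_eq_real,
    measureReal_add_apply, add_sub_cancel_left]

/-! ### The deconvolution density -/

/-- One derivative suffices: it gives an L² bound with weight (1 + |v|)², and Cauchy-Schwarz turns
this into an L¹ bound, as 1 > 1/2. -/
theorem integrable_invFourier {R : ℝ} {b : ℝ → ℝ} {f : ℝ → ℂ} (hm : Measurable f)
    (hb : Continuous b) (h : DerivBound univ 1 b f) (hR : ∀ t, R < |t| → f t = 0) :
    Integrable (invFourier f) := by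
  have hc := continuous_invFourier (integrable_of_support hm hb (fun t => h.norm_le t trivial) hR)
  refine ⟨hc.aestronglyMeasurable, ?_⟩
  have h1 := lintegral_one_add_rpow_mul_lt_top (p := 0) (m := 1) (by norm_num) hc.measurable
    ((lintegral_one_add_pow_mul_sq_invFourier_le hm hb h hR).trans_lt (ENNReal.mul_lt_top
      ENNReal.ofReal_lt_top ((hb.pow 2).continuousOn.integrableOn_Icc).lintegral_lt_top))
  exact (lintegral_enorm_le le_rfl _).trans_lt h1

theorem invFourier_add {f g : ℝ → ℂ} (hf : Integrable f) (hg : Integrable g) (v : ℝ) :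
    invFourier (fun w => f w + g w) v = invFourier f v + invFourier g v := by
  have hb : ∀ {f : ℝ → ℂ}, Integrable f →
      Integrable fun w : ℝ => Complex.exp (-(Complex.I * w * v)) * f w := fun {f} hf =>
    hf.bdd_mul (c := 1) (Continuous.aestronglyMeasurable (by fun_prop)) (.of_forall fun w => by
      rw [mul_assoc, ← Complex.ofReal_mul, ← mul_neg, ← Complex.ofReal_neg, mul_comm,
        Complex.norm_exp_ofReal_mul_I])
  simp only [invFourier_eq_integral, mul_add]
  rw [integral_add (hb hf) (hb hg), mul_add]

theorem conj_invFourier {f : ℝ → ℂ} (hf : ∀ w, conj (f (-w)) = f w) (v : ℝ) :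
    conj (invFourier f v) = invFourier f v := by
  rw [invFourier_eq_integral, map_mul, ← integral_conj, ← integral_neg_eq_self]
  congr 1
  · rw [show (1 / (2 * Real.pi) : ℂ) = ((1 / (2 * Real.pi) : ℝ) : ℂ) by push_cast; rfl,
      Complex.conj_ofReal]
  · refine integral_congr_ae (.of_forall fun w => ?_)
    simp only [map_mul, hf, ← Complex.exp_conj]
    simp

/-- The Fourier transform `w ↦ k^*(hw) / μ_ε^*(w)` of the deconvolution density. -/
def symbol (k : ℝ → ℝ) (με : Measure ℝ) (h w : ℝ) : ℂ := fourierStar k (h * w) * invCharFun με w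

/-- The density `v ↦ h⁻¹ k̃_h(v / h)`. -/
def deconvDensity (k : ℝ → ℝ) (με : Measure ℝ) (h v : ℝ) : ℝ := (invFourier (symbol k με h) v).re

section

variable {p h : ℝ} {k : ℝ → ℝ} {με : Measure ℝ}

theorem fourierStar_neg (k : ℝ → ℝ) (w : ℝ) : fourierStar k (-w) = conj (fourierStar k w) := by
  rw [fourierStar, fourierStar, ← integral_conj]
  refine integral_congr_ae (.of_forall fun u => ?_)
  simp only [map_mul, ← Complex.exp_conj, Complex.conj_ofReal, Complex.conj_I]
  congr 2
  push_cast
  ring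

theorem IsKernel.fourierStar_neg_eq (hk : IsKernel p k) (w : ℝ) :
    fourierStar k (-w) = fourierStar k w := by
  rw [fourierStar, fourierStar, ← integral_neg_eq_self]
  refine integral_congr_ae (.of_forall fun u => ?_)
  simp only [hk.symm]
  congr 2
  push_cast
  ring

theorem IsKernel.fourierStar_zero (hk : IsKernel p k) : fourierStar k 0 = 1 := by
  simp only [fourierStar, Complex.ofReal_zero, mul_zero, Complex.exp_zero, one_mul]
  rw [integral_complex_ofReal, hk.integral_eq_one, Complex.ofReal_one]

theorem invCharFun_zero (με : Measure ℝ) [IsProbabilityMeasure με] : invCharFun με 0 = 1 := by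
  simp [invCharFun]

theorem conj_symbol_neg (w : ℝ) : conj (symbol k με h (-w)) = symbol k με h w := by
  rw [symbol, symbol, mul_neg, fourierStar_neg, invCharFun, invCharFun, charFun_neg]
  simp

theorem ofReal_deconvDensity (v : ℝ) :
    (deconvDensity k με h v : ℂ) = invFourier (symbol k με h) v :=
  Complex.conj_eq_iff_re.1 (conj_invFourier conj_symbol_neg v)

theorem IsKernel.deconvKernel_div (hk : IsKernel p k) (hh : 0 < h) (v : ℝ) :
    deconvKernel k με h (v / h) = h * deconvDensity k με h v := by
  -- The substitution u = -hw turns μ_ε^*(-u/h) into μ_ε^*(w); the remaining sign disappears because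
  -- k^* is even.
  have hs := Measure.integral_comp_mul_left (fun u : ℝ =>
    Complex.exp (Complex.I * u * (v / h : ℝ)) *
    fourierStar k u / charFun με (-u / h)) (-h)
  rw [abs_of_neg (by simpa using hh), inv_neg, neg_neg, Complex.real_smul] at hs
  have hc : (h : ℂ) ≠ 0 := by exact_mod_cast hh.ne'
  rw [deconvKernel, deconvDensity, ← Complex.re_ofReal_mul, invFourier_eq_integral]
  congr 1
  rw [mul_left_comm]
  congr 1
  rw [← inv_mul_eq_iff_eq_mul₀ hc, ← Complex.ofReal_inv, ← hs]
  refine integral_congr_ae (.of_forall fun w => ?_)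
  simp only [symbol, invCharFun]
  rw [neg_mul, neg_neg, mul_div_cancel_left₀ _ hh.ne', hk.fourierStar_neg_eq, mul_one_div, mul_div]
  congr 3
  push_cast
  field_simp

theorem IsKernel.symbol_eq_zero (hk : IsKernel p k) (hh : 0 < h) (w : ℝ) (hw : 1 / h < |w|) :
    symbol k με h w = 0 := by
  rw [symbol, hk.support, zero_mul]
  rw [mem_Icc, ← abs_le, abs_mul, abs_of_pos hh, not_le]
  rwa [div_lt_iff₀' hh] at hw

theorem IsKernel.contDiff_symbol (hp : 1 ≤ p) (hk : IsKernel p k)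
    (hC : ContDiff ℝ 1 (invCharFun με)) :
    ContDiff ℝ 1 (symbol k με h) := by
  have hk1 : ContDiff ℝ 1 (fourierStar k) := hk.contDiff.of_le (by
    exact_mod_cast Nat.one_le_ceil_iff.2 (by linarith))
  exact (hk1.comp (contDiff_const.mul contDiff_id)).mul hC

/-- Multiples of the symbol by a smooth function have an integrable inverse Fourier transform. -/
theorem IsKernel.integrable_invFourier_mul_symbol (hp : 1 ≤ p) (hk : IsKernel p k) (hh : 0 < h)
    (hC : ContDiff ℝ 1 (invCharFun με)) {g : ℝ → ℂ} (hg : ContDiff ℝ 1 g) :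
    Integrable (fun w => g w * symbol k με h w) ∧
      Integrable (invFourier fun w => g w * symbol k με h w) := by
  have hcd : ContDiff ℝ 1 fun w => g w * symbol k με h w := hg.mul (hk.contDiff_symbol hp hC)
  have h0 : ∀ w, 1 / h < |w| → g w * symbol k με h w = 0 := fun w hw => by
    rw [hk.symbol_eq_zero hh w hw, mul_zero]
  obtain ⟨c, -, hc⟩ := DerivBound.exists_of_contDiff (m := 1) (by exact_mod_cast hcd) h0
  exact ⟨integrable_of_support hcd.continuous.measurable continuous_const
    (fun t => hc.norm_le t trivial) h0,
    integrable_invFourier hcd.continuous.measurable continuous_const hc h0⟩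

theorem IsKernel.integrable_deconvDensity (hp : 1 ≤ p) (hk : IsKernel p k) (hh : 0 < h)
    (hC : ContDiff ℝ 1 (invCharFun με)) : Integrable (deconvDensity k με h) := by
  have := (hk.integrable_invFourier_mul_symbol hp hh hC (g := fun _ => 1) contDiff_const).2
  simp only [one_mul] at this
  exact this.re

theorem IsKernel.prelimCDF_eq (hp : 1 ≤ p) (hk : IsKernel p k) (hh : 0 < h)
    (hC : ContDiff ℝ 1 (invCharFun με)) {n : ℕ} (y : Fin n → ℝ) (t : ℝ) :
    prelimCDF k με h y t = 1 / n * ∑ i, ∫ v in Iic (t - y i), deconvDensity k με h v := by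
  have hq := hk.integrable_deconvDensity hp hh hC
  have hshift : ∀ i, ∫ u in Iic t, deconvDensity k με h (u - y i) =
      ∫ v in Iic (t - y i), deconvDensity k με h v := fun i => by
    have := (measurePreserving_sub_right (volume : Measure ℝ) (y i)).setIntegral_preimage_emb
      (MeasurableEquiv.subRight (y i)).measurableEmbedding (deconvDensity k με h) (Iic (t - y i))
    rw [← this]
    congr 2
    ext u
    simp
  simp only [prelimCDF, hk.deconvKernel_div hh]
  rw [integral_finsetSum _ fun i _ => ((hq.comp_sub_right (y i)).const_mul h).integrableOn]
  simp only [integral_const_mul, hshift]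
  rw [← Finset.mul_sum, ← mul_assoc]
  congr 1
  field_simp

theorem IsKernel.charFun_kernelLaw (hk : IsKernel p k) (t : ℝ) :
    charFun (kernelLaw k h) t = fourierStar k (h * t) := by
  rw [kernelLaw, charFun_map_mul, charFun_apply_real, integral_withDensity_eq_integral_toReal_smul₀
    hk.integrable.aemeasurable.ennreal_ofReal (.of_forall fun _ => ENNReal.ofReal_lt_top)]
  refine integral_congr_ae (.of_forall fun u => ?_)
  simp only [ENNReal.toReal_ofReal (hk.nonneg u), Complex.real_smul]
  rw [mul_comm]
  congr 2
  ring

/-- The preliminary estimator is an unbiased estimator of the distribution function of the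
convolution of the signal with the kernel. -/
theorem IsKernel.integral_deconvDensity (hp : 1 ≤ p) (hk : IsKernel p k) (hh : 0 < h)
    (μ : Measure ℝ) [IsProbabilityMeasure μ] [IsProbabilityMeasure με]
    (hne : ∀ t, charFun με t ≠ 0) (hC : ContDiff ℝ 1 (invCharFun με)) (x : ℝ) :
    ∫ y, (∫ v in Iic (x - y), deconvDensity k με h v) ∂(μ.conv με) =
      cdf (μ.conv (kernelLaw k h)) x := by
  have := hk.isProbabilityMeasure h
  refine integral_integral_Iic_sub_eq (hk.integrable_deconvDensity hp hh hC) (fun t => ?_) x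
  have hi := hk.integrable_invFourier_mul_symbol hp hh hC (g := fun _ => 1) contDiff_const
  simp only [one_mul] at hi
  simp only [ofReal_deconvDensity]
  rw [integral_exp_mul_invFourier (hk.contDiff_symbol hp hC).continuous hi.1 hi.2, charFun_conv,
    charFun_conv, hk.charFun_kernelLaw, symbol, invCharFun]
  field_simp [hne t]

/-! ### Low and high frequencies -/

/-- The low frequency part of the deconvolution density. -/
def lowDensity (k : ℝ → ℝ) (με : Measure ℝ) (h : ℝ) : ℝ → ℂ :=
  invFourier fun w => cutoff w * symbol k με h w

/-- The primitive of the high frequency part of the deconvolution density. -/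
def highPart (k : ℝ → ℝ) (με : Measure ℝ) (h : ℝ) : ℝ → ℂ :=
  invFourier fun w => Complex.I * cutoffQuot w * symbol k με h w

/-- Differentiation of an inverse transform multiplies the symbol by -iw, and -iw · i(1 - φ(w))/w =
1 - φ(w). The resulting primitive vanishes at -∞ by the Riemann-Lebesgue lemma, so no constant
appears. -/
theorem IsKernel.integral_Iic_deconvDensity (hp : 1 ≤ p) (hk : IsKernel p k) (hh : 0 < h)
    (hC : ContDiff ℝ 1 (invCharFun με)) (z : ℝ) :
    ((∫ v in Iic z, deconvDensity k με h v : ℝ) : ℂ) =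
      (∫ v in Iic z, lowDensity k με h v) + highPart k με h z := by
  have hφ : ContDiff ℝ 1 cutoff := contDiff_cutoff (n := 1)
  have hθ : ContDiff ℝ 1 cutoffQuot := contDiff_cutoffQuot.of_le (by exact_mod_cast le_top)
  have h1 := hk.integrable_invFourier_mul_symbol hp hh hC hφ
  have h2 := hk.integrable_invFourier_mul_symbol hp hh hC (g := fun w => 1 - cutoff w)
    (contDiff_const.sub hφ)
  have h3 := hk.integrable_invFourier_mul_symbol hp hh hC (g := fun w => Complex.I * cutoffQuot w)
    (contDiff_const.mul hθ)
  have hsum : ∀ v, (deconvDensity k με h v : ℂ) = lowDensity k με h v +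
      invFourier (fun w => (1 - cutoff w) * symbol k με h w) v := fun v => by
    rw [ofReal_deconvDensity, lowDensity, ← invFourier_add h1.1 h2.1]
    congr 1
    ext w
    ring
  have hder : ∀ v, HasDerivAt (highPart k με h)
      (invFourier (fun w => (1 - cutoff w) * symbol k με h w) v) v := fun v => by
    have e : ∀ w : ℝ, (1 - cutoff w) * symbol k με h w =
        -Complex.I * w * (Complex.I * cutoffQuot w * symbol k με h w) := fun w => by
      rw [← mul_cutoffQuot]
      linear_combination ((w : ℂ) * cutoffQuot w * symbol k με h w) * Complex.I_mul_I
    have e' : (fun w => (1 - cutoff w) * symbol k με h w) = fun w : ℝ =>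
        -Complex.I * w * (Complex.I * cutoffQuot w * symbol k με h w) := funext e
    rw [e']
    refine hasDerivAt_invFourier h3.1 ?_ v
    refine ((h2.1.const_mul Complex.I)).congr (.of_forall fun w => ?_)
    simp only
    rw [← mul_cutoffQuot]
    ring
  rw [← integral_complex_ofReal]
  simp only [hsum]
  have h1' : Integrable (lowDensity k με h) := h1.2
  rw [integral_add h1'.integrableOn h2.2.integrableOn, integral_Iic_of_hasDerivAt_of_tendsto
    (hder z).continuousAt.continuousWithinAt (fun v _ => hder v) h2.2.integrableOn
    (tendsto_invFourier_atBot _), sub_zero]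

/-- By Fourier inversion the integral is the value at frequency 0, where the cutoff, k^* and r all
equal 1. -/
theorem IsKernel.integral_lowDensity (hp : 1 ≤ p) (hk : IsKernel p k) (hh : 0 < h)
    [IsProbabilityMeasure με] (hC : ContDiff ℝ 1 (invCharFun με)) :
    ∫ v, lowDensity k με h v = 1 := by
  have hφ : ContDiff ℝ 1 cutoff := contDiff_cutoff (n := 1)
  have h1 := hk.integrable_invFourier_mul_symbol hp hh hC hφ
  have := integral_exp_mul_invFourier ((hφ.mul (hk.contDiff_symbol hp hC)).continuous) h1.1 h1.2 0
  simp only [Complex.ofReal_zero, mul_zero, zero_mul, Complex.exp_zero, one_mul] at this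
  rw [lowDensity, this, cutoff_eq_one (by simp), symbol, mul_zero, hk.fourierStar_zero,
    invCharFun_zero, one_mul, one_mul]

/-- The low frequency part is the convolution with the rescaled kernel of a function which does not
depend on the bandwidth. -/
theorem IsKernel.lowDensity_eq (hk : IsKernel p k) (hC : Continuous (invCharFun με)) (v : ℝ) :
    lowDensity k με h v =
      ∫ y, k y * invFourier (fun w => cutoff w * invCharFun με w) (v - h * y) := by
  have hφ : Continuous cutoff := (contDiff_cutoff (n := 0)).continuous
  have hint := integrable_cutoff_mul hC
  have hint2 : Integrable (fun z : ℝ × ℝ => Complex.exp (-(Complex.I * z.1 * (v - h * z.2))) *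
      (cutoff z.1 * invCharFun με z.1 * k z.2)) (volume.prod volume) := by
    refine (hint.mul_prod hk.integrable.ofReal).bdd_mul (c := 1)
      (Continuous.aestronglyMeasurable (by fun_prop)) (.of_forall fun z => ?_)
    rw [mul_assoc, ← Complex.ofReal_mul, ← Complex.ofReal_sub, ← Complex.ofReal_mul, ← mul_neg,
      ← Complex.ofReal_neg, mul_comm, Complex.norm_exp_ofReal_mul_I]
  rw [lowDensity, invFourier_eq_integral]
  simp only [invFourier_eq_integral, symbol, fourierStar]
  calc _ = (1 / (2 * Real.pi) : ℂ) * ∫ w : ℝ, ∫ y : ℝ,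
        Complex.exp (-(Complex.I * w * (v - h * y))) * (cutoff w * invCharFun με w * k y) := by
        congr 1
        refine integral_congr_ae (.of_forall fun w => ?_)
        simp only
        rw [mul_comm (∫ u : ℝ, _) (invCharFun με w), ← mul_assoc, ← mul_assoc, ← integral_const_mul]
        refine integral_congr_ae (.of_forall fun y => ?_)
        simp only
        have : Complex.exp (-(Complex.I * w * (v - h * y))) = Complex.exp (-(Complex.I * w * v)) *
            Complex.exp (Complex.I * y * (h * w : ℝ)) := by
          rw [← Complex.exp_add]
          congr 1
          push_cast
          ring
        rw [this]
        ring
    _ = (1 / (2 * Real.pi) : ℂ) * ∫ y : ℝ, ∫ w : ℝ,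
        Complex.exp (-(Complex.I * w * (v - h * y))) * (cutoff w * invCharFun με w * k y) := by
        rw [integral_integral_swap hint2]
    _ = _ := by
        rw [← integral_const_mul]
        refine integral_congr_ae (.of_forall fun y => ?_)
        simp only
        rw [mul_left_comm]
        congr 1
        rw [← integral_const_mul]
        refine integral_congr_ae (.of_forall fun w => ?_)
        simp only
        push_cast
        ring

/-- The weight is submultiplicative, 1 + |v + hy| ≤ (1 + |v|)(1 + H|y|), so the weighted norm of the
convolution factors. Replacing h with H makes the bound uniform in the bandwidth. -/
theorem IsKernel.lintegral_lowDensity_le (hp : 0 ≤ p) (hk : IsKernel p k)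
    (hC : Continuous (invCharFun με)) {H : ℝ} (hh : 0 ≤ h) (hH : h ≤ H)
    (hm : Measurable (invFourier fun w => cutoff w * invCharFun με w)) :
    ∫⁻ v, ENNReal.ofReal ((1 + |v|) ^ p) * ‖lowDensity k με h v‖ₑ ≤
      (∫⁻ y, ENNReal.ofReal (k y) * ENNReal.ofReal ((1 + H * |y|) ^ p)) *
        ∫⁻ v, ENNReal.ofReal ((1 + |v|) ^ p) *
          ‖invFourier (fun w => cutoff w * invCharFun με w) v‖ₑ := by
  set a := invFourier fun w => cutoff w * invCharFun με w with ha
  have hw : Measurable fun v : ℝ => ENNReal.ofReal ((1 + |v|) ^ p) :=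
    ((measurable_const.add measurable_id.abs).pow_const _).ennreal_ofReal
  calc ∫⁻ v, ENNReal.ofReal ((1 + |v|) ^ p) * ‖lowDensity k με h v‖ₑ
      ≤ ∫⁻ v, ∫⁻ y, ENNReal.ofReal ((1 + |v|) ^ p) * (ENNReal.ofReal (k y) * ‖a (v - h * y)‖ₑ) := by
        refine lintegral_mono fun v => ?_
        rw [lintegral_const_mul' _ _ ENNReal.ofReal_ne_top, hk.lowDensity_eq hC]
        gcongr
        refine (enorm_integral_le_lintegral_enorm _).trans (lintegral_mono fun y => ?_)
        rw [enorm_mul, ← ofReal_norm (k y : ℂ), Complex.norm_real,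
          Real.norm_of_nonneg (hk.nonneg y)]
    _ = ∫⁻ y, ∫⁻ v, ENNReal.ofReal ((1 + |v|) ^ p) * (ENNReal.ofReal (k y) * ‖a (v - h * y)‖ₑ) := by
        have hk2 : AEMeasurable (fun z : ℝ × ℝ => ENNReal.ofReal (k z.2)) (volume.prod volume) :=
          hk.integrable.aemeasurable.ennreal_ofReal.comp_quasiMeasurePreserving
            Measure.quasiMeasurePreserving_snd
        have ha2 : Measurable fun z : ℝ × ℝ => ‖a (z.1 - h * z.2)‖ₑ := by fun_prop
        exact lintegral_lintegral_swap
          ((hw.comp measurable_fst).aemeasurable.mul (hk2.mul ha2.aemeasurable))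
    _ ≤ ∫⁻ y, ENNReal.ofReal (k y) * ENNReal.ofReal ((1 + H * |y|) ^ p) *
          ∫⁻ v, ENNReal.ofReal ((1 + |v|) ^ p) * ‖a v‖ₑ := by
        refine lintegral_mono fun y => ?_
        rw [← lintegral_add_right_eq_self (fun v => ENNReal.ofReal ((1 + |v|) ^ p) *
          (ENNReal.ofReal (k y) * ‖a (v - h * y)‖ₑ)) (h * y),
          ← lintegral_const_mul' _ _
            (ENNReal.mul_ne_top ENNReal.ofReal_ne_top ENNReal.ofReal_ne_top)]
        refine lintegral_mono fun v => ?_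
        rw [add_sub_cancel_right, mul_left_comm, mul_assoc,
          ← mul_assoc (ENNReal.ofReal ((1 + H * |y|) ^ p)),
          ← ENNReal.ofReal_mul (by positivity [hh.trans hH])]
        gcongr ENNReal.ofReal _ * (ENNReal.ofReal ?_ * _)
        have hH0 : 0 ≤ H := hh.trans hH
        rw [← Real.mul_rpow (by positivity) (by positivity)]
        refine Real.rpow_le_rpow (by positivity) ?_ hp
        have h1 : |v + h * y| ≤ |v| + h * |y| := by
          refine (abs_add_le _ _).trans ?_
          rw [abs_mul, abs_of_nonneg hh]
        have h2 : h * |y| ≤ H * |y| := by gcongr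
        nlinarith [mul_nonneg (mul_nonneg hH0 (abs_nonneg y)) (abs_nonneg v)]
    _ = _ := by
        rw [lintegral_mul_const'']
        exact hk.integrable.aemeasurable.ennreal_ofReal.mul
          ((measurable_const.add
            (measurable_id.abs.const_mul H)).pow_const _).ennreal_ofReal.aemeasurable

end

/-! ### The risk bound -/

theorem continuous_integral_Iic {E : Type*} [NormedAddCommGroup E] [NormedSpace ℝ E] {f : ℝ → E}
    (hf : Integrable f) : Continuous fun z => ∫ v in Iic z, f v := by
  refine continuous_iff_continuousAt.2 fun z => ?_
  exact (hf.integrableOn.continuousOn_Iic_primitive_Iic (a₀ := z + 1)).continuousAt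
    (Iic_mem_nhds (by linarith))

theorem sub_half_lt_mOne (p : ℝ) : p - 1 / 2 < mOne p := by
  unfold mOne
  exact_mod_cast Nat.lt_floor_add_one (p - 1 / 2)

theorem add_half_lt_mZero (p : ℝ) : p + 1 / 2 < mZero p := by
  unfold mZero
  exact_mod_cast Nat.lt_floor_add_one (p + 1 / 2)

/-- It ensures that k^* has the derivatives required of the high frequency symbol. -/
theorem mOne_le_ceil {p : ℝ} (hp : 1 ≤ p) : mOne p ≤ ⌈p⌉₊ := by
  have h1 : ((⌊p - 1 / 2⌋₊ : ℕ) : ℝ) < (⌈p⌉₊ : ℕ) :=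
    (Nat.floor_le (by linarith)).trans_lt ((by linarith : p - 1 / 2 < p).trans_le (Nat.le_ceil p))
  exact_mod_cast h1

section

variable {p : ℝ} {k : ℝ → ℝ} {με : Measure ℝ}

theorem IsKernel.lintegral_one_add_rpow_lt_top (hp : 1 ≤ p) (hk : IsKernel p k)
    {H : ℝ} (hH : 0 ≤ H) :
    ∫⁻ y, ENNReal.ofReal (k y) * ENNReal.ofReal ((1 + H * |y|) ^ p) < ∞ := by
  have hp0 : 0 ≤ p := by linarith
  calc ∫⁻ y, ENNReal.ofReal (k y) * ENNReal.ofReal ((1 + H * |y|) ^ p)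
      ≤ ∫⁻ y, ENNReal.ofReal (2 ^ p) * (ENNReal.ofReal (k y) +
          ENNReal.ofReal (H ^ p) * ENNReal.ofReal (|y| ^ p * k y)) := by
        refine lintegral_mono fun y => ?_
        have hky := hk.nonneg y
        have hy := abs_nonneg y
        rw [← ENNReal.ofReal_mul hky, ← ENNReal.ofReal_mul (by positivity),
          ← ENNReal.ofReal_add hky (by positivity), ← ENNReal.ofReal_mul (by positivity)]
        refine ENNReal.ofReal_le_ofReal ?_
        have h1 : (1 + H * |y|) ^ p ≤ 2 ^ p * (1 + H ^ p * |y| ^ p) := by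
          rw [← Real.mul_rpow hH hy]
          have hx : 0 ≤ H * |y| := by positivity
          rcases le_total (H * |y|) 1 with hle | hle
          · calc (1 + H * |y|) ^ p ≤ 2 ^ p := Real.rpow_le_rpow (by positivity) (by linarith) hp0
              _ ≤ _ := le_mul_of_one_le_right (by positivity) (by
                linarith [Real.rpow_nonneg hx p])
          · calc (1 + H * |y|) ^ p ≤ (2 * (H * |y|)) ^ p :=
                  Real.rpow_le_rpow (by positivity) (by linarith) hp0
              _ = 2 ^ p * (H * |y|) ^ p := Real.mul_rpow zero_le_two hx
              _ ≤ _ := by gcongr; linarith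
        calc k y * (1 + H * |y|) ^ p ≤ k y * (2 ^ p * (1 + H ^ p * |y| ^ p)) := by gcongr
          _ = _ := by ring
    _ < ∞ := by
        rw [lintegral_const_mul' _ _ ENNReal.ofReal_ne_top, lintegral_add_left'
          hk.integrable.aemeasurable.ennreal_ofReal, lintegral_const_mul' _ _ ENNReal.ofReal_ne_top]
        exact ENNReal.mul_lt_top ENNReal.ofReal_lt_top (ENNReal.add_lt_top.2
          ⟨hk.integrable.lintegral_lt_top, ENNReal.mul_lt_top ENNReal.ofReal_lt_top
            (hk.lintegral_rpow_mul_lt_top hp)⟩)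

/-- The low frequency inverse Fourier transform of `1 / μ_ε^*` has a moment of order `p`. -/
theorem lintegral_invFourier_cutoff_lt_top
    (hdiff₀ : ∀ ℓ < mZero p, ∀ t ∈ Icc (-2 : ℝ) 2,
      DifferentiableAt ℝ (iteratedDeriv ℓ (invCharFun με)) t)
    (hsup : ∃ M : ℝ, ∀ t ∈ Icc (-2 : ℝ) 2, ‖iteratedDeriv (mZero p) (invCharFun με) t‖ ≤ M)
    (hC : Continuous (invCharFun με)) :
    ∫⁻ v, ENNReal.ofReal ((1 + |v|) ^ p) *
      ‖invFourier (fun w => cutoff w * invCharFun με w) v‖ₑ < ∞ := by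
  obtain ⟨c₁, hc₁, h₁⟩ := DerivBound.exists_of_bddAbove isCompact_Icc hdiff₀ hsup
  obtain ⟨c₂, hc₂, h₂⟩ := DerivBound.exists_of_contDiff (m := mZero p) (R := 3 / 2) (f := cutoff)
    (contDiff_cutoff (n := mZero p)) fun t ht => cutoff_eq_zero ht.le
  have hzero : ∀ t, 3 / 2 < |t| → cutoff t * invCharFun με t = 0 := fun t ht => by
    rw [cutoff_eq_zero ht.le, zero_mul]
  have hcont : Continuous fun w => cutoff w * invCharFun με w :=
    (contDiff_cutoff (n := 0)).continuous.mul hC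
  -- The product rule is applied on the open interval (-2, 2). Its union with the open set |t| >
  -- 3/2, where the product vanishes, is the whole line.
  have hin := (h₂.subset (subset_univ (Ioo (-2 : ℝ) 2))).mul isOpen_Ioo
    (h₁.subset Ioo_subset_Icc_self)
  have hall : DerivBound univ (mZero p) (fun _ => 2 ^ mZero p * (c₂ * c₁))
      (fun w => cutoff w * invCharFun με w) := by
    refine (hin.union (DerivBound.of_support_subset (fun _ => by positivity) hzero)).subset
      fun t _ => ?_
    by_cases ht : 3 / 2 < |t|
    · exact .inr ht
    · have := abs_le.1 (not_lt.1 ht)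
      exact .inl ⟨by linarith, by linarith⟩
  refine lintegral_one_add_rpow_mul_lt_top (add_half_lt_mZero p) (continuous_invFourier
    (integrable_of_support hcont.measurable continuous_const (fun t => hall.norm_le t trivial)
      hzero)).measurable
    ((lintegral_one_add_pow_mul_sq_invFourier_le hcont.measurable continuous_const hall
      hzero).trans_lt
      (ENNReal.mul_lt_top ENNReal.ofReal_lt_top ?_))
  exact (continuous_const.continuousOn.integrableOn_Icc).lintegral_lt_top

/-- Leibniz for three factors: the quotient (1 - φ)/w supplies the decay 1/(1 + |w|), the dilated
k^* is bounded uniformly for h ≤ H, and r supplies b. -/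
theorem IsKernel.exists_derivBound_highPart (hp : 1 ≤ p) (hk : IsKernel p k) {b : ℝ → ℝ}
    (hb : DerivBound univ (mOne p) b (invCharFun με)) {H : ℝ} (hH : 0 ≤ H) :
    ∃ A, 0 ≤ A ∧ ∀ h, 0 < h → h ≤ H → DerivBound univ (mOne p) (fun w => A * (b w / (1 + |w|)))
      (fun w => Complex.I * cutoffQuot w * symbol k με h w) := by
  obtain ⟨c₁, hc₁, h₁⟩ := exists_derivBound_cutoffQuot (mOne p)
  obtain ⟨c₂, hc₂, h₂⟩ := DerivBound.exists_of_contDiff (m := mOne p) (R := 1)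
    (f := fourierStar k) (hk.contDiff.of_le (by exact_mod_cast mOne_le_ceil hp))
    fun t ht => hk.support t fun h' => absurd (abs_le.2 h') (not_le.2 ht)
  set m := mOne p
  refine ⟨2 ^ m * (c₁ * (2 ^ m * ((1 + H) ^ m * c₂))), by positivity, fun h hh hhH => ?_⟩
  have := ((h₁.mul isOpen_univ ((h₂.comp_mul_left hh.le).mul isOpen_univ hb))).const_mul
    isOpen_univ Complex.I
  refine (this.mono fun w _ => ?_).congr isOpen_univ fun w _ => ?_
  · have hbw : 0 ≤ b w := (norm_nonneg _).trans (hb.norm_le w trivial)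
    rw [Complex.norm_I, one_mul]
    calc 2 ^ m * (c₁ / (1 + |w|) * (2 ^ m * ((1 + h) ^ m * c₂ * b w)))
        ≤ 2 ^ m * (c₁ / (1 + |w|) * (2 ^ m * ((1 + H) ^ m * c₂ * b w))) := by gcongr
      _ = _ := by ring
  · simp only [symbol]
    ring

/-- The root mean square error of one summand of the preliminary estimator, integrated with weight
`|x| ^ (p - 1)`. -/
theorem IsKernel.exists_lintegral_deconv_le (hp : 1 ≤ p) (hk : IsKernel p k)
    [IsProbabilityMeasure με] {ν : Measure ℝ} [IsProbabilityMeasure ν]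
    (hC : ContDiff ℝ 1 (invCharFun με))
    (hdiff₀ : ∀ ℓ < mZero p, ∀ t ∈ Icc (-2 : ℝ) 2,
      DifferentiableAt ℝ (iteratedDeriv ℓ (invCharFun με)) t)
    (hsup : ∃ M : ℝ, ∀ t ∈ Icc (-2 : ℝ) 2, ‖iteratedDeriv (mZero p) (invCharFun με) t‖ ≤ M)
    (htail : ∫⁻ x in Ioi (0 : ℝ), ENNReal.ofReal (|x| ^ (p - 1) * √(ν.real {y | x ≤ |y|})) < ∞)
    {b : ℝ → ℝ} (hbc : Continuous b) (hb : DerivBound univ (mOne p) b (invCharFun με))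
    {H : ℝ} (hH : 0 ≤ H) :
    ∃ C : ℝ≥0∞, C ≠ ∞ ∧ ∀ h, 0 < h → h ≤ H →
      ∫⁻ x : ℝ, ENNReal.ofReal (|x| ^ (p - 1)) * (∫⁻ y, ‖(∫ v in Iic (x - y),
        deconvDensity k με h v) - (if 0 ≤ x then 1 else 0)‖ₑ ^ 2 ∂ν) ^ (1 / 2 : ℝ) ≤
      C * (1 + (∫⁻ w in Icc (-(1 / h)) (1 / h),
        ENNReal.ofReal ((b w / (1 + |w|)) ^ 2)) ^ (1 / 2 : ℝ)) := by
  have hp0 : 0 ≤ p := by linarith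
  have hint := integrable_cutoff_mul hC.continuous
  have ham := (continuous_invFourier hint).measurable
  obtain ⟨A, hA, hhigh⟩ := hk.exists_derivBound_highPart hp hb hH
  obtain ⟨C₁, hC₁, hconv⟩ := exists_lintegral_rpow_half_conv_le hp (sub_half_lt_mOne p)
    (lintegral_rootTail_ne_top htail (c := 3) (by norm_num))
  -- The bound for the low frequency contribution, independent of h.
  set L : ℝ≥0∞ := (ENNReal.ofReal (2 * 2 ^ p) +
    ∫⁻ x, ENNReal.ofReal (|x| ^ (p - 1)) * rootTail ν 2 x) *
    ((∫⁻ y, ENNReal.ofReal (k y) * ENNReal.ofReal ((1 + H * |y|) ^ p)) *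
      ∫⁻ v, ENNReal.ofReal ((1 + |v|) ^ p) *
        ‖invFourier (fun w => cutoff w * invCharFun με w) v‖ₑ) with hL
  have hLtop : L ≠ ∞ := ENNReal.mul_ne_top (ENNReal.add_ne_top.2 ⟨ENNReal.ofReal_ne_top,
    lintegral_rootTail_ne_top htail (by norm_num)⟩)
    (ENNReal.mul_ne_top (hk.lintegral_one_add_rpow_lt_top hp hH).ne
      (lintegral_invFourier_cutoff_lt_top hdiff₀ hsup hC.continuous).ne)
  set B : ℝ≥0∞ := ENNReal.ofReal (2 * 4 ^ mOne p * A ^ 2) ^ (1 / 2 : ℝ) with hB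
  have hBtop : B ≠ ∞ := ENNReal.rpow_ne_top_of_nonneg (by norm_num) ENNReal.ofReal_ne_top
  refine ⟨L + C₁ * B, by finiteness, fun h hh hhH => ?_⟩
  set S := ∫⁻ w in Icc (-(1 / h)) (1 / h), ENNReal.ofReal ((b w / (1 + |w|)) ^ 2) with hS
  have hφ : ContDiff ℝ 1 cutoff := contDiff_cutoff (n := 1)
  have hθ : ContDiff ℝ 1 cutoffQuot := contDiff_cutoffQuot.of_le (by exact_mod_cast le_top)
  have hlow : Integrable (lowDensity k με h) := (hk.integrable_invFourier_mul_symbol hp hh hC hφ).2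
  have hlowm : Measurable (lowDensity k με h) := (continuous_invFourier
    (hk.integrable_invFourier_mul_symbol hp hh hC hφ).1).measurable
  have hhm : Measurable (highPart k με h) := (continuous_invFourier
    (hk.integrable_invFourier_mul_symbol hp hh hC (g := fun w => Complex.I * cutoffQuot w)
      (contDiff_const.mul hθ)).1).measurable
  have hprim := (continuous_integral_Iic hlow).measurable
  have hbc' : Continuous fun w => A * (b w / (1 + |w|)) :=
    continuous_const.mul (hbc.div (by fun_prop) fun w => by positivity)
  have hw : Measurable fun x : ℝ => ENNReal.ofReal (|x| ^ (p - 1)) :=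
    (measurable_id.abs.pow_const _).ennreal_ofReal
  have hGam : ∫⁻ z, ENNReal.ofReal ((1 + |z|) ^ (2 * mOne p)) * ‖highPart k με h z‖ₑ ^ 2 ≤
      ENNReal.ofReal (2 * 4 ^ mOne p * A ^ 2) * S := by
    have hsm : Measurable fun w => Complex.I * cutoffQuot w * symbol k με h w :=
      ((continuous_const.mul hθ.continuous).mul (hk.contDiff_symbol hp hC).continuous).measurable
    have := lintegral_one_add_pow_mul_sq_invFourier_le hsm hbc' (hhigh h hh hhH) (R := 1 / h)
      fun w hw => by rw [hk.symbol_eq_zero hh w hw, mul_zero]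
    simp only [mul_pow A, ENNReal.ofReal_mul (sq_nonneg A)] at this
    rw [lintegral_const_mul' _ _ ENNReal.ofReal_ne_top, ← mul_assoc,
      ← ENNReal.ofReal_mul (by positivity)] at this
    refine le_trans (le_of_eq (lintegral_congr fun z => ?_)) this
    rw [ENNReal.ofReal_mul (by positivity), ENNReal.ofReal_pow (norm_nonneg _), ofReal_norm]
    rfl
  have hpt : ∀ x : ℝ, (∫⁻ y, ‖(∫ v in Iic (x - y), deconvDensity k με h v) -
      (if 0 ≤ x then 1 else 0)‖ₑ ^ 2 ∂ν) ^ (1 / 2 : ℝ) ≤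
      (∫⁻ y, ‖(∫ v in Iic (x - y), lowDensity k με h v) -
        (if 0 ≤ x then 1 else 0)‖ₑ ^ 2 ∂ν) ^ (1 / 2 : ℝ) +
      (∫⁻ y, ‖highPart k με h (x - y)‖ₑ ^ 2 ∂ν) ^ (1 / 2 : ℝ) := fun x => by
    have hlow : Measurable fun y => ∫ v in Iic (x - y), lowDensity k με h v :=
      hprim.comp (measurable_const.sub measurable_id)
    refine le_trans ?_ (rpow_half_lintegral_add_sq_le (hlow.sub_const _).enorm.aemeasurable
      (Measurable.aemeasurable (by fun_prop)))
    gcongr with y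
    have e : ‖(∫ v in Iic (x - y), deconvDensity k με h v) - (if 0 ≤ x then 1 else 0)‖ₑ =
        ‖(((∫ v in Iic (x - y), deconvDensity k με h v) - (if 0 ≤ x then 1 else 0) : ℝ) : ℂ)‖ₑ := by
      rw [← ofReal_norm, ← ofReal_norm, Complex.norm_real]
    rw [e]
    push_cast
    rw [hk.integral_Iic_deconvDensity hp hh hC, add_sub_right_comm]
    refine le_trans (enorm_add_le _ _) (le_of_eq ?_)
    congr 3
    split_ifs <;> simp
  calc _ ≤ ∫⁻ x : ℝ, (ENNReal.ofReal (|x| ^ (p - 1)) * (∫⁻ y, ‖(∫ v in Iic (x - y),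
        lowDensity k με h v) - (if 0 ≤ x then 1 else 0)‖ₑ ^ 2 ∂ν) ^ (1 / 2 : ℝ) +
        ENNReal.ofReal (|x| ^ (p - 1)) *
          (∫⁻ y, ‖highPart k με h (x - y)‖ₑ ^ 2 ∂ν) ^ (1 / 2 : ℝ)) := by
        refine lintegral_mono fun x => ?_
        rw [← mul_add]
        gcongr
        exact hpt x
    _ ≤ L + C₁ * (B * S ^ (1 / 2 : ℝ)) := by
        have hm2 : Measurable fun x : ℝ => ENNReal.ofReal (|x| ^ (p - 1)) *
            (∫⁻ y, ‖highPart k με h (x - y)‖ₑ ^ 2 ∂ν) ^ (1 / 2 : ℝ) :=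
          hw.mul (Measurable.pow_const (by fun_prop) _)
        rw [lintegral_add_right _ hm2]
        refine add_le_add ?_ ?_
        · refine (lintegral_rpow_half_integral_Iic_le hp hlowm hlow
            (hk.integral_lowDensity hp hh hC) ν).trans ?_
          rw [hL]
          gcongr
          exact hk.lintegral_lowDensity_le hp0 hC.continuous hh.le hhH ham
        · refine (hconv (fun z => ‖highPart k με h z‖ₑ ^ 2) (by fun_prop)).trans ?_
          gcongr
          rw [hB, ← ENNReal.mul_rpow_of_nonneg _ _ (by norm_num)]
          gcongr
    _ ≤ _ := by
        rw [← mul_assoc, mul_add, mul_one]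
        exact add_le_add le_self_add (mul_le_mul' le_add_self le_rfl)

/-- The expected loss of the preliminary estimator. -/
theorem IsKernel.lintegral_cdfLoss_prelimCDF_le (hp : 1 ≤ p) (hk : IsKernel p k)
    {μ : Measure ℝ} [IsProbabilityMeasure μ] [IsProbabilityMeasure με]
    (hne : ∀ t, charFun με t ≠ 0) (hC : ContDiff ℝ 1 (invCharFun με)) {h : ℝ} (hh : 0 < h)
    {Ω : Type*} [MeasurableSpace Ω] {P : Measure Ω} [IsProbabilityMeasure P] {n : ℕ} (hn : 0 < n)
    {X ε : Fin n → Ω → ℝ} (hs : IsConvolutionSample P μ με X ε) :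
    ∫⁻ ω, cdfLoss p (prelimCDF k με h fun i => X i ω + ε i ω) (cdf (μ.conv (kernelLaw k h))) ∂P ≤
      ENNReal.ofReal ((n : ℝ) ^ (-(1 / 2) : ℝ)) *
        ∫⁻ x : ℝ, ENNReal.ofReal (|x| ^ (p - 1)) * (∫⁻ y, ‖(∫ v in Iic (x - y),
          deconvDensity k με h v) - (if 0 ≤ x then 1 else 0)‖ₑ ^ 2 ∂(μ.conv με)) ^ (1 / 2 : ℝ) := by
  have hq := hk.integrable_deconvDensity hp hh hC
  have hG := (continuous_integral_Iic hq).measurable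
  have hX := hs.measurable_signal
  have hε := hs.measurable_noise
  have hcdf : Measurable (cdf (μ.conv (kernelLaw k h))) := (monotone_cdf _).measurable
  have hbound : ∀ z, |∫ v in Iic z, deconvDensity k με h v| ≤ ∫ v, |deconvDensity k με h v| :=
    fun z => (norm_integral_le_integral_norm _).trans
      (setIntegral_le_integral hq.norm (.of_forall fun v => norm_nonneg _))
  simp only [cdfLoss, hk.prelimCDF_eq hp hh hC]
  rw [lintegral_lintegral_swap, ← lintegral_const_mul' _ _ ENNReal.ofReal_ne_top]
  · refine lintegral_mono fun x => ?_
    simp only [ENNReal.ofReal_mul (Real.rpow_nonneg (abs_nonneg x) (p - 1))]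
    rw [lintegral_const_mul' _ _ ENNReal.ofReal_ne_top, mul_left_comm]
    gcongr
    -- The centring constant is 1_{x ≥ 0}, which matches the limits 0 and 1 of the summand's
    -- expectation at -∞ and +∞.
    have := lintegral_abs_average_sub_le hn (Y := fun i ω => X i ω + ε i ω) (ν := μ.conv με)
      (fun i => (hX i).add (hε i)) hs.map_add hs.pairwise_indepFun
      (g := fun y => ∫ v in Iic (x - y), deconvDensity k με h v)
      (hG.comp (measurable_const.sub measurable_id)) (fun y => hbound _) (if 0 ≤ x then 1 else 0)
    rw [hk.integral_deconvDensity hp hh μ hne hC] at this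
    exact this
  · have h1 : Measurable fun z : Ω × ℝ => ∑ i, ∫ v in Iic (z.2 - (X i z.1 + ε i z.1)),
        deconvDensity k με h v := Finset.measurable_sum _ fun i _ => hG.comp
      (measurable_snd.sub (((hX i).comp measurable_fst).add ((hε i).comp measurable_fst)))
    exact ((measurable_snd.abs.pow_const _).mul
      ((h1.const_mul _).sub (hcdf.comp measurable_snd)).abs).ennreal_ofReal.aemeasurable

theorem cdfLoss_triangle {F G₁ G₂ : ℝ → ℝ} (hF : Measurable F) (hG₁ : Measurable G₁) :
    cdfLoss p G₁ G₂ ≤ cdfLoss p F G₁ + cdfLoss p F G₂ := by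
  have hm : Measurable fun x => ENNReal.ofReal (|x| ^ (p - 1) * |F x - G₁ x|) :=
    ((measurable_id.abs.pow_const _).mul (hF.sub hG₁).abs).ennreal_ofReal
  rw [cdfLoss, cdfLoss, cdfLoss, ← lintegral_add_left hm]
  refine lintegral_mono fun x => ?_
  have hx := Real.rpow_nonneg (abs_nonneg x) (p - 1)
  rw [← ENNReal.ofReal_add (by positivity) (by positivity), ← mul_add]
  refine ENNReal.ofReal_le_ofReal (mul_le_mul_of_nonneg_left ?_ hx)
  rw [abs_sub_comm (F x) (G₁ x)]
  exact abs_sub_le _ _ _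

/-- The risk of the isotone deconvolution estimator, for any bandwidth. -/
theorem IsKernel.exists_risk_le (hp : 1 ≤ p) (hk : IsKernel p k)
    (μ : Measure ℝ) [IsProbabilityMeasure μ] [IsProbabilityMeasure με]
    (hne : ∀ t, charFun με t ≠ 0) (hC : ContDiff ℝ 1 (invCharFun με))
    (hdiff₀ : ∀ ℓ < mZero p, ∀ t ∈ Icc (-2 : ℝ) 2,
      DifferentiableAt ℝ (iteratedDeriv ℓ (invCharFun με)) t)
    (hsup : ∃ M : ℝ, ∀ t ∈ Icc (-2 : ℝ) 2, ‖iteratedDeriv (mZero p) (invCharFun με) t‖ ≤ M)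
    (htail : ∫⁻ x in Ioi (0 : ℝ),
      ENNReal.ofReal (|x| ^ (p - 1) * √((μ.conv με).real {y | x ≤ |y|})) < ∞)
    {b : ℝ → ℝ} (hbc : Continuous b) (hb : DerivBound univ (mOne p) b (invCharFun με))
    {H : ℝ} (hH : 0 ≤ H) :
    ∃ K : ℝ, 0 < K ∧ ∀ (n : ℕ) (h σ : ℝ), 0 < n → 0 < h → h ≤ H → 0 ≤ σ →
      ∫⁻ w in Icc (-(1 / h)) (1 / h), ENNReal.ofReal ((b w / (1 + |w|)) ^ 2) ≤
        ENNReal.ofReal (σ ^ 2) →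
      ∀ (Ω : Type*) [MeasurableSpace Ω] (P : Measure Ω) [IsProbabilityMeasure P]
        (X ε : Fin n → Ω → ℝ) (ρ : ℝ) (μt : Ω → Measure ℝ),
        IsConvolutionSample P μ με X ε → ρ ≤ (n : ℝ) ^ (-(1 / 2) : ℝ) →
        IsIsotoneEstimator p ρ k με h X ε μt →
        ∫⁻ ω, wasserstein p (μt ω) μ ^ p ∂P ≤
          ENNReal.ofReal (K * ((n : ℝ) ^ (-(1 / 2) : ℝ) * (1 + σ) + h ^ p)) := by
  obtain ⟨C, hCtop, hbd⟩ := hk.exists_lintegral_deconv_le hp hC hdiff₀ hsup htail hbc hb hH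
  have hMtop := (hk.lintegral_rpow_mul_lt_top hp).ne
  set M := ∫⁻ x, ENNReal.ofReal (|x| ^ p * k x) with hM
  set F : ℝ≥0∞ := ENNReal.ofReal (4 ^ p) with hF
  have hFtop : F ≠ ∞ := ENNReal.ofReal_ne_top
  set T : ℝ≥0∞ := 2 ^ (p - 1) with hT
  have hTtop : T ≠ ∞ := by simp [hT]
  set K : ℝ≥0∞ := T * (F * (2 * C + 1) + M) + 1 with hK
  have hKtop : K ≠ ∞ := by finiteness
  refine ⟨K.toReal, ENNReal.toReal_pos (by simp [hK]) hKtop, ?_⟩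
  intro n h σ hn hh hhH hσ hS Ω _ P _ X ε ρ μt hs hρ hest
  set a : ℝ := (n : ℝ) ^ (-(1 / 2) : ℝ) with ha
  have ha0 : 0 ≤ a := by positivity
  have := hk.isProbabilityMeasure h
  set ν := μ.conv (kernelLaw k h) with hν
  set L : Ω → ℝ≥0∞ := fun ω => cdfLoss p (prelimCDF k με h fun i => X i ω + ε i ω) (cdf ν) with hL
  have hq := hk.integrable_deconvDensity hp hh hC
  have hG := (continuous_integral_Iic hq).measurable
  -- The bound holds for every ω, so no measurability of the estimator is required.
  have hpt : ∀ ω, wasserstein p (μt ω) μ ^ p ≤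
      T * (F * (2 * L ω + ENNReal.ofReal a) + ENNReal.ofReal (h ^ p) * M) := fun ω => by
    have := (hest ω).1
    refine (wasserstein_rpow_le_cdfLoss_add hp hk hh.le μ (μt ω)).trans ?_
    have hFm : Measurable (prelimCDF k με h fun i => X i ω + ε i ω) := by
      have : (prelimCDF k με h fun i => X i ω + ε i ω) = fun t => 1 / n * ∑ i,
          ∫ v in Iic (t - (X i ω + ε i ω)), deconvDensity k με h v :=
        funext fun t => hk.prelimCDF_eq hp hh hC _ t
      rw [this]
      exact (Finset.measurable_sum _ fun i _ => hG.comp (measurable_id.sub_const _)).const_mul _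
    gcongr
    refine (cdfLoss_triangle hFm (monotone_cdf (μt ω)).measurable).trans ?_
    -- Near-minimality is tested against μ ∗ K_h itself, whence the factor 2 in front of `L ω`.
    refine (add_le_add ((hest ω).2 ν inferInstance) le_rfl).trans ?_
    rw [two_mul, add_right_comm]
    gcongr
  have hEL : ∫⁻ ω, L ω ∂P ≤ ENNReal.ofReal a * (C * (1 + ENNReal.ofReal σ)) := by
    refine (hk.lintegral_cdfLoss_prelimCDF_le hp hne hC hh hn hs).trans ?_
    gcongr
    refine (hbd h hh hhH).trans ?_
    gcongr
    calc _ ≤ ENNReal.ofReal (σ ^ 2) ^ (1 / 2 : ℝ) := by gcongr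
      _ = _ := by rw [ENNReal.ofReal_pow hσ, sq_rpow_half]
  calc ∫⁻ ω, wasserstein p (μt ω) μ ^ p ∂P
      ≤ ∫⁻ ω, T * (F * (2 * L ω + ENNReal.ofReal a) + ENNReal.ofReal (h ^ p) * M) ∂P :=
        lintegral_mono hpt
    _ = T * (F * (2 * ∫⁻ ω, L ω ∂P + ENNReal.ofReal a) + ENNReal.ofReal (h ^ p) * M) := by
        rw [lintegral_const_mul' _ _ hTtop, lintegral_add_right _ measurable_const,
          lintegral_const_mul' _ _ hFtop, lintegral_add_right _ measurable_const,
          lintegral_const_mul' _ _ (by simp), lintegral_const, lintegral_const, measure_univ,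
          mul_one, mul_one]
    _ ≤ T * (F * (2 * (ENNReal.ofReal a * (C * (1 + ENNReal.ofReal σ))) +
          ENNReal.ofReal a * (1 + ENNReal.ofReal σ)) + ENNReal.ofReal (h ^ p) * M) := by
        gcongr
        exact le_mul_of_one_le_right zero_le le_self_add
    _ = T * (F * (2 * C + 1)) * (ENNReal.ofReal a * (1 + ENNReal.ofReal σ)) +
          T * M * ENNReal.ofReal (h ^ p) := by ring
    _ ≤ K * (ENNReal.ofReal a * (1 + ENNReal.ofReal σ)) + K * ENNReal.ofReal (h ^ p) := by
        gcongr
        · rw [hK, mul_add T]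
          exact le_add_right le_self_add
        · rw [hK, mul_add T]
          exact le_add_right le_add_self
    _ = _ := by
        rw [← mul_add, ENNReal.ofReal_mul ENNReal.toReal_nonneg, ENNReal.ofReal_toReal hKtop,
          ENNReal.ofReal_add (by positivity) (by positivity), ENNReal.ofReal_mul ha0,
          ENNReal.ofReal_add zero_le_one hσ, ENNReal.ofReal_one]

end

/-! ### The rates -/

theorem lintegral_Icc_comp_abs_le (g : ℝ → ℝ≥0∞) (T : ℝ) :
    ∫⁻ w in Icc (-T) T, g |w| ≤ 2 * ∫⁻ w in Icc 0 T, g w := by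
  have hsub : Icc (-T) T ⊆ (Neg.neg ⁻¹' Icc 0 T) ∪ Icc 0 T := fun w hw => by
    rcases le_total w 0 with h | h
    · exact .inl ⟨by simpa using h, by linarith [hw.1]⟩
    · exact .inr ⟨h, hw.2⟩
  have hpos : ∫⁻ w in Icc 0 T, g |w| = ∫⁻ w in Icc 0 T, g w :=
    setLIntegral_congr_fun measurableSet_Icc fun w hw => by rw [abs_of_nonneg hw.1]
  have hneg : ∫⁻ w in Neg.neg ⁻¹' Icc 0 T, g |w| = ∫⁻ w in Icc 0 T, g |w| := by
    simpa only [abs_neg] using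
      (Measure.measurePreserving_neg (volume : Measure ℝ)).setLIntegral_comp_preimage_emb
        (MeasurableEquiv.neg ℝ).measurableEmbedding (fun w => g |w|) (Icc 0 T)
  calc _ ≤ ∫⁻ w in (Neg.neg ⁻¹' Icc 0 T) ∪ Icc 0 T, g |w| := lintegral_mono_set hsub
    _ ≤ _ := lintegral_union_le _ _ _
    _ = _ := by rw [hneg, hpos, two_mul]

theorem lintegral_ordinary_le {c β T : ℝ} (hT : 0 ≤ T) :
    ∫⁻ w in Icc (-T) T, ENNReal.ofReal ((c * (1 + |w|) ^ β / (1 + |w|)) ^ 2) ≤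
      ENNReal.ofReal (2 * c ^ 2 * ∫ w in (1 : ℝ)..1 + T, w ^ (2 * β - 2)) := by
  have hcont : ContinuousOn (fun w : ℝ => (1 + w) ^ (2 * β - 2)) (Icc 0 T) := fun w hw =>
    ((continuousAt_const.add continuousAt_id).rpow_const
      (.inl (ne_of_gt (add_pos_of_pos_of_nonneg one_pos hw.1)))).continuousWithinAt
  refine (lintegral_Icc_comp_abs_le
    (fun w => ENNReal.ofReal ((c * (1 + w) ^ β / (1 + w)) ^ 2)) T).trans_eq ?_
  have hg : ∀ w ∈ Icc (0 : ℝ) T, ENNReal.ofReal ((c * (1 + w) ^ β / (1 + w)) ^ 2) =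
      ENNReal.ofReal (c ^ 2) * ENNReal.ofReal ((1 + w) ^ (2 * β - 2)) := fun w hw => by
    have h1 : 0 < 1 + w := by linarith [hw.1]
    rw [← ENNReal.ofReal_mul (sq_nonneg c), div_pow, mul_pow, Real.rpow_sub h1, mul_comm 2 β,
      Real.rpow_mul h1.le, Real.rpow_two, Real.rpow_two, mul_div_assoc]
  have hint : ∫ w in (1 : ℝ)..1 + T, w ^ (2 * β - 2) = ∫ w in Icc 0 T, (1 + w) ^ (2 * β - 2) := by
    have := intervalIntegral.integral_comp_add_left (a := 0) (b := T)
      (fun w : ℝ => w ^ (2 * β - 2)) 1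
    rw [add_zero] at this
    rw [← this, intervalIntegral.integral_of_le hT, integral_Icc_eq_integral_Ioc]
  rw [setLIntegral_congr_fun measurableSet_Icc hg, lintegral_const_mul' _ _ ENNReal.ofReal_ne_top,
    ← ofReal_integral_eq_lintegral_ofReal (hcont.integrableOn_Icc), ← hint, mul_assoc 2,
    ENNReal.ofReal_mul zero_le_two, ENNReal.ofReal_mul (sq_nonneg c), ENNReal.ofReal_ofNat]
  filter_upwards [ae_restrict_mem measurableSet_Icc] with w hw
  exact Real.rpow_nonneg (by linarith [hw.1]) _

theorem integral_ordinary_eq {β T : ℝ} (hβ : β ≠ 1 / 2) (hT : 0 ≤ T) :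
    ∫ w in (1 : ℝ)..1 + T, w ^ (2 * β - 2) = ((1 + T) ^ (2 * β - 1) - 1) / (2 * β - 1) := by
  have h0 : (0 : ℝ) ∉ uIcc 1 (1 + T) := by
    rw [uIcc_of_le (by linarith)]
    exact fun h => by linarith [h.1]
  have hβ' : 2 * β - 2 ≠ -1 := fun h => hβ (by linarith)
  rw [integral_rpow (.inr ⟨hβ', h0⟩), Real.one_rpow, show 2 * β - 2 + 1 = 2 * β - 1 by ring]

/-- The variance and the squared bias in the ordinary smooth case. -/
theorem exists_ordinary_le {p β c : ℝ} (hp : 1 ≤ p) (hc : 0 < c) :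
    ∃ D : ℝ, 0 < D ∧ ∀ n : ℕ, 2 ≤ n → ∀ h : ℝ,
      h = (n : ℝ) ^ (-(1 / (2 * p + max (2 * β - 1) 0))) → 0 < h ∧ h ≤ 1 ∧ ∃ σ : ℝ, 0 ≤ σ ∧
        ∫⁻ w in Icc (-(1 / h)) (1 / h),
          ENNReal.ofReal ((c * (1 + |w|) ^ β / (1 + |w|)) ^ 2) ≤ ENNReal.ofReal (σ ^ 2) ∧
        (n : ℝ) ^ (-(1 / 2) : ℝ) * (1 + σ) + h ^ p ≤ D * ordinaryRate p β n := by
  have hbase : ∀ n : ℕ, 2 ≤ n → ∀ h : ℝ, h = (n : ℝ) ^ (-(1 / (2 * p + max (2 * β - 1) 0))) →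
      0 < h ∧ h ≤ 1 := fun n hn h hh => by
    have hn1 : (1 : ℝ) ≤ n := by exact_mod_cast (by omega : 1 ≤ n)
    have := le_max_right (2 * β - 1) 0
    refine ⟨hh ▸ Real.rpow_pos_of_pos (by linarith) _, hh ▸ Real.rpow_le_one_of_one_le_of_nonpos hn1
      (neg_nonpos.2 (by positivity))⟩
  have hσ : ∀ {T B : ℝ}, 0 ≤ T → 0 ≤ B → ∫ w in (1 : ℝ)..1 + T, w ^ (2 * β - 2) ≤ B →
      ∫⁻ w in Icc (-T) T, ENNReal.ofReal ((c * (1 + |w|) ^ β / (1 + |w|)) ^ 2) ≤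
        ENNReal.ofReal (√(2 * c ^ 2 * B) ^ 2) := fun hT hB hle => by
    rw [Real.sq_sqrt (by positivity)]
    exact (lintegral_ordinary_le hT).trans (ENNReal.ofReal_le_ofReal (by gcongr))
  -- As T grows, ∫ w^(2β-2) over [1, 1 + T] stays bounded, grows like log T or grows like T^(2β-1),
  -- according to the position of β with respect to 1/2.
  rcases lt_trichotomy β (1 / 2) with hβ | hβ | hβ
  · set B := 1 / (1 - 2 * β)
    have hB : 0 ≤ B := one_div_nonneg.2 (by linarith)
    refine ⟨2 + √(2 * c ^ 2 * B), by positivity, fun n hn h hh => ?_⟩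
    obtain ⟨h0, h1⟩ := hbase n hn h hh
    have hn0 : (0 : ℝ) < n := by exact_mod_cast (by omega : 0 < n)
    refine ⟨h0, h1, √(2 * c ^ 2 * B), Real.sqrt_nonneg _, hσ (by positivity) hB ?_, ?_⟩
    · rw [integral_ordinary_eq hβ.ne (by positivity), ← neg_div_neg_eq, neg_sub, neg_sub]
      have h2 : 0 ≤ (1 + 1 / h) ^ (2 * β - 1) := by positivity
      have h3 : 0 ≤ 1 - 2 * β := by linarith
      exact div_le_div_of_nonneg_right (by linarith) h3
    · have h2 : h ^ p = (n : ℝ) ^ (-(1 / 2) : ℝ) := by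
        rw [hh, max_eq_right (by linarith), ← Real.rpow_mul hn0.le]
        congr 1
        field_simp
        ring
      have h3 : ordinaryRate p β n = (n : ℝ) ^ (-(1 / 2) : ℝ) := by
        rw [ordinaryRate, if_neg (by linarith), if_neg hβ.ne, Real.rpow_neg hn0.le,
          Real.sqrt_eq_rpow, one_div]
      rw [h2, h3]
      exact le_of_eq (by ring)
  · refine ⟨4 + 2 * c, by positivity, fun n hn h hh => ?_⟩
    obtain ⟨h0, h1⟩ := hbase n hn h hh
    have hn2 : (2 : ℝ) ≤ n := by exact_mod_cast hn
    have hn0 : (0 : ℝ) < n := by linarith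
    have hlog2 : Real.log 2 ≤ Real.log n := Real.log_le_log two_pos hn2
    have hlog : 1 / 4 ≤ Real.log n := by linarith [Real.log_two_gt_d9]
    have hhr : h = (n : ℝ) ^ (-(1 / (2 * p))) := by
      rw [hh, hβ, max_eq_right (by norm_num), add_zero]
    refine ⟨h0, h1, √(2 * c ^ 2 * (2 * Real.log n)), Real.sqrt_nonneg _,
      hσ (by positivity) (by positivity) ?_, ?_⟩
    · have hT : 1 / h ≤ n := by
        rw [hhr, Real.rpow_neg hn0.le, one_div, inv_inv]
        calc (n : ℝ) ^ (1 / (2 * p)) ≤ (n : ℝ) ^ (1 : ℝ) :=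
              Real.rpow_le_rpow_of_exponent_le (by linarith)
                (by rw [div_le_one (by positivity)]; linarith)
          _ = n := Real.rpow_one _
      have h2 : (2 * β - 2) = -1 := by rw [hβ]; norm_num
      have h3 : 0 < 1 / h := by positivity
      simp only [h2, Real.rpow_neg_one]
      rw [integral_inv_of_pos one_pos (by positivity), div_one, ← Nat.cast_two (R := ℝ),
        ← Real.log_pow]
      exact Real.log_le_log (by positivity) (by nlinarith)
    · have h2 : h ^ p = (n : ℝ) ^ (-(1 / 2) : ℝ) := by
        rw [hhr, ← Real.rpow_mul hn0.le]
        congr 1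
        field_simp
      have h3 : ordinaryRate p β n = (n : ℝ) ^ (-(1 / 2) : ℝ) * √(Real.log n) := by
        rw [ordinaryRate, if_neg (by linarith), if_pos hβ, Real.rpow_neg hn0.le,
          ← Real.sqrt_eq_rpow, Real.sqrt_div (by linarith), div_eq_inv_mul]
      have h4 : √(2 * c ^ 2 * (2 * Real.log n)) = 2 * c * √(Real.log n) := by
        rw [show 2 * c ^ 2 * (2 * Real.log n) = (2 * c) ^ 2 * Real.log n by ring,
          Real.sqrt_mul (sq_nonneg _), Real.sqrt_sq (by positivity)]
      -- The two terms without a logarithm are absorbed at the cost of the constant 4.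
      have h5 : 1 / 2 ≤ √(Real.log n) := Real.le_sqrt_of_sq_le (by linarith)
      have h6 : 0 ≤ (n : ℝ) ^ (-(1 / 2) : ℝ) := by positivity
      rw [h2, h3, h4]
      nlinarith [mul_le_mul_of_nonneg_left h5 h6]
  · set a := 2 * β - 1 with ha
    have ha0 : 0 < a := by linarith
    set E := √(2 * c ^ 2 * (2 ^ a / a))
    refine ⟨2 + E, by positivity, fun n hn h hh => ?_⟩
    obtain ⟨h0, h1⟩ := hbase n hn h hh
    have hn1 : (1 : ℝ) ≤ n := by exact_mod_cast (by omega : 1 ≤ n)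
    have hn0 : (0 : ℝ) < n := by linarith
    have hT1 : 1 ≤ 1 / h := one_le_one_div h0 h1
    rw [max_eq_left ha0.le] at hh
    have hB0 : 0 ≤ (2 * (1 / h)) ^ a / a := by positivity
    refine ⟨h0, h1, √(2 * c ^ 2 * ((2 * (1 / h)) ^ a / a)), Real.sqrt_nonneg _,
      hσ (by positivity) hB0 ?_, ?_⟩
    · rw [integral_ordinary_eq hβ.ne' (by positivity), ← ha]
      have : (1 + 1 / h) ^ a ≤ (2 * (1 / h)) ^ a :=
        Real.rpow_le_rpow (by positivity) (by linarith) ha0.le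
      exact div_le_div_of_nonneg_right (by linarith) ha0.le
    · set R := (n : ℝ) ^ (-(p / (2 * p + a))) with hR
      have h2 : h ^ p = R := by
        rw [hh, ← Real.rpow_mul hn0.le, hR]
        congr 1
        field_simp
      have h3 : ordinaryRate p β n = R := by
        rw [ordinaryRate, if_pos hβ, hR, ha, add_sub_assoc]
      have h4 : √(2 * c ^ 2 * ((2 * (1 / h)) ^ a / a)) = E * (n : ℝ) ^ (a / (2 * (2 * p + a))) := by
        rw [Real.mul_rpow zero_le_two (by positivity), mul_div_right_comm, ← mul_assoc,
          Real.sqrt_mul (by positivity), hh, Real.rpow_neg hn0.le, one_div, inv_inv,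
          Real.sqrt_eq_rpow (_ ^ a), ← Real.rpow_mul hn0.le, ← Real.rpow_mul hn0.le]
        congr 2
        field_simp
      -- The bandwidth is the one that balances the stochastic term n^(-1/2) h^(-a/2) and the bias
      -- h^p.
      have h5 : (n : ℝ) ^ (-(1 / 2) : ℝ) * (n : ℝ) ^ (a / (2 * (2 * p + a))) = R := by
        rw [← Real.rpow_add hn0, hR]
        congr 1
        field_simp
        ring
      have h6 : (n : ℝ) ^ (-(1 / 2) : ℝ) ≤ R := by
        rw [hR]
        refine Real.rpow_le_rpow_of_exponent_le hn1 (neg_le_neg ?_)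
        rw [div_le_div_iff₀ (by positivity) two_pos]
        linarith
      rw [h2, h3, h4]
      calc (n : ℝ) ^ (-(1 / 2) : ℝ) * (1 + E * (n : ℝ) ^ (a / (2 * (2 * p + a)))) + R
          = (n : ℝ) ^ (-(1 / 2) : ℝ) +
            E * ((n : ℝ) ^ (-(1 / 2) : ℝ) * (n : ℝ) ^ (a / (2 * (2 * p + a)))) + R := by ring
        _ ≤ R + E * R + R := by rw [h5]; gcongr
        _ = (2 + E) * R := by ring

/-- With x = log n, it lets a power n^(1/4) absorb powers of log n. It is x ≤ 4s e^{x/(4s)} raised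
to the power s. -/
theorem exists_rpow_le_mul_exp {s : ℝ} (hs : 0 < s) :
    ∃ D : ℝ, 0 < D ∧ ∀ x : ℝ, 0 ≤ x → x ^ s ≤ D * Real.exp (x / 4) := by
  refine ⟨(4 * s) ^ s, by positivity, fun x hx => ?_⟩
  have h1 : x ≤ 4 * s * Real.exp (x / (4 * s)) := by
    rw [← div_le_iff₀' (by positivity)]
    linarith [Real.add_one_le_exp (x / (4 * s))]
  calc x ^ s ≤ (4 * s * Real.exp (x / (4 * s))) ^ s := Real.rpow_le_rpow hx h1 hs.le
    _ = _ := by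
      rw [Real.mul_rpow (by positivity) (Real.exp_pos _).le, ← Real.exp_mul]
      congr 2
      field_simp

/-- The variance and the squared bias in the supersmooth case. -/
theorem exists_supersmooth_le {p β βt γ c : ℝ} (hp : 1 ≤ p) (hβ : 0 < β) (hβt : 0 ≤ βt)
    (hγ : 0 < γ) (hc : 0 < c) :
    ∃ D : ℝ, 0 < D ∧ ∀ n : ℕ, 2 ≤ n → ∀ h : ℝ,
      h = (4 / (γ * Real.log n)) ^ (1 / β) → 0 < h ∧ h ≤ (4 / (γ * Real.log 2)) ^ (1 / β) ∧
      ∃ σ : ℝ, 0 ≤ σ ∧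
        ∫⁻ w in Icc (-(1 / h)) (1 / h), ENNReal.ofReal
          ((c * (1 + |w|) ^ βt * Real.exp (|w| ^ β / γ) / (1 + |w|)) ^ 2) ≤
            ENNReal.ofReal (σ ^ 2) ∧
        (n : ℝ) ^ (-(1 / 2) : ℝ) * (1 + σ) + h ^ p ≤ D * Real.log n ^ (-(p / β)) := by
  -- The first summand of the exponent is the growth of the polynomial part of σ in log n; the
  -- second leaves the rate (log n)^(-p/β).
  obtain ⟨A, hA, hAle⟩ := exists_rpow_le_mul_exp (s := (βt + 1) / β + p / β) (by positivity)
  have hl2 := Real.log_pos one_lt_two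
  set B : ℝ := (1 / Real.log 2) ^ (1 / β) + (γ / 4) ^ (1 / β) with hB
  have hB0 : 0 < B := by positivity
  refine ⟨(1 + 2 * c) * B ^ (βt + 1) * A + (4 / γ) ^ (p / β), by positivity, fun n hn h hh => ?_⟩
  have hn2 : (2 : ℝ) ≤ n := by exact_mod_cast hn
  have hn0 : (0 : ℝ) < n := by linarith
  have hlog2 : Real.log 2 ≤ Real.log n := Real.log_le_log two_pos hn2
  set L := Real.log n with hL
  have hL0 : 0 < L := hl2.trans_le hlog2
  have h0 : 0 < h := by rw [hh]; positivity
  have hT : 1 / h = (γ / 4) ^ (1 / β) * L ^ (1 / β) := by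
    rw [hh, one_div, ← Real.inv_rpow (by positivity), inv_div,
      ← Real.mul_rpow (by positivity) hL0.le, mul_div_right_comm]
  have hT0 : 0 < 1 / h := by positivity
  have hTB : 1 + 1 / h ≤ B * L ^ (1 / β) := by
    rw [hT, hB, add_mul]
    gcongr
    rw [← Real.mul_rpow (by positivity) hL0.le]
    refine Real.one_le_rpow ?_ (by positivity)
    rw [one_div_mul_eq_div, one_le_div hl2]
    exact hlog2
  have hexp : ∀ a : ℝ, (n : ℝ) ^ a = Real.exp (L * a) := fun a => Real.rpow_def_of_pos hn0 a
  set V := (1 + 1 / h) ^ (βt + 1) with hV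
  have hV1 : 1 ≤ V := Real.one_le_rpow (by linarith) (by linarith)
  -- The choice of σ bounds the integrand by its supremum; the extra power of 1 + 1/h in V and the
  -- factor 2 account for the length of the interval.
  refine ⟨h0, ?_, 2 * c * V * Real.exp (L / 4), by positivity, ?_, ?_⟩
  · rw [hh]
    gcongr
  · have hpt : ∀ w ∈ Icc (-(1 / h)) (1 / h), ENNReal.ofReal
        ((c * (1 + |w|) ^ βt * Real.exp (|w| ^ β / γ) / (1 + |w|)) ^ 2) ≤
          ENNReal.ofReal ((c * (1 + 1 / h) ^ βt * Real.exp (L / 4)) ^ 2) := fun w hw => by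
      have hw' : |w| ≤ 1 / h := abs_le.2 hw
      have hw0 := abs_nonneg w
      -- The constant 4 in the bandwidth limits the exponential to n^(1/4), so that n^(-1/2) σ still
      -- decays like n^(-1/4) up to logarithms.
      have he : |w| ^ β / γ ≤ L / 4 := by
        rw [div_le_iff₀ hγ]
        calc |w| ^ β ≤ (1 / h) ^ β := Real.rpow_le_rpow hw0 hw' hβ.le
          _ = L / 4 * γ := by
            rw [hT, ← Real.mul_rpow (by positivity) hL0.le, ← Real.rpow_mul (by positivity),
              one_div_mul_cancel hβ.ne', Real.rpow_one]
            ring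
      refine ENNReal.ofReal_le_ofReal (pow_le_pow_left₀ (by positivity) ?_ 2)
      refine (div_le_self (by positivity) (by linarith)).trans ?_
      gcongr
    refine (setLIntegral_mono' measurableSet_Icc hpt).trans ?_
    rw [setLIntegral_const, Real.volume_Icc, ← ENNReal.ofReal_mul (sq_nonneg _)]
    refine ENNReal.ofReal_le_ofReal ?_
    have hV' : V = (1 + 1 / h) ^ βt * (1 + 1 / h) := Real.rpow_add_one (by positivity) _
    rw [hV']
    have : 1 / h - -(1 / h) ≤ (2 * (1 + 1 / h)) ^ 2 := by nlinarith
    calc (c * (1 + 1 / h) ^ βt * Real.exp (L / 4)) ^ 2 * (1 / h - -(1 / h))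
        ≤ (c * (1 + 1 / h) ^ βt * Real.exp (L / 4)) ^ 2 * (2 * (1 + 1 / h)) ^ 2 := by gcongr
      _ = _ := by ring
  · have hhp : h ^ p = (4 / γ) ^ (p / β) * L ^ (-(p / β)) := by
      rw [hh, ← Real.rpow_mul (by positivity), one_div_mul_eq_div, ← div_div,
        Real.div_rpow (by positivity) hL0.le, Real.rpow_neg hL0.le, div_eq_mul_inv]
    have hVB : V ≤ B ^ (βt + 1) * L ^ ((βt + 1) / β) := by
      calc V ≤ (B * L ^ (1 / β)) ^ (βt + 1) :=
            Real.rpow_le_rpow (by positivity) hTB (by linarith)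
        _ = _ := by
          rw [Real.mul_rpow hB0.le (by positivity), ← Real.rpow_mul hL0.le, one_div_mul_eq_div]
    have hLA : L ^ ((βt + 1) / β) * Real.exp (-(L / 4)) ≤ A * L ^ (-(p / β)) := by
      have h1 := hAle L hL0.le
      rw [Real.rpow_add hL0] at h1
      rw [Real.exp_neg, Real.rpow_neg hL0.le, ← div_eq_mul_inv, ← div_eq_mul_inv,
        div_le_div_iff₀ (Real.exp_pos _) (by positivity)]
      exact h1
    have he1 : Real.exp (L * -(1 / 2)) = Real.exp (-(L / 4)) * Real.exp (-(L / 4)) := by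
      rw [← Real.exp_add]
      congr 1
      ring
    have he2 : Real.exp (-(L / 4)) * Real.exp (L / 4) = 1 := by
      rw [← Real.exp_add]
      simp
    have he3 : Real.exp (-(L / 4)) ≤ 1 := Real.exp_le_one_iff.2 (by linarith)
    rw [hhp, hexp, he1, add_mul]
    gcongr ?_ + _
    set e := Real.exp (-(L / 4)) with he
    have he0 : 0 < e := Real.exp_pos _
    calc e * e * (1 + 2 * c * V * Real.exp (L / 4))
        = e * e * 1 + 2 * c * V * e * (e * Real.exp (L / 4)) := by ring
      _ ≤ e * 1 * V + 2 * c * V * e * 1 := by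
        rw [he2]
        gcongr
      _ = (1 + 2 * c) * (V * e) := by ring
      _ ≤ (1 + 2 * c) * (B ^ (βt + 1) * L ^ ((βt + 1) / β) * e) := by gcongr
      _ = (1 + 2 * c) * B ^ (βt + 1) * (L ^ ((βt + 1) / β) * e) := by ring
      _ ≤ (1 + 2 * c) * B ^ (βt + 1) * (A * L ^ (-(p / β))) := by gcongr
      _ = _ := by ring

end WassersteinDeconvolution

end

/-! ### The theorem -/

open WassersteinDeconvolution in
theorem theorem1
    (p : ℝ) (hp : 1 ≤ p)
    -- the kernel, the unknown law `μ` and the known noise law `με`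
    (k : ℝ → ℝ) (hk : IsKernel p k)
    (μ με : Measure ℝ) [IsProbabilityMeasure μ] [IsProbabilityMeasure με]
    -- `r = 1 / με^*` is well defined and twice continuously differentiable
    (hne : ∀ t, charFun με t ≠ 0)
    (hC2 : ContDiff ℝ 2 (invCharFun με))
    -- the derivatives of `r` that occur below exist
    (hdiff₁ : ∀ ℓ < mOne p, Differentiable ℝ (iteratedDeriv ℓ (invCharFun με)))
    (hdiff₀ : ∀ ℓ < mZero p, ∀ t ∈ Icc (-2 : ℝ) 2,
      DifferentiableAt ℝ (iteratedDeriv ℓ (invCharFun με)) t)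
    -- the tail condition, `μ ∗ με` being the law of the observations
    (htail : ∫⁻ x in Ioi (0 : ℝ),
      ENNReal.ofReal (|x| ^ (p - 1) * √((μ.conv με).real {y | x ≤ |y|})) < ∞)
    (hsup : ∃ M : ℝ, ∀ t ∈ Icc (-2 : ℝ) 2, ‖iteratedDeriv (mZero p) (invCharFun με) t‖ ≤ M) :
    -- the supersmooth case
    (∀ β βt γ c : ℝ, 0 < β → 0 ≤ βt → 0 < γ → 0 < c →
      (∀ ℓ ≤ mOne p, ∀ t : ℝ, ‖iteratedDeriv ℓ (invCharFun με) t‖ ≤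
        c * (1 + |t|) ^ βt * Real.exp (|t| ^ β / γ)) →
      ∃ C : ℝ, 0 < C ∧ ∀ n : ℕ, 2 ≤ n →
        ∀ (Ω : Type*) [MeasurableSpace Ω] (P : Measure Ω) [IsProbabilityMeasure P]
          (X ε : Fin n → Ω → ℝ) (ρ : ℝ) (μt : Ω → Measure ℝ),
          IsConvolutionSample P μ με X ε →
          0 ≤ ρ → ρ ≤ (n : ℝ) ^ (-(1 / 2) : ℝ) →
          IsIsotoneEstimator p ρ k με ((4 / (γ * Real.log n)) ^ (1 / β)) X ε μt →
          ∫⁻ ω, wasserstein p (μt ω) μ ^ p ∂P ≤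
            ENNReal.ofReal (C * Real.log n ^ (-(p / β)))) ∧
    -- the ordinary smooth case
    (∀ β c : ℝ, 0 < β → 0 < c →
      (∀ ℓ ≤ mOne p, ∀ t : ℝ, ‖iteratedDeriv ℓ (invCharFun με) t‖ ≤ c * (1 + |t|) ^ β) →
      ∃ C : ℝ, 0 < C ∧ ∀ n : ℕ, 2 ≤ n →
        ∀ (Ω : Type*) [MeasurableSpace Ω] (P : Measure Ω) [IsProbabilityMeasure P]
          (X ε : Fin n → Ω → ℝ) (ρ : ℝ) (μt : Ω → Measure ℝ),
          IsConvolutionSample P μ με X ε →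
          0 ≤ ρ → ρ ≤ (n : ℝ) ^ (-(1 / 2) : ℝ) →
          IsIsotoneEstimator p ρ k με ((n : ℝ) ^ (-(1 / (2 * p + max (2 * β - 1) 0)))) X ε μt →
          ∫⁻ ω, wasserstein p (μt ω) μ ^ p ∂P ≤ ENNReal.ofReal (C * ordinaryRate p β n)) := by
  have hC1 : ContDiff ℝ 1 (invCharFun με) := hC2.of_le (by norm_num)
  refine ⟨fun β βt γ c hβ hβt hγ hc hbd => ?_, fun β c hβ hc hbd => ?_⟩
  · obtain ⟨D, hD, hrate⟩ := exists_supersmooth_le hp hβ hβt hγ hc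
    have hbc : Continuous fun t : ℝ => c * (1 + |t|) ^ βt * Real.exp (|t| ^ β / γ) := by
      have h1 : Continuous fun t : ℝ => (1 + |t|) ^ βt :=
        (continuous_const.add continuous_abs).rpow_const fun _ => .inr hβt
      have h2 : Continuous fun t : ℝ => |t| ^ β := continuous_abs.rpow_const fun _ => .inr hβ.le
      fun_prop
    -- The bandwidth decreases in n, so its value at n = 2 serves as the uniform bound `H`.
    obtain ⟨K, hK, hrisk⟩ := hk.exists_risk_le hp μ hne hC1 hdiff₀ hsup htail hbc
      (.of_iteratedDeriv (fun ℓ hℓ t _ => hdiff₁ ℓ hℓ t) fun ℓ hℓ t _ => hbd ℓ hℓ t)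
      (H := (4 / (γ * Real.log 2)) ^ (1 / β)) (by have := Real.log_pos one_lt_two; positivity)
    refine ⟨K * D, by positivity, fun n hn Ω _ P _ X ε ρ μt hs _ hρ hest => ?_⟩
    obtain ⟨h0, hH, σ, hσ, hS, hle⟩ := hrate n hn _ rfl
    refine (hrisk n _ σ (by omega) h0 hH hσ hS Ω P X ε ρ μt hs hρ hest).trans
      (ENNReal.ofReal_le_ofReal ?_)
    rw [mul_assoc]
    exact mul_le_mul_of_nonneg_left hle hK.le
  · obtain ⟨D, hD, hrate⟩ := exists_ordinary_le (β := β) hp hc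
    have hbc : Continuous fun t : ℝ => c * (1 + |t|) ^ β :=
      continuous_const.mul
        ((continuous_const.add continuous_abs).rpow_const fun _ => .inr hβ.le)
    obtain ⟨K, hK, hrisk⟩ := hk.exists_risk_le hp μ hne hC1 hdiff₀ hsup htail hbc
      (.of_iteratedDeriv (fun ℓ hℓ t _ => hdiff₁ ℓ hℓ t) fun ℓ hℓ t _ => hbd ℓ hℓ t) zero_le_one
    refine ⟨K * D, by positivity, fun n hn Ω _ P _ X ε ρ μt hs _ hρ hest => ?_⟩
    obtain ⟨h0, hH, σ, hσ, hS, hle⟩ := hrate n hn _ rfl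
    refine (hrisk n _ σ (by omega) h0 hH hσ hS Ω P X ε ρ μt hs hρ hest).trans
      (ENNReal.ofReal_le_ofReal ?_)
    rw [mul_assoc]
    exact mul_le_mul_of_nonneg_left hle hK.le
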